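/- Let $n\ge 1$ and $s\in(0,1)$. There is a constant $\Theta=\Theta(n,s)>1$, depending only on $n$ and $s$, with the following property. Let $\Omega\subset\mathbb R^n$ be a bounded open set with Lipschitz boundary, $A\subset\Omega$ open, $\psi\in L^\infty(A)$, and let $\varphi:\mathbb R^n\to\mathbb R$ be measurable with $\varphi\in L^\infty(\Omega_{\Theta\,\mathrm{diam}(\Omega)}\setminus\Omega)$, where $\Omega_\delta=\{x\in\mathbb R^n: d(x,\Omega)-d(x,\mathbb R^n\setminus\Omega)<\delta\}$. Equalities and inclusions of functions and sets below are understood up to Lebesgue null sets, and $\mathcal C$ denotes the complement. Let $\mathcal W^s_{\varphi,\psi}(\Omega,A)$ be the set of all $u:\mathbb R^n\to\mathbb R$ with $u|_\Omega\in W^{s,1}(\Omega)$, $u=\varphi$ in $\mathcal C\Omega$ and $u\ge\psi$ in $A$. Put $\mathcal G_s(t)=\int_0^t\int_0^\tau(1+r^2)^{-\frac{n+1+s}2}\,dr\,d\tau$ and $Q(\Omega)=\mathbb R^{2n}\setminus(\mathcal C\Omega)^2$. A function $u\in\mathcal W^s_{\varphi,\psi}(\Omega,A)$ solves the obstacle problem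 if for every $v\in\mathcal W^s_{\varphi,\psi}(\Omega,A)$ the following integral converges absolutely and satisfies $$\iint_{Q(\Omega)}\Big\{\mathcal G_s\Big(\frac{u(x)-u(y)}{|x-y|}\Big)-\mathcal G_s\Big(\frac{v(x)-v(y)}{|x-y|}\Big)\Big\}\frac{dx\,dy}{|x-y|^{n-1+s}}\le 0 .$$ Write $\mathrm{Sg}(u,A)=\{(x,t)\in A\times\mathbb R: t<u(x)\}$, $\mathrm{Sg}(u)=\mathrm{Sg}(u,\mathbb R^n)$, $\Omega^M=\Omega\times(-M,M)$, $\Omega^\infty=\Omega\times\mathbb R$, and, for measurable $E\subset\mathbb R^{n+1}$ and $\mathcal O\subset\mathbb R^{n+1}$ open, $$\mathrm{Per}_s(E,\mathcal O)=\iint_{\mathbb R^{2(n+1)}\setminus(\mathcal C\mathcal O)^2}\frac{|\chi_E(X)-\chi_E(Y)|}{|X-Y|^{n+1+s}}\,dX\,dY\in[0,\infty].$$ Then the obstacle problem has a solution $u$, and it is unique up to null sets. Its subgraph $E=\mathrm{Sg}(u)$ solves the geometric obstacle problem, that is: $E\setminus\Omega^\infty=\mathrm{Sg}(\varphi)\setminus\Omega^\infty$,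 $\mathrm{Sg}(\psi,A)\subset E$, and for every real $M\ge\|\psi\|_{L^\infty(A)}$ one has $\mathrm{Per}_s(E,\Omega^M)<\infty$ and $$\mathrm{Per}_s(E,\Omega^M)\le\mathrm{Per}_s(F,\Omega^M)$$ for every measurable set $F\subset\mathbb R^{n+1}$ (not necessarily a subgraph) with $F\setminus\Omega^M=E\setminus\Omega^M$ and $\mathrm{Sg}(\psi,A)\subset F$. -/

import Mathlib

open MeasureTheory

noncomputable section

namespace NonlocalObstacle

/-- The Euclidean space `ℝⁿ`. -/
abbrev Rn (n : ℕ) : Type := EuclideanSpace ℝ (Fin n)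

/-- The space `ℝⁿ⁺¹ = ℝⁿ × ℝ`, with points `X = (x, x_{n+1})` and with Lebesgue (product) measure.
The Euclidean distance on it is `dist₂` below (the product type itself carries the sup distance,
which is not used). -/
abbrev RnSucc (n : ℕ) : Type := Rn n × ℝ

variable {n : ℕ}

/-- The Euclidean distance `|X - Y|` in `ℝⁿ⁺¹`. -/
def dist₂ (X Y : RnSucc n) : ℝ := Real.sqrt (‖X.1 - Y.1‖ ^ 2 + (X.2 - Y.2) ^ 2)

/-! ### Domains -/

/-- Lipschitz boundary: near each boundary point, after the choice of a direction `e`, the set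
`Ω` is the strict epigraph in direction `e` of a Lipschitz function `γ` of the component
`x - ⟨e, x⟩ e` of `x` orthogonal to `e`. -/
def HasLipschitzBoundary (Ω : Set (Rn n)) : Prop :=
  ∀ p ∈ frontier Ω, ∃ (e : Rn n) (r : ℝ) (K : NNReal) (γ : Rn n → ℝ),
    ‖e‖ = 1 ∧ 0 < r ∧ LipschitzWith K γ ∧
      ∀ x ∈ Metric.ball p r, x ∈ Ω ↔ γ (x - inner ℝ e x • e) < inner ℝ e x

/-- The signed distance from the boundary of `Ω`, negative inside `Ω`. -/
def signedDist (Ω : Set (Rn n)) (x : Rn n) : ℝ := Metric.infDist x Ω - Metric.infDist x Ωᶜ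

/-- The neighbourhood `Ω_δ`. -/
def nbhd (Ω : Set (Rn n)) (δ : ℝ) : Set (Rn n) := {x | signedDist Ω x < δ}

/-- The cylinder `Ω^M = Ω × (-M, M)`. -/
def cylinder (Ω : Set (Rn n)) (M : ℝ) : Set (RnSucc n) := Ω ×ˢ Set.Ioo (-M) M

/-- The infinite cylinder `Ω^∞ = Ω × ℝ`. -/
def infCylinder (Ω : Set (Rn n)) : Set (RnSucc n) := Ω ×ˢ Set.univ

/-- The subgraph of `u` over `A`. -/
def subgraph (u : Rn n → ℝ) (A : Set (Rn n)) : Set (RnSucc n) := {X | X.1 ∈ A ∧ X.2 < u X.1}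

/-! ### The functional obstacle problem -/

/-- `g_s(t) = (1 + t²)^{-(n+1+s)/2}`. -/
def g (n : ℕ) (s t : ℝ) : ℝ := 1 / (1 + t ^ 2) ^ (((n : ℝ) + 1 + s) / 2)

/-- `G_s`, the primitive of `g_s` vanishing at `0`. -/
def G (n : ℕ) (s t : ℝ) : ℝ := ∫ τ in (0 : ℝ)..t, g n s τ

/-- `𝒢_s`, the primitive of `G_s` vanishing at `0`. -/
def GG (n : ℕ) (s t : ℝ) : ℝ := ∫ τ in (0 : ℝ)..t, G n s τ

/-- The Gagliardo seminorm `[u]_{W^{s,1}(Ω)}`, with values in `[0, ∞]`. -/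
def gagliardo (s : ℝ) (Ω : Set (Rn n)) (u : Rn n → ℝ) : ENNReal :=
  ∫⁻ x in Ω, ∫⁻ y in Ω, ENNReal.ofReal (|u x - u y| / ‖x - y‖ ^ ((n : ℝ) + s))

/-- `𝒲^s(Ω)`: functions on `ℝⁿ` whose restriction to `Ω` belongs to `W^{s,1}(Ω)`. -/
def W (s : ℝ) (Ω : Set (Rn n)) : Set (Rn n → ℝ) :=
  {u | IntegrableOn u Ω ∧ gagliardo s Ω u < ⊤}

/-- `𝒲^s_{φ,ψ}(Ω, A)`: functions of `𝒲^s(Ω)` with exterior datum `φ` and obstacle `ψ` in `A`. -/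
def WObs (s : ℝ) (Ω A : Set (Rn n)) (φ ψ : Rn n → ℝ) : Set (Rn n → ℝ) :=
  {u | u ∈ W s Ω ∧ (∀ᵐ x, x ∉ Ω → u x = φ x) ∧ (∀ᵐ x, x ∈ A → ψ x ≤ u x)}

/-- `Q(Ω) = ℝ²ⁿ ∖ (𝒞Ω)²`. -/
def Q (Ω : Set (Rn n)) : Set (Rn n × Rn n) := (Ωᶜ ×ˢ Ωᶜ)ᶜ

/-- The integrand of the difference of the fractional areas of `u` and `v`. -/
def areaDiff (s : ℝ) (u v : Rn n → ℝ) (p : Rn n × Rn n) : ℝ :=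
  (GG n s ((u p.1 - u p.2) / ‖p.1 - p.2‖) - GG n s ((v p.1 - v p.2) / ‖p.1 - p.2‖)) /
    ‖p.1 - p.2‖ ^ ((n : ℝ) - 1 + s)

/-- `u` solves the obstacle problem: it belongs to `𝒲^s_{φ,ψ}(Ω, A)`, and for every competitor `v`
the integral of the difference of the area densities of `u` and `v` over `Q(Ω)` converges
and is nonpositive. -/
def SolvesObstacle (s : ℝ) (Ω A : Set (Rn n)) (φ ψ : Rn n → ℝ) (u : Rn n → ℝ) : Prop :=
  u ∈ WObs s Ω A φ ψ ∧ ∀ v ∈ WObs s Ω A φ ψ,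
    IntegrableOn (areaDiff s u v) (Q Ω) ∧ ∫ p in Q Ω, areaDiff s u v p ≤ 0

/-! ### The geometric obstacle problem -/

/-- The `s`-fractional perimeter of `E` in `O`,
the integral of `|χ_E(X) - χ_E(Y)| / |X - Y|^{n+1+s}` over the complement of `(𝒞O)²`. -/
def fracPer (s : ℝ) (E O : Set (RnSucc n)) : ENNReal :=
  ∫⁻ p in (Oᶜ ×ˢ Oᶜ : Set (RnSucc n × RnSucc n))ᶜ,
    ENNReal.ofReal (|E.indicator (fun _ => (1 : ℝ)) p.1 - E.indicator (fun _ => (1 : ℝ)) p.2| /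
      dist₂ p.1 p.2 ^ ((n : ℝ) + 1 + s))

/-- `E` solves the geometric obstacle problem. As usual for measurable sets, equalities and
inclusions are up to Lebesgue null sets (`=ᵐ` and `≤ᵐ`). The competitors `F` are arbitrary
measurable sets. -/
def SolvesGeometricObstacle (s : ℝ) (Ω A : Set (Rn n)) (φ ψ : Rn n → ℝ)
    (E : Set (RnSucc n)) : Prop :=
  NullMeasurableSet E ∧
  (E \ infCylinder Ω : Set (RnSucc n)) =ᵐ[volume]
    (subgraph φ Set.univ \ infCylinder Ω : Set (RnSucc n)) ∧
  subgraph ψ A ≤ᵐ[volume] E ∧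
  ∀ M : ℝ, 0 ≤ M → eLpNorm ψ ⊤ (volume.restrict A) ≤ ENNReal.ofReal M →
    fracPer s E (cylinder Ω M) < ⊤ ∧
    ∀ F : Set (RnSucc n), NullMeasurableSet F →
      (F \ cylinder Ω M : Set (RnSucc n)) =ᵐ[volume] (E \ cylinder Ω M : Set (RnSucc n)) →
      subgraph ψ A ≤ᵐ[volume] F →
      fracPer s E (cylinder Ω M) ≤ fracPer s F (cylinder Ω M)

end NonlocalObstacle

end

open NonlocalObstacle

/-!
The graph of a function is compared with arbitrary sets one pair of vertical fibres at a time.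
For two fibres at horizontal distance `r`, with characteristic functions `a` and `b`, and for the
kernel `k(h) = (r² + h²)^{-(n+1+s)/2}`, one has

  `∬ |a(t) - b(τ)| k(t - τ) dt dτ = ∫ k(h) ∫ |a(t) - b(t - h)| dt dh ≥ ∫ k(h) |α - β - h| dh`,

where `α` and `β` are the renormalized lengths of the fibres, and equality holds if the fibres are
half-lines with end points `α` and `β` (`lintegral_le_interaction`, `interaction_halfLine`). The
right-hand side equals `2 𝒢_s((α - β)/r) / r^{n-1+s}` up to a term depending on `r` only
(`integral_g_mul_abs_sub`, `lintegral_fibreKernel_mul_abs_sub`). A competitor `F` for the subgraph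
of `u` therefore yields a function, its rearrangement `rearr F u`, which is a competitor for `u` in
the functional problem, and the perimeter of `F` exceeds that of the subgraph by at least twice the
difference of the areas (`fibrePart_add_areaDiff_le`, integrated over `Q(Ω)` in
`SolvesObstacle.fracPer_subgraph_le`). As `F` and the subgraph differ only in a bounded cylinder,
the infinite contributions cancel before integration, and the boundedness of `u` is not needed.

The functional problem is well posed because `𝒢_s` is strictly convex and has linear growth. Since
`s < 1`, functions of `W^{s,1}(Ω)` satisfy a fractional Hardy inequality on Lipschitz domains
without any boundary condition (`hardy`): in a boundary chart, `|w(x)|` is compared with the value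
at a point higher by a multiple of the height of `x`, and the integral of the latter is absorbed, the
constant `∫_2^3 σ^{s-1} dσ` being less than `1`. The Hardy inequality makes all area differences
integrable over `Q(Ω)` (`integrableOn_areaDiff`) and also bounds the perimeter of the subgraph
(`fracPer_subgraph_lt_top`). Strict convexity gives uniqueness (`SolvesObstacle.unique`).

Existence rests on a truncation estimate (`integral_areaDiff_truncOn_le`). Truncating `v` in `Ω` at
a high level `N` lowers the interaction of `x ∈ Ω` with the points outside `Ω` at distance between
`2 diam Ω` and `4 diam Ω`, where the exterior datum is bounded, and can raise it only for points at
distance at least `Θ diam Ω`, where the datum is unrestricted but the kernel has small mass; the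
choice of `Θ` in `exists_width` makes the gain dominate. It thus suffices to minimize among
functions bounded by `N` in `Ω`, which the direct method in `L²(Ω)` achieves
(`exists_minimizer_bdd`).
-/

/-! ### The profile `g_s` and its primitives -/

namespace NonlocalObstacle

theorem g_nonneg (n : ℕ) (s t : ℝ) : 0 ≤ g n s t := by
  unfold g; positivity

theorem g_pos (n : ℕ) (s t : ℝ) : 0 < g n s t := by
  unfold g; positivity

theorem g_neg (n : ℕ) (s t : ℝ) : g n s (-t) = g n s t := by
  unfold g; simp

theorem g_eq_rpow (n : ℕ) (s t : ℝ) : g n s t = (1 + t ^ 2) ^ (-((n : ℝ) + 1 + s) / 2) := by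
  unfold g
  rw [neg_div, Real.rpow_neg (by positivity), one_div]

theorem continuous_g (n : ℕ) (s : ℝ) : Continuous (g n s) := by
  have : g n s = fun t => (1 + t ^ 2) ^ (-((n : ℝ) + 1 + s) / 2) := funext (g_eq_rpow n s)
  rw [this]
  refine Continuous.rpow_const (by fun_prop) fun t => Or.inl ?_
  positivity

theorem integrable_g {n : ℕ} (hn : 1 ≤ n) {s : ℝ} (hs : 0 < s) : Integrable (g n s) := by
  have h1 : (1 : ℝ) ≤ n := by exact_mod_cast hn
  have := integrable_rpow_neg_one_add_norm_sq (E := ℝ) (μ := volume) (r := (n : ℝ) + 1 + s)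
    (by simp; linarith)
  refine this.congr (Filter.Eventually.of_forall fun t => ?_)
  simp [g_eq_rpow]

/-- The first moment of `g_s` is finite because `n + s > 1`. -/
theorem integrable_g_mul_abs {n : ℕ} (hn : 1 ≤ n) {s : ℝ} (hs : 0 < s) :
    Integrable (fun z => g n s z * |z|) := by
  have h1 : (1 : ℝ) ≤ n := by exact_mod_cast hn
  have := integrable_rpow_neg_one_add_norm_sq (E := ℝ) (μ := volume) (r := (n : ℝ) + s)
    (by simp; linarith)
  refine this.mono' ?_ (Filter.Eventually.of_forall fun t => ?_)
  · exact ((continuous_g n s).mul continuous_abs).aestronglyMeasurable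
  · have h0 : 0 < 1 + t ^ 2 := by positivity
    rw [Real.norm_of_nonneg (mul_nonneg (g_nonneg _ _ _) (abs_nonneg _)), g_eq_rpow]
    have h2 : |t| ≤ (1 + t ^ 2) ^ (1 / 2 : ℝ) := by
      rw [← Real.sqrt_eq_rpow]
      exact Real.abs_le_sqrt (by linarith)
    calc (1 + t ^ 2) ^ (-((n : ℝ) + 1 + s) / 2) * |t|
        ≤ (1 + t ^ 2) ^ (-((n : ℝ) + 1 + s) / 2) * (1 + t ^ 2) ^ (1 / 2 : ℝ) := by gcongr
      _ = (1 + ‖t‖ ^ 2) ^ (-((n : ℝ) + s) / 2) := by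
        rw [← Real.rpow_add h0, Real.norm_eq_abs, sq_abs]; congr 1; ring

/-- The total mass of `g_s`, an upper bound for `|G_s|`. -/
noncomputable def gMass (n : ℕ) (s : ℝ) : ℝ := ∫ z, g n s z

theorem hasDerivAt_G (n : ℕ) (s t : ℝ) : HasDerivAt (G n s) (g n s t) t :=
  intervalIntegral.integral_hasDerivAt_right ((continuous_g n s).intervalIntegrable _ _)
    ((continuous_g n s).stronglyMeasurableAtFilter _ _) (continuous_g n s).continuousAt

theorem continuous_G (n : ℕ) (s : ℝ) : Continuous (G n s) :=
  continuous_iff_continuousAt.2 fun t => (hasDerivAt_G n s t).continuousAt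

theorem hasDerivAt_GG (n : ℕ) (s t : ℝ) : HasDerivAt (GG n s) (G n s t) t :=
  intervalIntegral.integral_hasDerivAt_right ((continuous_G n s).intervalIntegrable _ _)
    ((continuous_G n s).stronglyMeasurableAtFilter _ _) (continuous_G n s).continuousAt

theorem continuous_GG (n : ℕ) (s : ℝ) : Continuous (GG n s) :=
  continuous_iff_continuousAt.2 fun t => (hasDerivAt_GG n s t).continuousAt

@[simp] theorem G_zero (n : ℕ) (s : ℝ) : G n s 0 = 0 := by simp [G]
@[simp] theorem GG_zero (n : ℕ) (s : ℝ) : GG n s 0 = 0 := by simp [GG]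

theorem G_neg (n : ℕ) (s t : ℝ) : G n s (-t) = - G n s t := by
  unfold G
  have := intervalIntegral.integral_comp_neg (g n s) (a := 0) (b := t)
  simp only [g_neg, neg_zero] at this
  rw [intervalIntegral.integral_symm, this]

theorem GG_neg (n : ℕ) (s t : ℝ) : GG n s (-t) = GG n s t := by
  unfold GG
  have := intervalIntegral.integral_comp_neg (G n s) (a := 0) (b := t)
  simp only [G_neg, neg_zero, intervalIntegral.integral_neg] at this
  rw [intervalIntegral.integral_symm, ← this, neg_neg]

theorem GG_abs (n : ℕ) (s t : ℝ) : GG n s |t| = GG n s t := by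
  rcases abs_choice t with h | h <;> rw [h]
  exact GG_neg n s t

theorem strictMono_G (n : ℕ) (s : ℝ) : StrictMono (G n s) :=
  strictMono_of_hasDerivAt_pos (fun t => hasDerivAt_G n s t) fun t => g_pos n s t

theorem G_one_pos (n : ℕ) (s : ℝ) : 0 < G n s 1 := by
  have := strictMono_G n s zero_lt_one
  simpa using this

theorem gMass_nonneg (n : ℕ) (s : ℝ) : 0 ≤ gMass n s := integral_nonneg fun z => g_nonneg n s z

theorem abs_G_le {n : ℕ} (hn : 1 ≤ n) {s : ℝ} (hs : 0 < s) (t : ℝ) : |G n s t| ≤ gMass n s := by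
  have key : ∀ t, 0 ≤ t → |G n s t| ≤ gMass n s := by
    intro t ht
    have h0 : 0 ≤ G n s t := by simpa using (strictMono_G n s).monotone ht
    rw [abs_of_nonneg h0, G, intervalIntegral.integral_of_le ht]
    exact setIntegral_le_integral (integrable_g hn hs)
      (Filter.Eventually.of_forall fun z => g_nonneg n s z)
  rcases le_total 0 t with h | h
  · exact key t h
  · have := key (-t) (by linarith)
    rwa [G_neg, abs_neg] at this

theorem strictConvexOn_GG (n : ℕ) (s : ℝ) : StrictConvexOn ℝ Set.univ (GG n s) := by
  refine StrictMono.strictConvexOn_univ_of_deriv (continuous_GG n s) ?_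
  have : deriv (GG n s) = G n s := funext fun t => (hasDerivAt_GG n s t).deriv
  rw [this]
  exact strictMono_G n s

/-- The graph of the convex function `𝒢_s` lies above its tangent lines. -/
theorem GG_tangent (n : ℕ) (s a b : ℝ) : GG n s a + G n s a * (b - a) ≤ GG n s b := by
  have hc := (strictConvexOn_GG n s).convexOn
  rcases lt_trichotomy a b with h | h | h
  · have := hc.le_slope_of_hasDerivAt (Set.mem_univ a) (Set.mem_univ b) h (hasDerivAt_GG n s a)
    rw [slope_def_field, le_div_iff₀ (by linarith)] at this
    linarith
  · simp [h]
  · have := hc.slope_le_of_hasDerivAt (Set.mem_univ b) (Set.mem_univ a) h (hasDerivAt_GG n s a)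
    rw [slope_def_field, div_le_iff₀ (by linarith)] at this
    linarith

theorem abs_GG_sub_le {n : ℕ} (hn : 1 ≤ n) {s : ℝ} (hs : 0 < s) (a b : ℝ) :
    |GG n s a - GG n s b| ≤ gMass n s * |a - b| := by
  have h1 := GG_tangent n s a b
  have h2 := GG_tangent n s b a
  have ha := abs_G_le hn hs a
  have hb := abs_G_le hn hs b
  have e1 : |G n s a * (b - a)| ≤ gMass n s * |a - b| := by
    rw [abs_mul, abs_sub_comm b a]; gcongr
  have e2 : |G n s b * (a - b)| ≤ gMass n s * |a - b| := by
    rw [abs_mul]; gcongr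
  rw [abs_le] at e1 e2 ⊢
  constructor <;> linarith [e1.1, e1.2, e2.1, e2.2]

theorem GG_nonneg (n : ℕ) (s t : ℝ) : 0 ≤ GG n s t := by
  simpa using GG_tangent n s 0 t

theorem GG_mono {n : ℕ} {s a b : ℝ} (h : |a| ≤ |b|) : GG n s a ≤ GG n s b := by
  have h1 := GG_tangent n s |a| |b|
  have h2 : 0 ≤ G n s |a| := by simpa using (strictMono_G n s).monotone (abs_nonneg a)
  rw [GG_abs, GG_abs] at h1
  nlinarith [mul_nonneg h2 (sub_nonneg.2 h)]

theorem GG_lower (n : ℕ) (s t : ℝ) : G n s 1 * (|t| - 1) ≤ GG n s t := by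
  have h1 := GG_tangent n s 1 |t|
  rw [GG_abs] at h1
  linarith [GG_nonneg n s 1]

theorem GG_midpoint (n : ℕ) (s a b : ℝ) : 2 * GG n s ((a + b) / 2) ≤ GG n s a + GG n s b := by
  have h1 := GG_tangent n s ((a + b) / 2) a
  have h2 := GG_tangent n s ((a + b) / 2) b
  nlinarith

theorem eq_of_GG_midpoint {n : ℕ} {s a b : ℝ}
    (h : GG n s a + GG n s b ≤ 2 * GG n s ((a + b) / 2)) : a = b := by
  by_contra hab
  have := (strictConvexOn_GG n s).2 (Set.mem_univ a) (Set.mem_univ b) hab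
    (show (0 : ℝ) < 1 / 2 by norm_num) (show (0 : ℝ) < 1 / 2 by norm_num) (by norm_num)
  simp only [smul_eq_mul] at this
  rw [show 1 / 2 * a + 1 / 2 * b = (a + b) / 2 by ring] at this
  linarith

theorem integrable_g_mul_abs_sub {n : ℕ} (hn : 1 ≤ n) {s : ℝ} (hs : 0 < s) (τ : ℝ) :
    Integrable (fun z => g n s z * |τ - z|) := by
  refine (((integrable_g hn hs).mul_const |τ|).add (integrable_g_mul_abs hn hs)).mono' ?_
    (Filter.Eventually.of_forall fun z => ?_)
  · exact ((continuous_g n s).mul (by fun_prop)).aestronglyMeasurable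
  · rw [Real.norm_of_nonneg (mul_nonneg (g_nonneg _ _ _) (abs_nonneg _))]
    simp only [Pi.add_apply]
    rw [← mul_add]
    gcongr
    · exact g_nonneg _ _ _
    · exact abs_sub _ _

theorem integral_Iic_sub_integral_Ioi_g {n : ℕ} (hn : 1 ≤ n) {s : ℝ} (hs : 0 < s) (t : ℝ) :
    (∫ z in Set.Iic t, g n s z) - ∫ z in Set.Ioi t, g n s z = 2 * G n s t := by
  have hi := integrable_g hn hs
  have e1 : ∫ z in Set.Ioi t, g n s z = ∫ z in Set.Iic (-t), g n s z := by
    have := integral_comp_neg_Iic (-t) (g n s)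
    simp only [g_neg, neg_neg] at this
    exact this.symm
  have e2 : (∫ z in Set.Iic t, g n s z) - ∫ z in Set.Iic (-t), g n s z
      = ∫ z in (-t)..t, g n s z :=
    intervalIntegral.integral_Iic_sub_Iic hi.integrableOn hi.integrableOn
  have e3 : (∫ z in (-t)..t, g n s z) = (∫ z in (-t)..0, g n s z) + ∫ z in (0 : ℝ)..t, g n s z :=
    (intervalIntegral.integral_add_adjacent_intervals
      ((continuous_g n s).intervalIntegrable _ _) ((continuous_g n s).intervalIntegrable _ _)).symm
  have e4 : (∫ z in (-t)..0, g n s z) = G n s t := by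
    rw [intervalIntegral.integral_symm]
    change - G n s (-t) = _
    rw [G_neg, neg_neg]
  rw [e1, e2, e3, e4]
  change G n s t + G n s t = _
  ring

/-- Smoothing `|·|` by `g_s` gives `2 𝒢_s` up to an additive constant:
the two sides have the derivative `2 G_s`. -/
theorem integral_g_mul_abs_sub {n : ℕ} (hn : 1 ≤ n) {s : ℝ} (hs : 0 < s) (τ : ℝ) :
    ∫ z, g n s z * |τ - z| = (∫ z, g n s z * |z|) + 2 * GG n s τ := by
  have hi := integrable_g hn hs
  have hd : ∀ t, HasDerivAt (fun t => ∫ z, g n s z * |t - z|) (2 * G n s t) t := by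
    intro t
    have := hasDerivAt_integral_of_dominated_loc_of_lip (μ := volume) (𝕜 := ℝ)
      (F := fun t z => g n s z * |t - z|) (x₀ := t) (s := Set.univ) (bound := g n s)
      (F' := fun z => (Set.Iic t).indicator (g n s) z - (Set.Ioi t).indicator (g n s) z)
      Filter.univ_mem
      (Filter.Eventually.of_forall fun t => (integrable_g_mul_abs_sub hn hs t).aestronglyMeasurable)
      (integrable_g_mul_abs_sub hn hs t)
      (((hi.indicator measurableSet_Iic).sub
        (hi.indicator measurableSet_Ioi)).aestronglyMeasurable)
      (Filter.Eventually.of_forall fun z => ?_) hi ?_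
    · rw [← integral_Iic_sub_integral_Ioi_g hn hs, ← integral_indicator measurableSet_Iic,
        ← integral_indicator measurableSet_Ioi, ← integral_sub
          (hi.indicator measurableSet_Iic) (hi.indicator measurableSet_Ioi)]
      exact this.2
    · refine LipschitzOnWith.of_dist_le_mul fun a _ b _ => ?_
      rw [Real.dist_eq, Real.dist_eq, ← mul_sub, abs_mul, Real.coe_nnabs]
      have := abs_abs_sub_abs_le (a - z) (b - z)
      rw [sub_sub_sub_cancel_right] at this
      exact mul_le_mul_of_nonneg_left this (abs_nonneg _)
    · have hne : ∀ᵐ z : ℝ, z ≠ t := by simp [ae_iff, measure_singleton]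
      filter_upwards [hne] with z hz
      rcases lt_or_gt_of_ne hz with h | h
      · have h1 : HasDerivAt (fun x : ℝ => |x - z|) 1 t := by
          have := (hasDerivAt_abs_pos (x := t - z) (by linarith)).comp t
            ((hasDerivAt_id t).sub_const z)
          simpa [Function.comp_def] using this
        have := h1.const_mul (g n s z)
        simpa [Set.indicator, h.le, not_lt.2 h.le] using this
      · have h1 : HasDerivAt (fun x : ℝ => |x - z|) (-1) t := by
          have := (hasDerivAt_abs_neg (x := t - z) (by linarith)).comp t
            ((hasDerivAt_id t).sub_const z)
          simpa [Function.comp_def] using this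
        have := h1.const_mul (g n s z)
        simpa [Set.indicator, h, not_le.2 h] using this
  have hc : ∀ t, HasDerivAt (fun t => (∫ z, g n s z * |t - z|) - 2 * GG n s t) 0 t := by
    intro t
    have := (hd t).fun_sub ((hasDerivAt_GG n s t).const_mul 2)
    rwa [sub_self] at this
  have := is_const_of_deriv_eq_zero (fun t => (hc t).differentiableAt) (fun t => (hc t).deriv) τ 0
  simp only [zero_sub, abs_neg, GG_zero, mul_zero, sub_zero] at this
  linarith

end NonlocalObstacle

/-! ### Integrals of powers of the distance in `ℝⁿ` -/

namespace NonlocalObstacle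

/-- The constant in `∫_{|z| ≥ R} |z|^{-(n+s)} dz = farConst n s * R^{-s}`. -/
noncomputable def farConst (n : ℕ) (s : ℝ) : ℝ :=
  n * (volume.real (Metric.ball (0 : Rn n) 1)) / s

theorem farConst_pos {n : ℕ} (hn : 1 ≤ n) {s : ℝ} (hs : 0 < s) : 0 < farConst n s := by
  have h1 : (0 : ℝ) < n := by exact_mod_cast hn
  have h2 : 0 < volume.real (Metric.ball (0 : Rn n) 1) :=
    ENNReal.toReal_pos (Metric.measure_ball_pos _ _ one_pos).ne' measure_ball_lt_top.ne
  unfold farConst; positivity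

theorem nontrivial_Rn {n : ℕ} (hn : 1 ≤ n) : Nontrivial (Rn n) := by
  apply Module.nontrivial_of_finrank_pos (R := ℝ)
  simp; omega

theorem lintegral_far {n : ℕ} (hn : 1 ≤ n) {s : ℝ} (hs : 0 < s) {R : ℝ} (hR : 0 < R) :
    ∫⁻ z in {z : Rn n | R ≤ ‖z‖}, ENNReal.ofReal (1 / ‖z‖ ^ ((n : ℝ) + s)) =
      ENNReal.ofReal (farConst n s * R ^ (-s)) := by
  have := nontrivial_Rn hn
  have hm : MeasurableSet {z : Rn n | R ≤ ‖z‖} := measurableSet_le measurable_const measurable_norm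
  set f : ℝ → ℝ := (Set.Ici R).indicator fun r => 1 / r ^ ((n : ℝ) + s) with hf
  have hfn : ∀ z : Rn n, {z : Rn n | R ≤ ‖z‖}.indicator
      (fun z => ENNReal.ofReal (1 / ‖z‖ ^ ((n : ℝ) + s))) z = ENNReal.ofReal (f ‖z‖) := by
    intro z
    by_cases h : R ≤ ‖z‖ <;> simp [hf, h]
  have key : ∀ y ∈ Set.Ioi (0 : ℝ), y ^ (Module.finrank ℝ (Rn n) - 1) • f y =
      (Set.Ici R).indicator (fun r => r ^ (-s - 1)) y := by
    intro y hy
    have hy : 0 < y := hy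
    by_cases h : R ≤ y
    · simp only [hf, Set.mem_Ici, h, Set.indicator_of_mem, smul_eq_mul, finrank_euclideanSpace,
        Fintype.card_fin]
      rw [← Real.rpow_natCast, one_div, ← Real.rpow_neg hy.le, ← Real.rpow_add hy, Nat.cast_sub hn]
      congr 1; push_cast; ring
    · simp [hf, h]
  have hint : IntegrableOn ((Set.Ici R).indicator (fun r : ℝ => r ^ (-s - 1))) (Set.Ioi 0) := by
    refine Integrable.integrableOn ?_
    rw [integrable_indicator_iff measurableSet_Ici]
    exact (integrableOn_Ici_iff_integrableOn_Ioi).2 (integrableOn_Ioi_rpow_of_lt (by linarith) hR)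
  have hI : Integrable (fun z : Rn n => f ‖z‖) := by
    rw [integrable_fun_norm_addHaar]
    exact hint.congr_fun (fun y hy => (key y hy).symm) measurableSet_Ioi
  rw [← lintegral_indicator hm, lintegral_congr hfn, ← ofReal_integral_eq_lintegral_ofReal hI]
  · congr 1
    rw [integral_fun_norm_addHaar, setIntegral_congr_fun measurableSet_Ioi key,
      setIntegral_indicator measurableSet_Ici,
      show Set.Ioi (0 : ℝ) ∩ Set.Ici R = Set.Ici R from
        Set.inter_eq_right.2 fun y hy => lt_of_lt_of_le hR hy,
      integral_Ici_eq_integral_Ioi, integral_Ioi_rpow_of_lt (by linarith) hR]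
    simp only [finrank_euclideanSpace, Fintype.card_fin, farConst, nsmul_eq_mul, smul_eq_mul,
      sub_add_cancel]
    rw [neg_div_neg_eq]
    ring
  · refine Filter.Eventually.of_forall fun z => ?_
    by_cases h : R ≤ ‖z‖
    · simp only [Pi.zero_apply, hf, Set.mem_Ici, h, Set.indicator_of_mem]; positivity
    · simp [hf, h]

theorem lintegral_far_sub {n : ℕ} (hn : 1 ≤ n) {s : ℝ} (hs : 0 < s) {R : ℝ} (hR : 0 < R)
    (x : Rn n) :
    ∫⁻ y in {y : Rn n | R ≤ ‖x - y‖}, ENNReal.ofReal (1 / ‖x - y‖ ^ ((n : ℝ) + s)) =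
      ENNReal.ofReal (farConst n s * R ^ (-s)) := by
  rw [← lintegral_far hn hs hR, ← lintegral_indicator, ← lintegral_indicator]
  · exact lintegral_sub_left_eq_self
      ({z : Rn n | R ≤ ‖z‖}.indicator fun z => ENNReal.ofReal (1 / ‖z‖ ^ ((n : ℝ) + s))) x
  · exact measurableSet_le measurable_const measurable_norm
  · exact measurableSet_le measurable_const (by fun_prop)

theorem lintegral_annulus_add_far {n : ℕ} (hn : 1 ≤ n) {s : ℝ} (hs : 0 < s) {a b : ℝ} (ha : 0 < a)
    (hab : a ≤ b) (x : Rn n) :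
    (∫⁻ y in {y : Rn n | a ≤ ‖x - y‖ ∧ ‖x - y‖ < b},
      ENNReal.ofReal (1 / ‖x - y‖ ^ ((n : ℝ) + s))) + ENNReal.ofReal (farConst n s * b ^ (-s)) =
      ENNReal.ofReal (farConst n s * a ^ (-s)) := by
  have hu : {y : Rn n | a ≤ ‖x - y‖ ∧ ‖x - y‖ < b} ∪ {y : Rn n | b ≤ ‖x - y‖} =
      {y : Rn n | a ≤ ‖x - y‖} := by
    ext y
    simp only [Set.mem_union, Set.mem_ofPred_eq]
    constructor
    · rintro (h | h)
      · exact h.1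
      · exact hab.trans h
    · intro h
      rcases lt_or_ge ‖x - y‖ b with h' | h'
      · exact Or.inl ⟨h, h'⟩
      · exact Or.inr h'
  have hm : MeasurableSet {y : Rn n | b ≤ ‖x - y‖} :=
    measurableSet_le measurable_const (by fun_prop)
  have hd : Disjoint {y : Rn n | a ≤ ‖x - y‖ ∧ ‖x - y‖ < b} {y : Rn n | b ≤ ‖x - y‖} := by
    rw [Set.disjoint_left]
    intro y hy hy'
    exact absurd hy' (not_le.2 hy.2)
  rw [← lintegral_far_sub hn hs ha x, ← lintegral_far_sub hn hs (ha.trans_le hab) x, ← hu]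
  exact (lintegral_union hm hd).symm

theorem lintegral_ball_lt_top {n : ℕ} (hn : 1 ≤ n) {s : ℝ} (hs1 : s < 1) (R : ℝ) :
    ∫⁻ z in Metric.ball (0 : Rn n) R, ENNReal.ofReal (1 / ‖z‖ ^ ((n : ℝ) - 1 + s)) < ⊤ := by
  have h := integrableOn_ball_of_norm_le_rpow (μ := (volume : Measure (Rn n))) (by simpa using hn)
    (f := fun z : Rn n => 1 / ‖z‖ ^ ((n : ℝ) - 1 + s)) (C := 1) (α := (n : ℝ) - 1 + s) (r := R)
    (by simp; linarith) (Filter.Eventually.of_forall fun z => ?_)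
    (Measurable.aestronglyMeasurable (by fun_prop))
  · exact h.lintegral_lt_top
  · rw [Real.norm_of_nonneg (by positivity), Real.rpow_neg (norm_nonneg _), one_mul, one_div]

/-- On a bounded set the kernel `|x - y|^{-(n-1+s)}` is integrable. -/
theorem lintegral_lintegral_bounded_lt_top {n : ℕ} (hn : 1 ≤ n) {s : ℝ} (hs1 : s < 1)
    {Ω : Set (Rn n)} (hm : MeasurableSet Ω) (hΩ : Bornology.IsBounded Ω) :
    ∫⁻ x in Ω, ∫⁻ y in Ω, ENNReal.ofReal (1 / ‖x - y‖ ^ ((n : ℝ) - 1 + s)) < ⊤ := by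
  obtain ⟨R, hR0, hR⟩ := hΩ.exists_pos_norm_lt
  have hfin : volume Ω < ⊤ := hΩ.measure_lt_top
  calc ∫⁻ x in Ω, ∫⁻ y in Ω, ENNReal.ofReal (1 / ‖x - y‖ ^ ((n : ℝ) - 1 + s))
      ≤ ∫⁻ x in Ω, ∫⁻ z in Metric.ball (0 : Rn n) (2 * R),
          ENNReal.ofReal (1 / ‖z‖ ^ ((n : ℝ) - 1 + s)) := by
        refine setLIntegral_mono' hm fun x hx => ?_
        rw [← lintegral_indicator hm, ← lintegral_indicator measurableSet_ball,
          ← lintegral_sub_left_eq_self ((Metric.ball (0 : Rn n) (2 * R)).indicator _) x]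
        refine lintegral_mono fun y => ?_
        by_cases hy : y ∈ Ω
        · have : x - y ∈ Metric.ball (0 : Rn n) (2 * R) := by
            rw [mem_ball_zero_iff]
            linarith [norm_sub_le x y, hR x hx, hR y hy]
          simp [hy, this]
        · simp [hy]
    _ = volume Ω * _ := by rw [setLIntegral_const, mul_comm]
    _ < ⊤ := ENNReal.mul_lt_top hfin (lintegral_ball_lt_top hn hs1 _)

/-- Almost every pair of points lies off the diagonal. -/
theorem ae_ne_diagonal {n : ℕ} (hn : 1 ≤ n) : ∀ᵐ p : Rn n × Rn n, p.1 ≠ p.2 := by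
  have := nontrivial_Rn hn
  rw [Measure.volume_eq_prod]
  refine Measure.ae_prod_iff_ae_ae ?_ |>.2 ?_
  · exact (measurableSet_eq_fun measurable_fst measurable_snd).compl
  · refine Filter.Eventually.of_forall fun x => ?_
    simp only [ne_eq]
    rw [ae_iff]
    simp

end NonlocalObstacle

/-! ### A fractional Hardy inequality on Lipschitz domains -/

namespace NonlocalObstacle

/-- The integrand `a^{-(n+1+s)} |w(y) - w(ξ)|`, for `y, ξ ∈ Ω` at distance at most `a`.
Its integral in `a` is a multiple of the integrand of the Gagliardo seminorm. -/
noncomputable def chainKernel {n : ℕ} (s : ℝ) (Ω : Set (Rn n)) (w : Rn n → ℝ) (y : Rn n) (a : ℝ)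
    (ξ : Rn n) : ENNReal :=
  {q : Rn n × ℝ × Rn n | q.1 ∈ Ω ∧ q.2.2 ∈ Ω ∧ 0 < q.2.1 ∧ ‖q.1 - q.2.2‖ ≤ q.2.1}.indicator
    (fun q => ENNReal.ofReal (q.2.1 ^ (-(n : ℝ) - s - 1) * |w q.1 - w q.2.2|)) (y, a, ξ)

theorem measurable_chainKernel {n : ℕ} (s : ℝ) {Ω : Set (Rn n)} (hΩ : MeasurableSet Ω)
    {w : Rn n → ℝ} (hw : Measurable w) :
    Measurable fun q : Rn n × ℝ × Rn n => chainKernel s Ω w q.1 q.2.1 q.2.2 := by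
  unfold chainKernel
  refine Measurable.indicator ?_ ?_
  · fun_prop
  · refine (measurable_fst hΩ).inter (((measurable_snd.comp measurable_snd) hΩ).inter ?_)
    refine (measurableSet_lt (f := fun _ : Rn n × ℝ × Rn n => (0 : ℝ)) (g := fun q => q.2.1)
      measurable_const (by fun_prop)).inter ?_
    exact measurableSet_le (f := fun q : Rn n × ℝ × Rn n => ‖q.1 - q.2.2‖) (g := fun q => q.2.1)
      (by fun_prop) (by fun_prop)

theorem lintegral_chainKernel_le {n : ℕ} {s : ℝ} (hs : 0 < s) {Ω : Set (Rn n)}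
    (hΩ : MeasurableSet Ω) {w : Rn n → ℝ} (hw : Measurable w) :
    ∫⁻ y, ∫⁻ a, ∫⁻ ξ, chainKernel s Ω w y a ξ ≤
      ENNReal.ofReal (1 / (n + s)) * gagliardo s Ω w := by
  have hns : (0 : ℝ) < n + s := by positivity
  have hmeas := measurable_chainKernel s hΩ hw
  have hinner : ∀ y ξ : Rn n, ∫⁻ a, chainKernel s Ω w y a ξ ≤
      Ω.indicator (fun y => Ω.indicator (fun ξ => ENNReal.ofReal (1 / (n + s)) *
        ENNReal.ofReal (|w y - w ξ| / ‖y - ξ‖ ^ ((n : ℝ) + s))) ξ) y := by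
    intro y ξ
    by_cases hy : y ∈ Ω
    swap
    · simp [chainKernel, hy]
    by_cases hξ : ξ ∈ Ω
    swap
    · simp [chainKernel, hξ]
    simp only [hy, hξ, Set.indicator_of_mem]
    rcases eq_or_ne y ξ with rfl | hne
    · have : ∀ a, chainKernel s Ω w y a y = 0 := by
        intro a
        simp [chainKernel, Set.indicator]
      simp [this]
    have hr : 0 < ‖y - ξ‖ := norm_pos_iff.2 (sub_ne_zero.2 hne)
    have h1 : ∀ a, chainKernel s Ω w y a ξ = (Set.Ici ‖y - ξ‖).indicator
        (fun a => ENNReal.ofReal |w y - w ξ| * ENNReal.ofReal (a ^ (-(n : ℝ) - s - 1))) a := by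
      intro a
      by_cases ha : ‖y - ξ‖ ≤ a
      · have ha0 : 0 < a := hr.trans_le ha
        simp only [chainKernel, Set.indicator, Set.mem_ofPred_eq, hy, hξ, ha, ha0, and_self,
          if_true, Set.mem_Ici]
        rw [mul_comm, ENNReal.ofReal_mul (abs_nonneg _)]
      · simp [chainKernel, ha]
    simp_rw [h1]
    rw [lintegral_indicator measurableSet_Ici, lintegral_const_mul _ (by fun_prop),
      ← ofReal_integral_eq_lintegral_ofReal, integral_Ici_eq_integral_Ioi,
      integral_Ioi_rpow_of_lt (by linarith) hr, ← ENNReal.ofReal_mul (abs_nonneg _),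
      ← ENNReal.ofReal_mul (by positivity)]
    · apply le_of_eq
      congr 1
      rw [show -(n : ℝ) - s - 1 + 1 = -(n + s) by ring, neg_div_neg_eq, Real.rpow_neg hr.le]
      field_simp
    · exact (integrableOn_Ici_iff_integrableOn_Ioi).2
        (integrableOn_Ioi_rpow_of_lt (by linarith) hr)
    · filter_upwards [self_mem_ae_restrict measurableSet_Ici] with a ha
      exact Real.rpow_nonneg (hr.le.trans ha) _
  calc ∫⁻ y, ∫⁻ a, ∫⁻ ξ, chainKernel s Ω w y a ξ
      = ∫⁻ y, ∫⁻ ξ, ∫⁻ a, chainKernel s Ω w y a ξ := by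
        refine lintegral_congr fun y => ?_
        exact lintegral_lintegral_swap
          (hmeas.comp (measurable_const.prodMk measurable_id)).aemeasurable
    _ ≤ ∫⁻ y, ∫⁻ ξ, Ω.indicator (fun y => Ω.indicator (fun ξ => ENNReal.ofReal (1 / (n + s)) *
        ENNReal.ofReal (|w y - w ξ| / ‖y - ξ‖ ^ ((n : ℝ) + s))) ξ) y :=
        lintegral_mono fun y => lintegral_mono fun ξ => hinner y ξ
    _ = ENNReal.ofReal (1 / (n + s)) * gagliardo s Ω w := by
        unfold gagliardo
        rw [← lintegral_indicator hΩ, ← lintegral_const_mul' _ _ ENNReal.ofReal_ne_top]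
        refine lintegral_congr fun y => ?_
        by_cases hy : y ∈ Ω
        · simp only [hy, Set.indicator_of_mem]
          rw [lintegral_indicator hΩ, lintegral_const_mul' _ _ ENNReal.ofReal_ne_top]
        · simp [hy]

/-- A point value `|w(x)|` is estimated by the value at the translate `x + a e`, through the
average over the points `ξ` of a ball centred at the midpoint. -/
theorem chain_le {n : ℕ} {s : ℝ} (hs : 0 < s) {Ω : Set (Rn n)} {w : Rn n → ℝ} (hw : Measurable w)
    {e : Rn n} (he : ‖e‖ = 1) {ε : ℝ} (hε : 0 < ε) (hε1 : ε ≤ 1 / 2) {x : Rn n} {t a : ℝ}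
    (ht : 0 < t) (hta : t < a) (hat : a ≤ 2 * t) (hx : x ∈ Ω) (hxe : x + a • e ∈ Ω)
    (hb : ∀ ξ ∈ Metric.ball (x + (a / 2) • e) (ε * a), ξ ∈ Ω) :
    ENNReal.ofReal (t ^ (-s - 1)) * ENNReal.ofReal |w x| ≤
      ENNReal.ofReal (2 ^ (s + 1) / (ε ^ n * volume.real (Metric.ball (0 : Rn n) 1))) *
        (∫⁻ ξ, chainKernel s Ω w x a ξ) +
      ENNReal.ofReal (2 ^ (s + 1) / (ε ^ n * volume.real (Metric.ball (0 : Rn n) 1))) *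
        (∫⁻ ξ, chainKernel s Ω w (x + a • e) a ξ) +
      ENNReal.ofReal (t ^ (-s - 1)) * ENNReal.ofReal |w (x + a • e)| := by
  have ha : 0 < a := ht.trans hta
  set b := volume.real (Metric.ball (0 : Rn n) 1) with hbdef
  have hb0 : 0 < b :=
    ENNReal.toReal_pos (Metric.measure_ball_pos _ _ one_pos).ne' measure_ball_lt_top.ne
  set C := 2 ^ (s + 1) / (ε ^ n * b) with hC
  set B := Metric.ball (x + (a / 2) • e) (ε * a) with hB
  have hBm : MeasurableSet B := measurableSet_ball
  have hvol : volume B = ENNReal.ofReal ((ε * a) ^ n * b) := by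
    rw [hB, Measure.addHaar_ball_of_pos _ _ (by positivity), ENNReal.ofReal_mul (by positivity),
      hbdef, Measure.real, ENNReal.ofReal_toReal measure_ball_lt_top.ne]
    simp
  have hn1 : ‖a • e‖ = a := by rw [norm_smul, he, mul_one, Real.norm_of_nonneg ha.le]
  have hn2 : ‖(a / 2) • e‖ = a / 2 := by
    rw [norm_smul, he, mul_one, Real.norm_of_nonneg (by positivity)]
  have hdist : ∀ ξ ∈ B, ‖x - ξ‖ ≤ a ∧ ‖x + a • e - ξ‖ ≤ a := by
    intro ξ hξ
    rw [hB, mem_ball_iff_norm'] at hξ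
    have hεa : ε * a ≤ a / 2 := by nlinarith
    constructor
    · have : x - ξ = (x + (a / 2) • e - ξ) - (a / 2) • e := by abel
      rw [this]
      refine (norm_sub_le _ _).trans ?_
      rw [hn2]; linarith
    · have : x + a • e - ξ = (x + (a / 2) • e - ξ) + (a / 2) • e := by
        have : a • e = (a / 2) • e + (a / 2) • e := by rw [← add_smul, add_halves]
        rw [this]; abel
      rw [this]
      refine (norm_add_le _ _).trans ?_
      rw [hn2]; linarith
  -- The constant `C` absorbs the volume of the ball and the comparison of `t` with `a`.
  have hconst : ENNReal.ofReal (t ^ (-s - 1)) ≤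
      ENNReal.ofReal C * ENNReal.ofReal (a ^ (-(n : ℝ) - s - 1)) * volume B := by
    rw [hvol, ← ENNReal.ofReal_mul (by positivity), ← ENNReal.ofReal_mul (by positivity)]
    apply ENNReal.ofReal_le_ofReal
    have e1 : C * a ^ (-(n : ℝ) - s - 1) * ((ε * a) ^ n * b) = 2 ^ (s + 1) * a ^ (-s - 1) := by
      rw [hC, mul_pow, show -(n : ℝ) - s - 1 = (-s - 1) + -(n : ℝ) by ring, Real.rpow_add ha,
        Real.rpow_neg ha.le, Real.rpow_natCast]
      field_simp
    rw [e1, show -s - 1 = -(s + 1) by ring, Real.rpow_neg ht.le, Real.rpow_neg ha.le,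
      ← div_eq_mul_inv, inv_le_comm₀ (by positivity) (by positivity), inv_div, div_le_iff₀
      (by positivity), ← Real.mul_rpow ht.le (by norm_num)]
    exact Real.rpow_le_rpow ha.le (by linarith) (by linarith)
  have hker : ∀ y, (y ∈ Ω) → (∀ ξ ∈ B, ‖y - ξ‖ ≤ a) →
      ENNReal.ofReal (a ^ (-(n : ℝ) - s - 1)) * ∫⁻ ξ in B, ENNReal.ofReal |w y - w ξ| ≤
        ∫⁻ ξ, chainKernel s Ω w y a ξ := by
    intro y hy hyξ
    rw [← lintegral_const_mul' _ _ ENNReal.ofReal_ne_top, ← lintegral_indicator hBm]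
    refine lintegral_mono fun ξ => ?_
    by_cases hξ : ξ ∈ B
    · simp only [hξ, Set.indicator_of_mem]
      rw [← ENNReal.ofReal_mul (by positivity), chainKernel, Set.indicator_of_mem]
      exact ⟨hy, hb ξ hξ, ha, hyξ ξ hξ⟩
    · simp [hξ]
  have hvpos : volume B ≠ 0 := by
    rw [hvol]; simp; positivity
  have hvtop : volume B ≠ ⊤ := by rw [hvol]; simp
  have htri : volume B * ENNReal.ofReal |w x| ≤
      (∫⁻ ξ in B, ENNReal.ofReal |w x - w ξ|) + (∫⁻ ξ in B, ENNReal.ofReal |w (x + a • e) - w ξ|) +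
        volume B * ENNReal.ofReal |w (x + a • e)| := by
    rw [mul_comm, mul_comm (volume B), ← setLIntegral_const, ← setLIntegral_const,
      ← lintegral_add_left (by fun_prop), ← lintegral_add_left (by fun_prop)]
    refine lintegral_mono fun ξ => ?_
    simp only
    rw [← ENNReal.ofReal_add (by positivity) (by positivity),
      ← ENNReal.ofReal_add (by positivity) (by positivity)]
    apply ENNReal.ofReal_le_ofReal
    have h1 := abs_sub_abs_le_abs_sub (w x) (w ξ)
    have h2 := abs_sub_abs_le_abs_sub (w ξ) (w (x + a • e))
    rw [abs_sub_comm (w ξ)] at h2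
    linarith
  set X := ∫⁻ ξ in B, ENNReal.ofReal |w x - w ξ|
  set Y := ∫⁻ ξ in B, ENNReal.ofReal |w (x + a • e) - w ξ|
  set P := ENNReal.ofReal (t ^ (-s - 1))
  set A := ENNReal.ofReal (a ^ (-(n : ℝ) - s - 1))
  have hPV : P * (volume B)⁻¹ ≤ ENNReal.ofReal C * A := by
    calc P * (volume B)⁻¹ ≤ (ENNReal.ofReal C * A * volume B) * (volume B)⁻¹ := by gcongr
      _ = ENNReal.ofReal C * A := by rw [mul_assoc, ENNReal.mul_inv_cancel hvpos hvtop, mul_one]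
  calc P * ENNReal.ofReal |w x|
      = P * (volume B)⁻¹ * (volume B * ENNReal.ofReal |w x|) := by
        rw [mul_assoc, ← mul_assoc (volume B)⁻¹, ENNReal.inv_mul_cancel hvpos hvtop, one_mul]
    _ ≤ P * (volume B)⁻¹ * (X + Y + volume B * ENNReal.ofReal |w (x + a • e)|) := by gcongr
    _ = P * (volume B)⁻¹ * X + P * (volume B)⁻¹ * Y + P * ENNReal.ofReal |w (x + a • e)| := by
        rw [mul_add, mul_add, mul_assoc P _ (volume B * _), ← mul_assoc (volume B)⁻¹,
          ENNReal.inv_mul_cancel hvpos hvtop, one_mul]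
    _ ≤ ENNReal.ofReal C * A * X + ENNReal.ofReal C * A * Y +
        P * ENNReal.ofReal |w (x + a • e)| := by
        gcongr
    _ ≤ ENNReal.ofReal C * (∫⁻ ξ, chainKernel s Ω w x a ξ) +
        ENNReal.ofReal C * (∫⁻ ξ, chainKernel s Ω w (x + a • e) a ξ) +
        P * ENNReal.ofReal |w (x + a • e)| := by
        refine add_le_add (add_le_add ?_ ?_) le_rfl
        · rw [mul_assoc]
          exact mul_le_mul' le_rfl (hker x hx fun ξ hξ => (hdist ξ hξ).1)
        · rw [mul_assoc]
          exact mul_le_mul' le_rfl (hker _ hxe fun ξ hξ => (hdist ξ hξ).2)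

/-- The absorption constant `∫_2^3 σ^{s-1} dσ` of the one-dimensional Hardy inequality. -/
noncomputable def absorbConst (s : ℝ) : ℝ := (3 ^ s - 2 ^ s) / s

theorem absorbConst_nonneg {s : ℝ} (hs : 0 < s) : 0 ≤ absorbConst s := by
  unfold absorbConst
  have : (2 : ℝ) ^ s ≤ 3 ^ s := Real.rpow_le_rpow (by norm_num) (by norm_num) hs.le
  exact div_nonneg (by linarith) hs.le

theorem absorbConst_lt_one {s : ℝ} (hs : 0 < s) (hs1 : s < 1) : absorbConst s < 1 := by
  unfold absorbConst
  rw [div_lt_one hs]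
  have h1 : (3 : ℝ) ^ s = 2 ^ s * (1 + 1 / 2) ^ s := by
    rw [← Real.mul_rpow (by norm_num) (by norm_num)]; norm_num
  have h2 : (1 + 1 / 2 : ℝ) ^ s ≤ 1 + s * (1 / 2) :=
    rpow_one_add_le_one_add_mul_self (by norm_num) hs.le hs1.le
  have h3 : (2 : ℝ) ^ s < 2 := by
    calc (2 : ℝ) ^ s < 2 ^ (1 : ℝ) := Real.rpow_lt_rpow_of_exponent_lt (by norm_num) hs1
      _ = 2 := by norm_num
  have h4 : (0 : ℝ) < 2 ^ s := by positivity
  rw [h1]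
  nlinarith

theorem lintegral_absorb {s : ℝ} (hs : 0 < s) {τ : ℝ} (hτ : 0 < τ) :
    ∫⁻ a, {a : ℝ | τ - a < a ∧ a ≤ 2 * (τ - a)}.indicator
      (fun a => ENNReal.ofReal ((τ - a) ^ (-s - 1))) a =
      ENNReal.ofReal (absorbConst s * τ ^ (-s)) := by
  have h1 : ∀ a, {a : ℝ | τ - a < a ∧ a ≤ 2 * (τ - a)}.indicator
      (fun a => ENNReal.ofReal ((τ - a) ^ (-s - 1))) a =
      (Set.Ico (τ / 3) (τ / 2)).indicator (fun h => ENNReal.ofReal (h ^ (-s - 1))) (τ - a) := by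
    intro a
    by_cases h : τ - a < a ∧ a ≤ 2 * (τ - a)
    · have : τ - a ∈ Set.Ico (τ / 3) (τ / 2) := ⟨by linarith [h.2], by linarith [h.1]⟩
      simp [Set.indicator_of_mem, this, h]
    · have : τ - a ∉ Set.Ico (τ / 3) (τ / 2) := by
        rintro ⟨h1, h2⟩
        exact h ⟨by linarith, by linarith⟩
      simp [this, h]
  simp_rw [h1]
  rw [lintegral_sub_left_eq_self ((Set.Ico (τ / 3) (τ / 2)).indicator
    (fun h => ENNReal.ofReal (h ^ (-s - 1)))) τ, lintegral_indicator measurableSet_Ico,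
    restrict_Ico_eq_restrict_Ioc, ← ofReal_integral_eq_lintegral_ofReal,
    ← intervalIntegral.integral_of_le (by linarith), integral_rpow]
  · congr 1
    rw [sub_add_cancel, Real.div_rpow hτ.le (by norm_num), Real.div_rpow hτ.le (by norm_num),
      Real.rpow_neg hτ.le, Real.rpow_neg (by norm_num), Real.rpow_neg (by norm_num), absorbConst]
    field_simp
    ring
  · right
    refine ⟨by linarith, ?_⟩
    rw [Set.uIcc_of_le (by linarith)]
    intro h
    linarith [h.1]
  · refine (intervalIntegrable_iff_integrableOn_Ioc_of_le (by linarith)).1 ?_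
    apply intervalIntegral.intervalIntegrable_rpow
    right
    rw [Set.uIcc_of_le (by linarith)]
    intro h
    linarith [h.1]
  · filter_upwards [self_mem_ae_restrict measurableSet_Ioc] with a ha
    exact Real.rpow_nonneg (by linarith [ha.1]) _

theorem lintegral_const_Ioc {s t : ℝ} (ht : 0 < t) :
    ∫⁻ a, (Set.Ioc t (2 * t)).indicator (fun _ => ENNReal.ofReal (t ^ (-s - 1))) a =
      ENNReal.ofReal (t ^ (-s)) := by
  rw [lintegral_indicator_const measurableSet_Ioc, Real.volume_Ioc,
    ← ENNReal.ofReal_mul (by positivity)]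
  congr 1
  rw [show 2 * t - t = t by ring, ← Real.rpow_add_one ht.ne']
  congr 1; ring

theorem lintegral_lintegral_add {α β : Type*} [MeasurableSpace α] [MeasurableSpace β]
    {μ : Measure α} {ν : Measure β} [SFinite ν] {F G : α × β → ENNReal} (hF : Measurable F) :
    ∫⁻ x, ∫⁻ y, (F (x, y) + G (x, y)) ∂ν ∂μ =
      (∫⁻ x, ∫⁻ y, F (x, y) ∂ν ∂μ) + ∫⁻ x, ∫⁻ y, G (x, y) ∂ν ∂μ := by
  rw [← lintegral_add_left hF.lintegral_prod_right']
  refine lintegral_congr fun x => ?_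
  exact lintegral_add_left (hF.comp (measurable_const.prodMk measurable_id)) _

section Layer

variable {n : ℕ} {s : ℝ} {Ω Z : Set (Rn n)} {w : Rn n → ℝ} {e : Rn n} {t : Rn n → ℝ} {L β : ℝ}

/-- The weighted integral `∫ t^{-s} |w|` over the part of `Z` of height `t` between `δ` and `b`. -/
noncomputable def layerIntegral (s : ℝ) (Z : Set (Rn n)) (t w : Rn n → ℝ) (δ b : ℝ) : ENNReal :=
  ∫⁻ x in {x | x ∈ Z ∧ δ < t x ∧ t x < b}, ENNReal.ofReal (t x ^ (-s)) * ENNReal.ofReal |w x|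

theorem measurableSet_layer (hZ : MeasurableSet Z) (ht : Measurable t) (δ b : ℝ) :
    MeasurableSet {x | x ∈ Z ∧ δ < t x ∧ t x < b} :=
  hZ.inter ((measurableSet_lt measurable_const ht).inter (measurableSet_lt ht measurable_const))

/-- The Hardy inequality with an error term on the right which is absorbed later: the weighted
integral is estimated by the Gagliardo seminorm and a small multiple of itself, up to a change of
the upper height. -/
theorem layerIntegral_le (hs : 0 < s) (hΩ : MeasurableSet Ω) (hZ : MeasurableSet Z)
    (hw : Measurable w) (he : ‖e‖ = 1) (ht : Measurable t)
    (hte : ∀ x a, t (x + a • e) = t x + a) (hL : 1 ≤ L)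
    (htL : ∀ x y, |t x - t y| ≤ L * ‖x - y‖) (hZe : ∀ x (a : ℝ), x + a • e ∈ Z ↔ x ∈ Z)
    (hZΩ : ∀ x ∈ Z, 0 < t x → t x < 3 * β → ∀ ξ, ‖ξ - x‖ ≤ 2 * β → 0 < t ξ → ξ ∈ Ω)
    {δ : ℝ} (hδ : 0 < δ) :
    layerIntegral s Z t w δ β ≤
      2 * (ENNReal.ofReal (2 ^ (s + 1) /
        ((1 / (4 * L)) ^ n * volume.real (Metric.ball (0 : Rn n) 1))) *
        (ENNReal.ofReal (1 / (n + s)) * gagliardo s Ω w)) +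
      ENNReal.ofReal (absorbConst s) * layerIntegral s Z t w δ (3 * β) := by
  -- With this `ε`, the ball of radius `ε a` about `x + (a / 2) e` stays at height at least `a / 4`.
  set ε := 1 / (4 * L) with hε
  have hε0 : 0 < ε := by rw [hε]; positivity
  have hεL : L * ε = 1 / 4 := by rw [hε]; field_simp
  have hε1 : ε ≤ 1 / 2 := by nlinarith
  set C := ENNReal.ofReal (2 ^ (s + 1) / (ε ^ n * volume.real (Metric.ball (0 : Rn n) 1))) with hC
  have hCtop : C ≠ ⊤ := ENNReal.ofReal_ne_top
  set f : Rn n → ENNReal := fun x => ENNReal.ofReal |w x| with hf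
  have hfm : Measurable f := by fun_prop
  set S := {x | x ∈ Z ∧ δ < t x ∧ t x < β} with hS
  have hSm : MeasurableSet S := measurableSet_layer hZ ht δ β
  -- The pairs `(x, a)` with `x` in the layer and `a` comparable to the height of `x`.
  set T : Set (Rn n × ℝ) := {q | q.1 ∈ S ∧ t q.1 < q.2 ∧ q.2 ≤ 2 * t q.1} with hT
  have hTm : MeasurableSet T := by
    refine (measurable_fst hSm).inter ((measurableSet_lt (f := fun q : Rn n × ℝ => t q.1)
      (g := fun q => q.2) (by fun_prop) (by fun_prop)).inter
      (measurableSet_le (f := fun q : Rn n × ℝ => q.2) (g := fun q => 2 * t q.1)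
      (by fun_prop) (by fun_prop)))
  have hker := measurable_chainKernel s hΩ hw
  have hI : Measurable fun q : Rn n × ℝ => ∫⁻ ξ, chainKernel s Ω w q.1 q.2 ξ := by
    refine Measurable.lintegral_prod_right' (f := fun z : (Rn n × ℝ) × Rn n =>
      chainKernel s Ω w z.1.1 z.1.2 z.2) ?_
    exact hker.comp (f := fun z : (Rn n × ℝ) × Rn n => (z.1.1, z.1.2, z.2)) (by fun_prop)
  have hshift : Measurable fun q : Rn n × ℝ => (q.1 + q.2 • e, q.2) := by fun_prop
  have hI' : Measurable fun q : Rn n × ℝ => ∫⁻ ξ, chainKernel s Ω w (q.1 + q.2 • e) q.2 ξ :=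
    hI.comp hshift
  set R : Rn n × ℝ → ENNReal := T.indicator
    (fun q => ENNReal.ofReal (t q.1 ^ (-s - 1)) * f (q.1 + q.2 • e)) with hR
  have hRm : Measurable R := by
    refine Measurable.indicator ?_ hTm
    fun_prop
  have hpt : ∀ x a, T.indicator (fun q => ENNReal.ofReal (t q.1 ^ (-s - 1)) * f q.1) (x, a) ≤
      C * (∫⁻ ξ, chainKernel s Ω w x a ξ) + C * (∫⁻ ξ, chainKernel s Ω w (x + a • e) a ξ) +
        R (x, a) := by
    intro x a
    by_cases hq : (x, a) ∈ T
    swap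
    · simp [hq]
    simp only [hq, Set.indicator_of_mem, hR]
    obtain ⟨⟨hxZ, hxδ, hxβ⟩, hxa, hax⟩ := hq
    simp only at hxZ hxδ hxβ hxa hax
    have htx : 0 < t x := hδ.trans hxδ
    have ha : 0 < a := htx.trans hxa
    have hn1 : ‖a • e‖ = a := by rw [norm_smul, he, mul_one, Real.norm_of_nonneg ha.le]
    have hn2 : ‖(a / 2) • e‖ = a / 2 := by
      rw [norm_smul, he, mul_one, Real.norm_of_nonneg (by positivity)]
    refine chain_le hs hw he hε0 hε1 htx hxa hax ?_ ?_ ?_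
    · exact hZΩ x hxZ htx (by linarith) x (by simp; linarith) htx
    · refine hZΩ x hxZ htx (by linarith) _ ?_ (by rw [hte]; linarith)
      rw [add_sub_cancel_left, hn1]; linarith
    · intro ξ hξ
      rw [mem_ball_iff_norm] at hξ
      have hεa : ε * a ≤ a / 2 := by nlinarith
      refine hZΩ x hxZ htx (by linarith) ξ ?_ ?_
      · have : ξ - x = (ξ - (x + (a / 2) • e)) + (a / 2) • e := by abel
        rw [this]
        refine (norm_add_le _ _).trans ?_
        rw [hn2]; linarith
      · have h1 := htL ξ (x + (a / 2) • e)
        rw [hte, abs_le] at h1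
        have h2 : L * ‖ξ - (x + (a / 2) • e)‖ ≤ L * (ε * a) := by gcongr
        have h3 : L * (ε * a) = a / 4 := by rw [← mul_assoc, hεL]; ring
        linarith [h1.1]
  have hH : layerIntegral s Z t w δ β =
      ∫⁻ x, ∫⁻ a, T.indicator (fun q => ENNReal.ofReal (t q.1 ^ (-s - 1)) * f q.1) (x, a) := by
    unfold layerIntegral
    rw [← lintegral_indicator hSm]
    refine lintegral_congr fun x => ?_
    by_cases hx : x ∈ S
    · simp only [hx, Set.indicator_of_mem]
      have htx : 0 < t x := hδ.trans hx.2.1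
      rw [← lintegral_const_Ioc htx, ← lintegral_mul_const' _ _ ENNReal.ofReal_ne_top]
      refine lintegral_congr fun a => ?_
      by_cases ha : a ∈ Set.Ioc (t x) (2 * t x)
      · have : (x, a) ∈ T := ⟨hx, ha.1, ha.2⟩
        simp [Set.indicator_of_mem, ha, this, hf]
      · have : (x, a) ∉ T := fun h => ha ⟨h.2.1, h.2.2⟩
        simp [ha, this]
    · have : ∀ a, (x, a) ∉ T := fun a h => hx h.1
      simp [hx, this]
  have hT1 : ∫⁻ x, ∫⁻ a, ∫⁻ ξ, chainKernel s Ω w x a ξ ≤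
      ENNReal.ofReal (1 / (n + s)) * gagliardo s Ω w := lintegral_chainKernel_le hs hΩ hw
  have hT2 : ∫⁻ x, ∫⁻ a, ∫⁻ ξ, chainKernel s Ω w (x + a • e) a ξ ≤
      ENNReal.ofReal (1 / (n + s)) * gagliardo s Ω w := by
    refine le_trans (le_of_eq ?_) hT1
    rw [lintegral_lintegral_swap hI'.aemeasurable,
      lintegral_lintegral_swap (f := fun x a => ∫⁻ ξ, chainKernel s Ω w x a ξ) hI.aemeasurable]
    refine lintegral_congr fun a => ?_
    exact lintegral_add_right_eq_self (fun x => ∫⁻ ξ, chainKernel s Ω w x a ξ) (a • e)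
  have hT3 : ∫⁻ x, ∫⁻ a, R (x, a) ≤
      ENNReal.ofReal (absorbConst s) * layerIntegral s Z t w δ (3 * β) := by
    -- In terms of `y = x + a e`, the condition on `a` reads `t y / 2 < a ≤ 2 t y / 3`.
    have e1 : ∫⁻ x, ∫⁻ a, R (x, a) = ∫⁻ y, ∫⁻ a, R (y - a • e, a) := by
      rw [lintegral_lintegral_swap (f := fun x a => R (x, a)) hRm.aemeasurable,
        lintegral_lintegral_swap (f := fun y a => R (y - a • e, a)) (hRm.comp
          (f := fun q : Rn n × ℝ => (q.1 - q.2 • e, q.2)) (by fun_prop)).aemeasurable]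
      refine lintegral_congr fun a => ?_
      exact (lintegral_sub_right_eq_self (fun x => R (x, a)) (a • e)).symm
    rw [e1, layerIntegral, ← lintegral_indicator (measurableSet_layer hZ ht δ (3 * β)),
      ← lintegral_const_mul' _ _ ENNReal.ofReal_ne_top]
    refine lintegral_mono fun y => ?_
    have hty : ∀ a : ℝ, t (y - a • e) = t y - a := by
      intro a
      have := hte (y - a • e) a
      rw [sub_add_cancel] at this
      linarith
    by_cases hy : y ∈ {x | x ∈ Z ∧ δ < t x ∧ t x < 3 * β}
    · simp only [hy, Set.indicator_of_mem]
      have h0 : 0 < t y := hδ.trans hy.2.1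
      rw [← mul_assoc, ← ENNReal.ofReal_mul (absorbConst_nonneg hs), ← lintegral_absorb hs h0,
        ← lintegral_mul_const' _ _ ENNReal.ofReal_ne_top]
      refine lintegral_mono fun a => ?_
      by_cases hq : (y - a • e, a) ∈ T
      · have h1 := hq.2
        simp only [hty] at h1
        simp only [hR, hq, Set.indicator_of_mem, hty, Set.mem_ofPred_eq, h1, and_self,
          sub_add_cancel]
        exact le_rfl
      · simp [hR, hq]
    · have : ∀ a : ℝ, (y - a • e, a) ∉ T := by
        rintro a ⟨⟨h1, h2, h3⟩, h4, h5⟩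
        simp only [hty] at h1 h2 h3 h4 h5
        have h1' : y ∈ Z := by
          have := (hZe (y - a • e) a).2 h1
          rwa [sub_add_cancel] at this
        exact hy ⟨h1', by linarith, by linarith⟩
      simp [hR, this]
  calc layerIntegral s Z t w δ β
      ≤ ∫⁻ x, ∫⁻ a, (C * (∫⁻ ξ, chainKernel s Ω w x a ξ) +
          C * (∫⁻ ξ, chainKernel s Ω w (x + a • e) a ξ) + R (x, a)) := by
        rw [hH]
        exact lintegral_mono fun x => lintegral_mono fun a => hpt x a
    _ = C * (∫⁻ x, ∫⁻ a, ∫⁻ ξ, chainKernel s Ω w x a ξ) +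
          C * (∫⁻ x, ∫⁻ a, ∫⁻ ξ, chainKernel s Ω w (x + a • e) a ξ) + ∫⁻ x, ∫⁻ a, R (x, a) := by
        rw [lintegral_lintegral_add (F := fun q : Rn n × ℝ =>
            C * (∫⁻ ξ, chainKernel s Ω w q.1 q.2 ξ) +
              C * (∫⁻ ξ, chainKernel s Ω w (q.1 + q.2 • e) q.2 ξ))
            ((hI.const_mul C).add (hI'.const_mul C)),
          lintegral_lintegral_add (G := fun q : Rn n × ℝ =>
            C * (∫⁻ ξ, chainKernel s Ω w (q.1 + q.2 • e) q.2 ξ)) (hI.const_mul C)]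
        simp only [lintegral_const_mul' _ _ hCtop]
    _ ≤ C * (ENNReal.ofReal (1 / (n + s)) * gagliardo s Ω w) +
          C * (ENNReal.ofReal (1 / (n + s)) * gagliardo s Ω w) +
          ENNReal.ofReal (absorbConst s) * layerIntegral s Z t w δ (3 * β) := by
        gcongr
    _ = _ := by rw [two_mul]

theorem layerIntegral_le_of_subset (hs : 0 < s) (ht : Measurable t) (hZ : MeasurableSet Z) {δ b : ℝ}
    (hδ : 0 < δ) (h : ∀ x ∈ Z, δ < t x → t x < b → x ∈ Ω) :
    layerIntegral s Z t w δ b ≤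
      ENNReal.ofReal (δ ^ (-s)) * ∫⁻ x in Ω, ENNReal.ofReal |w x| := by
  unfold layerIntegral
  rw [← lintegral_const_mul' _ _ ENNReal.ofReal_ne_top]
  refine le_trans (setLIntegral_mono' (measurableSet_layer hZ ht δ b) fun x hx => ?_)
    (lintegral_mono_set fun x hx => h x hx.1 hx.2.1 hx.2.2)
  exact mul_le_mul' (ENNReal.ofReal_le_ofReal
    (Real.rpow_le_rpow_of_nonpos hδ hx.2.1.le (by linarith))) le_rfl

/-- The Hardy inequality in a boundary chart, with the height `t` over the boundary as weight. -/
theorem lintegral_layer_lt_top (hs : 0 < s) (hs1 : s < 1) (hΩ : MeasurableSet Ω)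
    (hZ : MeasurableSet Z) (hw : Measurable w) (he : ‖e‖ = 1) (ht : Measurable t)
    (hte : ∀ x a, t (x + a • e) = t x + a) (hL : 1 ≤ L)
    (htL : ∀ x y, |t x - t y| ≤ L * ‖x - y‖) (hZe : ∀ x (a : ℝ), x + a • e ∈ Z ↔ x ∈ Z)
    (hβ : 0 < β)
    (hZΩ : ∀ x ∈ Z, 0 < t x → t x < 3 * β → ∀ ξ, ‖ξ - x‖ ≤ 2 * β → 0 < t ξ → ξ ∈ Ω)
    (hw1 : ∫⁻ x in Ω, ENNReal.ofReal |w x| < ⊤) (hwg : gagliardo s Ω w < ⊤) :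
    ∫⁻ x in {x | x ∈ Z ∧ 0 < t x ∧ t x < β},
      ENNReal.ofReal (t x ^ (-s)) * ENNReal.ofReal |w x| < ⊤ := by
  have hsub : ∀ x ∈ Z, 0 < t x → t x < 3 * β → x ∈ Ω := fun x hx h0 h1 =>
    hZΩ x hx h0 h1 x (by simp; linarith) h0
  set θ := absorbConst s with hθ
  have hθ0 : 0 ≤ θ := absorbConst_nonneg hs
  have hθ1 : θ < 1 := absorbConst_lt_one hs hs1
  set I := ∫⁻ x in Ω, ENNReal.ofReal |w x| with hI
  set K : ENNReal := 2 * (ENNReal.ofReal (2 ^ (s + 1) /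
        ((1 / (4 * L)) ^ n * volume.real (Metric.ball (0 : Rn n) 1))) *
        (ENNReal.ofReal (1 / (n + s)) * gagliardo s Ω w)) + ENNReal.ofReal (β ^ (-s)) * I with hK
  have hKtop : K ≠ ⊤ := by
    refine ENNReal.add_ne_top.2 ⟨ENNReal.mul_ne_top (by simp) (ENNReal.mul_ne_top
      ENNReal.ofReal_ne_top (ENNReal.mul_ne_top ENNReal.ofReal_ne_top hwg.ne)),
      ENNReal.mul_ne_top ENNReal.ofReal_ne_top hw1.ne⟩
  -- The cut-off at height `δ` makes the layer integral finite, so that it can be absorbed; the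
  -- resulting bound does not depend on `δ`.
  have hbound : ∀ δ, 0 < δ → layerIntegral s Z t w δ β ≤ ENNReal.ofReal (K.toReal / (1 - θ)) := by
    intro δ hδ
    have hfin : layerIntegral s Z t w δ β ≠ ⊤ := by
      refine ne_top_of_le_ne_top (ENNReal.mul_ne_top ENNReal.ofReal_ne_top hw1.ne)
        (layerIntegral_le_of_subset hs ht hZ hδ fun x hx h1 h2 => ?_)
      exact hsub x hx (hδ.trans h1) (by linarith)
    have hsplit : layerIntegral s Z t w δ (3 * β) ≤
        layerIntegral s Z t w δ β + ENNReal.ofReal (β ^ (-s)) * I := by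
      unfold layerIntegral
      have hu : {x | x ∈ Z ∧ δ < t x ∧ t x < 3 * β} ⊆
          {x | x ∈ Z ∧ δ < t x ∧ t x < β} ∪ {x | x ∈ Z ∧ β ≤ t x ∧ t x < 3 * β} := by
        rintro x ⟨h1, h2, h3⟩
        rcases lt_or_ge (t x) β with h | h
        · exact Or.inl ⟨h1, h2, h⟩
        · exact Or.inr ⟨h1, h, h3⟩
      refine (lintegral_mono_set hu).trans ((lintegral_union_le _ _ _).trans ?_)
      gcongr
      rw [← lintegral_const_mul' _ _ ENNReal.ofReal_ne_top]
      have hm : MeasurableSet {x | x ∈ Z ∧ β ≤ t x ∧ t x < 3 * β} :=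
        hZ.inter ((measurableSet_le measurable_const ht).inter
          (measurableSet_lt ht measurable_const))
      refine le_trans (setLIntegral_mono' hm fun x hx => ?_)
        (lintegral_mono_set (t := Ω) fun x hx => hsub x hx.1 (hβ.trans_le hx.2.1) hx.2.2)
      exact mul_le_mul' (ENNReal.ofReal_le_ofReal
        (Real.rpow_le_rpow_of_nonpos hβ hx.2.1 (by linarith))) le_rfl
    have hmain := layerIntegral_le (β := β) hs hΩ hZ hw he ht hte hL htL hZe hZΩ hδ
    set H := layerIntegral s Z t w δ β
    have h2 : H ≤ K + ENNReal.ofReal θ * H := by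
      refine hmain.trans ?_
      calc _ ≤ 2 * (ENNReal.ofReal (2 ^ (s + 1) /
            ((1 / (4 * L)) ^ n * volume.real (Metric.ball (0 : Rn n) 1))) *
            (ENNReal.ofReal (1 / (n + s)) * gagliardo s Ω w)) +
            ENNReal.ofReal θ * (H + ENNReal.ofReal (β ^ (-s)) * I) := by gcongr
        _ ≤ 2 * (ENNReal.ofReal (2 ^ (s + 1) /
            ((1 / (4 * L)) ^ n * volume.real (Metric.ball (0 : Rn n) 1))) *
            (ENNReal.ofReal (1 / (n + s)) * gagliardo s Ω w)) +
            (ENNReal.ofReal θ * H + 1 * (ENNReal.ofReal (β ^ (-s)) * I)) := by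
              rw [mul_add]
              gcongr
              rw [← ENNReal.ofReal_one]
              exact ENNReal.ofReal_le_ofReal hθ1.le
        _ = K + ENNReal.ofReal θ * H := by rw [hK, one_mul]; ring
    have h3 : H.toReal ≤ K.toReal + θ * H.toReal := by
      have hf : ENNReal.ofReal θ * H ≠ ⊤ := ENNReal.mul_ne_top ENNReal.ofReal_ne_top hfin
      have := ENNReal.toReal_mono (ENNReal.add_ne_top.2 ⟨hKtop, hf⟩) h2
      rwa [ENNReal.toReal_add hKtop hf, ENNReal.toReal_mul, ENNReal.toReal_ofReal hθ0] at this
    rw [← ENNReal.ofReal_toReal hfin]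
    apply ENNReal.ofReal_le_ofReal
    rw [le_div_iff₀ (by linarith)]
    linarith
  have hU : {x | x ∈ Z ∧ 0 < t x ∧ t x < β} =
      ⋃ k : ℕ, {x | x ∈ Z ∧ 1 / ((k : ℝ) + 1) < t x ∧ t x < β} := by
    ext x
    simp only [Set.mem_ofPred_eq, Set.mem_iUnion]
    constructor
    · rintro ⟨h1, h2, h3⟩
      obtain ⟨k, hk⟩ := exists_nat_one_div_lt h2
      exact ⟨k, h1, hk, h3⟩
    · rintro ⟨k, h1, h2, h3⟩
      exact ⟨h1, lt_trans (by positivity) h2, h3⟩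
  rw [hU, setLIntegral_iUnion_of_directed]
  · refine lt_of_le_of_lt (iSup_le fun k => hbound (1 / ((k : ℝ) + 1)) (by positivity))
      ENNReal.ofReal_lt_top
  · refine Monotone.directed_le fun k l hkl x hx => ⟨hx.1, lt_of_le_of_lt ?_ hx.2.1, hx.2.2⟩
    have : (k : ℝ) ≤ l := by exact_mod_cast hkl
    apply one_div_le_one_div_of_le (by positivity)
    linarith

end Layer

/-- The potential `∫_{𝒞Ω} |x - y|^{-(n+s)} dy`. -/
noncomputable def extPotential {n : ℕ} (s : ℝ) (Ω : Set (Rn n)) (x : Rn n) : ENNReal :=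
  ∫⁻ y in Ωᶜ, ENNReal.ofReal (1 / ‖x - y‖ ^ ((n : ℝ) + s))

theorem extPotential_le {n : ℕ} (hn : 1 ≤ n) {s : ℝ} (hs : 0 < s) {Ω : Set (Rn n)} {x : Rn n}
    {R : ℝ} (hR : 0 < R) (h : ∀ y ∉ Ω, R ≤ ‖x - y‖) :
    extPotential s Ω x ≤ ENNReal.ofReal (farConst n s * R ^ (-s)) := by
  rw [← lintegral_far_sub hn hs hR x]
  exact lintegral_mono_set fun y hy => h y hy

/-- Near a boundary point, the boundary chart reduces the potential to the weight `t^{-s}`. -/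
theorem hardy_boundary_chart {n : ℕ} (hn : 1 ≤ n) {s : ℝ} (hs : 0 < s) (hs1 : s < 1)
    {Ω : Set (Rn n)} (hΩ : IsOpen Ω) (hL : HasLipschitzBoundary Ω) {w : Rn n → ℝ}
    (hw : Measurable w) (hw1 : ∫⁻ x in Ω, ENNReal.ofReal |w x| < ⊤) (hwg : gagliardo s Ω w < ⊤)
    {p : Rn n} (hp : p ∈ frontier Ω) :
    ∃ ρ > 0, ∫⁻ x in Ω ∩ Metric.ball p ρ, extPotential s Ω x * ENNReal.ofReal |w x| < ⊤ := by
  obtain ⟨e, r, K, γ, he, hr, hγ, hchar⟩ := hL p hp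
  set π : Rn n → Rn n := fun x => x - inner ℝ e x • e with hπ
  set t : Rn n → ℝ := fun x => inner ℝ e x - γ (π x) with ht
  have hK0 : (0 : ℝ) ≤ K := K.2
  have hinner : ∀ x y : Rn n, |inner ℝ e x - inner ℝ e y| ≤ ‖x - y‖ := by
    intro x y
    rw [← inner_sub_right]
    have := abs_real_inner_le_norm e (x - y)
    rwa [he, one_mul] at this
  have hπL : ∀ x y, ‖π x - π y‖ ≤ 2 * ‖x - y‖ := by
    intro x y
    have : π x - π y = (x - y) - (inner ℝ e x - inner ℝ e y) • e := by
      simp only [hπ, sub_smul]; abel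
    rw [this]
    refine (norm_sub_le _ _).trans ?_
    rw [norm_smul, he, mul_one, Real.norm_eq_abs]
    linarith [hinner x y]
  have hγL : ∀ x y, |γ x - γ y| ≤ K * ‖x - y‖ := by
    intro x y
    have := hγ.dist_le_mul x y
    rwa [Real.dist_eq, dist_eq_norm] at this
  set L : ℝ := 1 + 2 * K with hLdef
  have htL : ∀ x y, |t x - t y| ≤ L * ‖x - y‖ := by
    intro x y
    have h1 := hinner x y
    have h2 := hγL (π x) (π y)
    have h3 := mul_le_mul_of_nonneg_left (hπL x y) hK0
    have : t x - t y = (inner ℝ e x - inner ℝ e y) - (γ (π x) - γ (π y)) := by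
      simp only [ht]; ring
    rw [this, hLdef]
    refine (abs_sub _ _).trans ?_
    linarith
  have htc : Continuous t := by
    have : Continuous π := by fun_prop
    exact (by fun_prop : Continuous fun x : Rn n => inner ℝ e x).sub (hγ.continuous.comp this)
  have hin : ∀ x (a : ℝ), inner ℝ e (x + a • e) = inner ℝ e x + a := by
    intro x a
    rw [inner_add_right, inner_smul_right, real_inner_self_eq_norm_sq, he]; ring
  have hπe : ∀ x (a : ℝ), π (x + a • e) = π x := by
    intro x a
    simp only [hπ, hin, add_smul]; abel
  have hte : ∀ x a, t (x + a • e) = t x + a := by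
    intro x a
    simp only [ht, hin, hπe]; ring
  have hchar' : ∀ x ∈ Metric.ball p r, x ∈ Ω ↔ 0 < t x := by
    intro x hx
    rw [hchar x hx]
    simp only [ht, hπ, sub_pos]
  have hpr : p ∈ Metric.ball p r := Metric.mem_ball_self hr
  have htp : t p = 0 := by
    apply le_antisymm
    · by_contra h
      have h1 := (hchar' p hpr).2 (not_le.1 h)
      rw [hΩ.frontier_eq] at hp
      exact hp.2 h1
    · by_contra h
      have hU : IsOpen ({x | t x < 0} ∩ Metric.ball p r) :=
        (isOpen_lt htc continuous_const).inter Metric.isOpen_ball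
      obtain ⟨y, hy1, hy2⟩ := mem_closure_iff.1 (frontier_subset_closure hp) _ hU
        ⟨not_le.1 h, hpr⟩
      have := (hchar' y hy1.2).1 hy2
      have h3 : t y < 0 := hy1.1
      linarith
  -- Points of `Z` of height at most `3 β` have distance at most `(4 + K) β` from `p`, and a further
  -- displacement by `2 β` has to remain in the ball of radius `r`.
  set β : ℝ := r / (7 + K) with hβdef
  have hβ : 0 < β := by positivity
  have hβr : (7 + K) * β = r := by rw [hβdef]; field_simp
  set Z : Set (Rn n) := {x | ‖π x - π p‖ < β} with hZ
  have hZm : MeasurableSet Z := by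
    have : Continuous π := by fun_prop
    exact (isOpen_lt (by fun_prop) continuous_const).measurableSet
  have hZe : ∀ x (a : ℝ), x + a • e ∈ Z ↔ x ∈ Z := by
    intro x a
    simp only [hZ, Set.mem_ofPred_eq, hπe]
  have hZΩ : ∀ x ∈ Z, 0 < t x → t x < 3 * β → ∀ ξ, ‖ξ - x‖ ≤ 2 * β → 0 < t ξ → ξ ∈ Ω := by
    intro x hx h0 h1 ξ hξ hξ0
    refine (hchar' ξ ?_).2 hξ0
    have hx : ‖π x - π p‖ < β := hx
    have e1 : x - p = (π x - π p) + (inner ℝ e x - inner ℝ e p) • e := by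
      simp only [hπ, sub_smul]; abel
    have e2 : |inner ℝ e x - inner ℝ e p| ≤ 3 * β + K * β := by
      have h2 := hγL (π x) (π p)
      have h3 := mul_le_mul_of_nonneg_left hx.le hK0
      have : inner ℝ e x - inner ℝ e p = t x + (γ (π x) - γ (π p)) := by
        have : inner ℝ e p - γ (π p) = 0 := htp
        simp only [ht]; linarith
      rw [this]
      refine (abs_add_le _ _).trans ?_
      rw [abs_of_pos h0]
      linarith
    have e3 : ‖x - p‖ ≤ β + (3 * β + K * β) := by
      rw [e1]
      refine (norm_add_le _ _).trans ?_
      rw [norm_smul, he, mul_one, Real.norm_eq_abs]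
      linarith
    rw [mem_ball_iff_norm]
    have e4 : ξ - p = (ξ - x) + (x - p) := by abel
    rw [e4]
    refine lt_of_le_of_lt (norm_add_le _ _) ?_
    nlinarith
  have hlayer := lintegral_layer_lt_top hs hs1 hΩ.measurableSet hZm hw he htc.measurable hte
    (by rw [hLdef]; linarith) htL hZe hβ hZΩ hw1 hwg
  have hL0 : 0 < L := by rw [hLdef]; positivity
  refine ⟨min (β / (2 * L)) (r / 2), by positivity, ?_⟩
  set ρ := min (β / (2 * L)) (r / 2) with hρ
  have hρ1 : 2 * L * ρ ≤ β := by
    have : ρ ≤ β / (2 * L) := min_le_left _ _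
    rw [le_div_iff₀ (by positivity)] at this
    linarith
  have hρ2 : ρ ≤ r / 2 := min_le_right _ _
  have hL1 : 1 ≤ L := by rw [hLdef]; linarith
  have hmem : ∀ x ∈ Ω ∩ Metric.ball p ρ, x ∈ {x | x ∈ Z ∧ 0 < t x ∧ t x < β} ∧
      extPotential s Ω x ≤ ENNReal.ofReal (farConst n s * L ^ s) * ENNReal.ofReal (t x ^ (-s)) := by
    rintro x ⟨hxΩ, hxρ⟩
    rw [mem_ball_iff_norm] at hxρ
    have hxn := norm_nonneg (x - p)
    have hxr : x ∈ Metric.ball p r := by rw [mem_ball_iff_norm]; linarith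
    have htx : 0 < t x := (hchar' x hxr).1 hxΩ
    have htx1 : t x ≤ L * ‖x - p‖ := by
      have := htL x p
      rw [htp, sub_zero, abs_of_pos htx] at this
      exact this
    have hLρ : L * ‖x - p‖ < L * ρ := by gcongr
    refine ⟨⟨?_, htx, by nlinarith⟩, ?_⟩
    · have := hπL x p
      change ‖π x - π p‖ < β
      nlinarith
    · have hfar : ∀ y ∉ Ω, t x / L ≤ ‖x - y‖ := by
        intro y hy
        rw [div_le_iff₀ hL0, mul_comm]
        by_cases hyr : y ∈ Metric.ball p r
        · have hty : t y ≤ 0 := by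
            by_contra h
            exact hy ((hchar' y hyr).2 (not_le.1 h))
          have := (abs_le.1 (htL x y)).2
          linarith
        · rw [mem_ball_iff_norm, not_lt] at hyr
          have : ‖y - p‖ ≤ ‖x - y‖ + ‖x - p‖ := by
            have : y - p = (x - p) - (x - y) := by abel
            rw [this]
            linarith [norm_sub_le (x - p) (x - y)]
          have : ρ ≤ ‖x - y‖ := by linarith
          have := mul_le_mul_of_nonneg_left this hL0.le
          linarith
      refine (extPotential_le hn hs (div_pos htx hL0) hfar).trans (le_of_eq ?_)
      rw [← ENNReal.ofReal_mul (mul_nonneg (farConst_pos hn hs).le (by positivity)),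
        Real.div_rpow htx.le hL0.le, Real.rpow_neg hL0.le]
      congr 1
      field_simp
  calc ∫⁻ x in Ω ∩ Metric.ball p ρ, extPotential s Ω x * ENNReal.ofReal |w x|
      ≤ ∫⁻ x in Ω ∩ Metric.ball p ρ, ENNReal.ofReal (farConst n s * L ^ s) *
          (ENNReal.ofReal (t x ^ (-s)) * ENNReal.ofReal |w x|) := by
        refine setLIntegral_mono' (hΩ.measurableSet.inter measurableSet_ball) fun x hx => ?_
        rw [← mul_assoc]
        gcongr
        exact (hmem x hx).2
    _ ≤ ∫⁻ x in {x | x ∈ Z ∧ 0 < t x ∧ t x < β}, ENNReal.ofReal (farConst n s * L ^ s) *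
          (ENNReal.ofReal (t x ^ (-s)) * ENNReal.ofReal |w x|) :=
        lintegral_mono_set fun x hx => (hmem x hx).1
    _ < ⊤ := by
        rw [lintegral_const_mul' _ _ ENNReal.ofReal_ne_top]
        exact ENNReal.mul_lt_top ENNReal.ofReal_lt_top hlayer

theorem hardy_measurable {n : ℕ} (hn : 1 ≤ n) {s : ℝ} (hs : 0 < s) (hs1 : s < 1)
    {Ω : Set (Rn n)} (hΩ : IsOpen Ω) (hb : Bornology.IsBounded Ω) (hL : HasLipschitzBoundary Ω)
    {w : Rn n → ℝ} (hw : Measurable w) (hw1 : ∫⁻ x in Ω, ENNReal.ofReal |w x| < ⊤)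
    (hwg : gagliardo s Ω w < ⊤) :
    ∫⁻ x in Ω, extPotential s Ω x * ENNReal.ofReal |w x| < ⊤ := by
  have hc : IsCompact (closure Ω) := hb.isCompact_closure
  have key := hc.induction_on
    (p := fun S => ∫⁻ x in Ω ∩ S, extPotential s Ω x * ENNReal.ofReal |w x| < ⊤)
    (by simp) (fun S T hST hT => lt_of_le_of_lt
      (lintegral_mono_set (Set.inter_subset_inter_right _ hST)) hT)
    (fun S T hS hT => by
      rw [Set.inter_union_distrib_left]
      exact lt_of_le_of_lt (lintegral_union_le _ _ _) (ENNReal.add_lt_top.2 ⟨hS, hT⟩)) ?_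
  · rwa [Set.inter_eq_left.2 subset_closure] at key
  · intro x hx
    by_cases hxΩ : x ∈ Ω
    · obtain ⟨d, hd, hball⟩ := Metric.isOpen_iff.1 hΩ x hxΩ
      refine ⟨Metric.ball x (d / 2), mem_nhdsWithin_of_mem_nhds
        (Metric.ball_mem_nhds x (by positivity)), ?_⟩
      calc ∫⁻ y in Ω ∩ Metric.ball x (d / 2), extPotential s Ω y * ENNReal.ofReal |w y|
          ≤ ∫⁻ y in Ω ∩ Metric.ball x (d / 2),
              ENNReal.ofReal (farConst n s * (d / 2) ^ (-s)) * ENNReal.ofReal |w y| := by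
            refine setLIntegral_mono' (hΩ.measurableSet.inter measurableSet_ball) fun y hy => ?_
            gcongr
            refine extPotential_le hn hs (by positivity) fun z hz => ?_
            have h1 : z ∉ Metric.ball x d := fun h => hz (hball h)
            have h2 := hy.2
            rw [Metric.mem_ball] at h1 h2
            rw [← dist_eq_norm, dist_comm]
            have := dist_triangle z y x
            linarith
        _ ≤ ENNReal.ofReal (farConst n s * (d / 2) ^ (-s)) * ∫⁻ y in Ω, ENNReal.ofReal |w y| := by
            rw [lintegral_const_mul' _ _ ENNReal.ofReal_ne_top]
            gcongr
            exact Set.inter_subset_left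
        _ < ⊤ := ENNReal.mul_lt_top ENNReal.ofReal_lt_top hw1
    · obtain ⟨ρ, hρ, h⟩ := hardy_boundary_chart hn hs hs1 hΩ hL hw hw1 hwg (p := x)
        (by rw [hΩ.frontier_eq]; exact ⟨hx, hxΩ⟩)
      exact ⟨Metric.ball x ρ, mem_nhdsWithin_of_mem_nhds (Metric.ball_mem_nhds x hρ), h⟩

theorem gagliardo_congr {n : ℕ} {s : ℝ} {Ω : Set (Rn n)} {u v : Rn n → ℝ}
    (h : u =ᵐ[volume.restrict Ω] v) : gagliardo s Ω u = gagliardo s Ω v := by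
  unfold gagliardo
  refine lintegral_congr_ae ?_
  filter_upwards [h] with x hx
  refine lintegral_congr_ae ?_
  filter_upwards [h] with y hy
  rw [hx, hy]

/-- The fractional Hardy inequality on a bounded Lipschitz domain. It is available because
`s < 1`, so that no boundary condition on `w` is needed. -/
theorem hardy {n : ℕ} (hn : 1 ≤ n) {s : ℝ} (hs : 0 < s) (hs1 : s < 1)
    {Ω : Set (Rn n)} (hΩ : IsOpen Ω) (hb : Bornology.IsBounded Ω) (hL : HasLipschitzBoundary Ω)
    {w : Rn n → ℝ} (hw : w ∈ W s Ω) :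
    ∫⁻ x in Ω, extPotential s Ω x * ENNReal.ofReal |w x| < ⊤ := by
  obtain ⟨h1, h2⟩ := hw
  set w' := h1.aestronglyMeasurable.mk w with hw'
  have hae : w =ᵐ[volume.restrict Ω] w' := h1.aestronglyMeasurable.ae_eq_mk
  have hm : Measurable w' := h1.aestronglyMeasurable.stronglyMeasurable_mk.measurable
  have h3 : ∫⁻ x in Ω, ENNReal.ofReal |w' x| < ⊤ := by
    have := (h1.congr hae).2
    rw [HasFiniteIntegral] at this
    simpa only [← ofReal_norm, Real.norm_eq_abs] using this
  have := hardy_measurable hn hs hs1 hΩ hb hL hm h3 (by rwa [← gagliardo_congr hae])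
  refine lt_of_eq_of_lt (lintegral_congr_ae ?_) this
  filter_upwards [hae] with x hx
  rw [hx]

end NonlocalObstacle

/-! ### The fractional area functional -/

namespace NonlocalObstacle

variable {n : ℕ} {s : ℝ} {Ω A : Set (Rn n)} {φ ψ u v : Rn n → ℝ}

/-- The integrand of the Gagliardo seminorm, as a function on pairs. -/
noncomputable def gagDensity (s : ℝ) (u : Rn n → ℝ) (p : Rn n × Rn n) : ENNReal :=
  ENNReal.ofReal (|u p.1 - u p.2| / ‖p.1 - p.2‖ ^ ((n : ℝ) + s))

theorem aemeasurable_pair_fst {α β γ : Type*} [MeasurableSpace α] [MeasurableSpace β]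
    [MeasurableSpace γ] {μ : Measure α} {ν : Measure β} [SFinite ν] {f : α → γ}
    (hf : AEMeasurable f μ) : AEMeasurable (fun p : α × β => f p.1) (μ.prod ν) :=
  hf.comp_quasiMeasurePreserving Measure.quasiMeasurePreserving_fst

theorem aemeasurable_pair_snd {α β γ : Type*} [MeasurableSpace α] [MeasurableSpace β]
    [MeasurableSpace γ] {μ : Measure α} {ν : Measure β} [SFinite μ] [SFinite ν] {f : β → γ}
    (hf : AEMeasurable f ν) : AEMeasurable (fun p : α × β => f p.2) (μ.prod ν) :=
  hf.comp_quasiMeasurePreserving Measure.quasiMeasurePreserving_snd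

theorem aemeasurable_gagDensity {μ ν : Measure (Rn n)} [SFinite μ] [SFinite ν]
    (hu : AEMeasurable u μ) (hu' : AEMeasurable u ν) :
    AEMeasurable (gagDensity s u) (μ.prod ν) := by
  have h1 := aemeasurable_pair_fst (ν := ν) hu
  have h2 := aemeasurable_pair_snd (μ := μ) hu'
  unfold gagDensity
  refine ENNReal.measurable_ofReal.comp_aemeasurable (AEMeasurable.div ?_ ?_)
  · exact continuous_abs.measurable.comp_aemeasurable (h1.sub h2)
  · exact Measurable.aemeasurable (by fun_prop)

theorem gagliardo_eq_lintegral_prod (hu : AEMeasurable u (volume.restrict Ω)) :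
    gagliardo s Ω u = ∫⁻ p in Ω ×ˢ Ω, gagDensity s u p := by
  rw [Measure.volume_eq_prod, ← Measure.prod_restrict, lintegral_prod _
    (aemeasurable_gagDensity hu hu)]
  rfl

theorem W_aemeasurable (hu : u ∈ W s Ω) : AEMeasurable u (volume.restrict Ω) :=
  hu.1.aestronglyMeasurable.aemeasurable

theorem gagliardo_lt_top_of_le {w : Rn n → ℝ} (hu : u ∈ W s Ω) (hv : v ∈ W s Ω)
    (h : ∀ x y, |w x - w y| ≤ |u x - u y| + |v x - v y|) : gagliardo s Ω w < ⊤ := by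
  have h1 := gagliardo_eq_lintegral_prod (s := s) (W_aemeasurable hu)
  have h2 := gagliardo_eq_lintegral_prod (s := s) (W_aemeasurable hv)
  have hle : gagliardo s Ω w ≤ ∫⁻ x in Ω, ∫⁻ y in Ω, (gagDensity s u (x, y) +
      gagDensity s v (x, y)) := by
    unfold gagliardo
    refine lintegral_mono fun x => lintegral_mono fun y => ?_
    unfold gagDensity
    rw [← ENNReal.ofReal_add (by positivity) (by positivity), ← add_div]
    apply ENNReal.ofReal_le_ofReal
    gcongr
    exact h x y
  refine lt_of_le_of_lt hle ?_
  have h3 := aemeasurable_gagDensity (s := s) (W_aemeasurable hu) (W_aemeasurable hu)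
  have h4 := aemeasurable_gagDensity (s := s) (W_aemeasurable hv) (W_aemeasurable hv)
  rw [← lintegral_prod (fun p => gagDensity s u p + gagDensity s v p) (h3.add h4),
    lintegral_add_left' h3, Measure.prod_restrict, ← Measure.volume_eq_prod, ← h1, ← h2]
  exact ENNReal.add_lt_top.2 ⟨hu.2, hv.2⟩

theorem W_sub (hu : u ∈ W s Ω) (hv : v ∈ W s Ω) : (fun x => u x - v x) ∈ W s Ω := by
  refine ⟨hu.1.sub hv.1, gagliardo_lt_top_of_le hu hv fun x y => ?_⟩
  rw [show u x - v x - (u y - v y) = (u x - u y) - (v x - v y) by ring]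
  exact abs_sub _ _

theorem W_midpoint (hu : u ∈ W s Ω) (hv : v ∈ W s Ω) : (fun x => (u x + v x) / 2) ∈ W s Ω := by
  refine ⟨(hu.1.add hv.1).div_const 2, gagliardo_lt_top_of_le hu hv fun x y => ?_⟩
  rw [show (u x + v x) / 2 - (u y + v y) / 2 = ((u x - u y) + (v x - v y)) / 2 by ring, abs_div,
    abs_of_pos (by norm_num : (0 : ℝ) < 2)]
  have := abs_add_le (u x - u y) (v x - v y)
  linarith [abs_nonneg (u x - u y + (v x - v y))]

theorem W_of_lipschitz {w : Rn n → ℝ} (hu : u ∈ W s Ω) (hw : IntegrableOn w Ω)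
    (h : ∀ x y, |w x - w y| ≤ |u x - u y|) : w ∈ W s Ω :=
  ⟨hw, gagliardo_lt_top_of_le hu hu fun x y => (h x y).trans (by linarith [abs_nonneg (u x - u y)])⟩

theorem W_congr (hu : u ∈ W s Ω) (h : u =ᵐ[volume.restrict Ω] v) : v ∈ W s Ω :=
  ⟨hu.1.congr h, by rw [← gagliardo_congr h]; exact hu.2⟩

theorem WObs_midpoint (hu : u ∈ WObs s Ω A φ ψ) (hv : v ∈ WObs s Ω A φ ψ) :
    (fun x => (u x + v x) / 2) ∈ WObs s Ω A φ ψ := by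
  obtain ⟨hu1, hu2, hu3⟩ := hu
  obtain ⟨hv1, hv2, hv3⟩ := hv
  refine ⟨W_midpoint hu1 hv1, ?_, ?_⟩
  · filter_upwards [hu2, hv2] with x h1 h2 hx
    rw [h1 hx, h2 hx]; ring
  · filter_upwards [hu3, hv3] with x h1 h2 hx
    linarith [h1 hx, h2 hx]

theorem aemeasurable_of_restrict_compl {α : Type*} [MeasurableSpace α] {μ : Measure α} {S : Set α}
    {f : α → ℝ} (hS : MeasurableSet S) (h1 : AEMeasurable f (μ.restrict S))
    (h2 : AEMeasurable f (μ.restrict Sᶜ)) : AEMeasurable f μ := by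
  rw [← Measure.restrict_add_restrict_compl (μ := μ) hS]
  exact h1.add_measure h2

theorem WObs_aemeasurable (hΩ : MeasurableSet Ω) (hφ : AEMeasurable φ (volume.restrict Ωᶜ))
    (hu : u ∈ WObs s Ω A φ ψ) : AEMeasurable u := by
  refine aemeasurable_of_restrict_compl hΩ (W_aemeasurable hu.1) (hφ.congr ?_)
  filter_upwards [ae_restrict_of_ae hu.2.1, self_mem_ae_restrict hΩ.compl] with x h1 h2
  exact (h1 h2).symm

theorem areaDiff_swap (s : ℝ) (u v : Rn n → ℝ) (p : Rn n × Rn n) :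
    areaDiff s u v p.swap = areaDiff s u v p := by
  unfold areaDiff
  simp only [Prod.fst_swap, Prod.snd_swap]
  rw [norm_sub_rev p.2 p.1, ← neg_sub (u p.1), ← neg_sub (v p.1), neg_div, neg_div, GG_neg, GG_neg]

theorem areaDiff_add (s : ℝ) (u v w : Rn n → ℝ) (p : Rn n × Rn n) :
    areaDiff s u v p + areaDiff s v w p = areaDiff s u w p := by
  unfold areaDiff; rw [← add_div]; congr 1; ring

theorem aemeasurable_areaDiff (hu : AEMeasurable u) (hv : AEMeasurable v) :
    AEMeasurable (areaDiff s u v) := by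
  have key : ∀ {w : Rn n → ℝ}, AEMeasurable w → AEMeasurable
      (fun p : Rn n × Rn n => GG n s ((w p.1 - w p.2) / ‖p.1 - p.2‖)) := fun hw =>
    (continuous_GG n s).measurable.comp_aemeasurable
      (((aemeasurable_pair_fst hw).sub (aemeasurable_pair_snd hw)).div
        (Measurable.aemeasurable (by fun_prop)))
  exact ((key hu).sub (key hv)).div (Measurable.aemeasurable (by fun_prop))

theorem abs_areaDiff_le (hn : 1 ≤ n) (hs : 0 < s) (u v : Rn n → ℝ) (p : Rn n × Rn n) :
    |areaDiff s u v p| ≤ gMass n s *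
      (|(u p.1 - v p.1) - (u p.2 - v p.2)| / ‖p.1 - p.2‖ ^ ((n : ℝ) + s)) := by
  have h1 : (1 : ℝ) ≤ n := by exact_mod_cast hn
  unfold areaDiff
  rcases (norm_nonneg (p.1 - p.2)).eq_or_lt with h | h
  · rw [← h, Real.zero_rpow (by linarith), Real.zero_rpow (by linarith)]; simp
  · rw [abs_div, abs_of_pos (Real.rpow_pos_of_pos h _), div_le_iff₀ (Real.rpow_pos_of_pos h _)]
    refine (abs_GG_sub_le hn hs _ _).trans (le_of_eq ?_)
    rw [← sub_div, abs_div, abs_of_pos h, show (n : ℝ) + s = ((n : ℝ) - 1 + s) + 1 by ring,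
      Real.rpow_add_one h.ne']
    have : 0 < ‖p.1 - p.2‖ ^ ((n : ℝ) - 1 + s) := Real.rpow_pos_of_pos h _
    rw [sub_sub_sub_comm]
    field_simp

theorem measurableSet_Q (hΩ : MeasurableSet Ω) : MeasurableSet (Q Ω) :=
  (hΩ.compl.prod hΩ.compl).compl

theorem lintegral_Q (hΩ : MeasurableSet Ω) (F : Rn n × Rn n → ENNReal) :
    ∫⁻ p in Q Ω, F p = (∫⁻ p in Ω ×ˢ Ω, F p) + (∫⁻ p in Ω ×ˢ Ωᶜ, F p) + ∫⁻ p in Ωᶜ ×ˢ Ω, F p := by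
  have hQ : Q Ω = (Ω ×ˢ Ω ∪ Ω ×ˢ Ωᶜ) ∪ Ωᶜ ×ˢ Ω := by
    ext ⟨x, y⟩
    simp only [Q, Set.mem_compl_iff, Set.mem_prod, Set.mem_union]
    tauto
  rw [hQ, lintegral_union (hΩ.compl.prod hΩ), lintegral_union (hΩ.prod hΩ.compl)]
  · rw [Set.disjoint_left]
    rintro ⟨x, y⟩ h1 h2
    exact h2.2 h1.2
  · rw [Set.disjoint_left]
    rintro ⟨x, y⟩ (h1 | h1) h2
    · exact h2.1 h1.1
    · exact h2.1 h1.1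

theorem lintegral_prod_set_swap (S T : Set (Rn n)) (F : Rn n × Rn n → ENNReal) :
    ∫⁻ p in T ×ˢ S, F p = ∫⁻ p in S ×ˢ T, F p.swap := by
  rw [Measure.volume_eq_prod, ← Measure.prod_restrict, ← Measure.prod_restrict,
    lintegral_prod_swap]

/-- The integral over `Q(Ω)` of a symmetric density. -/
theorem lintegral_Q_of_symm (hΩ : MeasurableSet Ω) {F : Rn n × Rn n → ENNReal}
    (hF : ∀ p, F p.swap = F p) :
    ∫⁻ p in Q Ω, F p = (∫⁻ p in Ω ×ˢ Ω, F p) + 2 * ∫⁻ p in Ω ×ˢ Ωᶜ, F p := by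
  rw [lintegral_Q hΩ, lintegral_prod_set_swap Ω Ωᶜ]
  simp_rw [hF]
  rw [two_mul, add_assoc]

/-- For `w` vanishing outside `Ω`, the interactions of `Ω` with its complement are controlled by
the Hardy inequality. -/
theorem lintegral_gagDensity_ext_lt_top (hn : 1 ≤ n) (hs : 0 < s) (hs1 : s < 1) (hΩ : IsOpen Ω)
    (hb : Bornology.IsBounded Ω) (hL : HasLipschitzBoundary Ω) {w : Rn n → ℝ} (hw : w ∈ W s Ω)
    (hmeas : AEMeasurable w) (hout : ∀ᵐ x, x ∉ Ω → w x = 0) :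
    ∫⁻ p in Ω ×ˢ Ωᶜ, gagDensity s w p < ⊤ := by
  rw [Measure.volume_eq_prod, ← Measure.prod_restrict, lintegral_prod _
    (aemeasurable_gagDensity hmeas.restrict hmeas.restrict)]
  refine lt_of_eq_of_lt (lintegral_congr fun x => ?_) (hardy hn hs hs1 hΩ hb hL hw)
  unfold extPotential
  rw [← lintegral_mul_const' _ _ ENNReal.ofReal_ne_top]
  refine lintegral_congr_ae ?_
  filter_upwards [ae_restrict_of_ae hout, self_mem_ae_restrict hΩ.measurableSet.compl] with y h1 h2
  unfold gagDensity
  simp only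
  rw [h1 h2, ← ENNReal.ofReal_mul (by positivity), sub_zero]
  congr 1; ring

theorem lintegral_Q_gagDensity_lt_top (hn : 1 ≤ n) (hs : 0 < s) (hs1 : s < 1) (hΩ : IsOpen Ω)
    (hb : Bornology.IsBounded Ω) (hL : HasLipschitzBoundary Ω) {w : Rn n → ℝ} (hw : w ∈ W s Ω)
    (hmeas : AEMeasurable w) (hout : ∀ᵐ x, x ∉ Ω → w x = 0) :
    ∫⁻ p in Q Ω, gagDensity s w p < ⊤ := by
  rw [lintegral_Q_of_symm hΩ.measurableSet]
  · refine ENNReal.add_lt_top.2 ⟨?_, ENNReal.mul_lt_top (by simp)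
      (lintegral_gagDensity_ext_lt_top hn hs hs1 hΩ hb hL hw hmeas hout)⟩
    rw [← gagliardo_eq_lintegral_prod hmeas.restrict]
    exact hw.2
  · intro p
    simp only [gagDensity, Prod.fst_swap, Prod.snd_swap]
    rw [norm_sub_rev, abs_sub_comm]

theorem integrableOn_areaDiff (hn : 1 ≤ n) (hs : 0 < s) (hs1 : s < 1) (hΩ : IsOpen Ω)
    (hb : Bornology.IsBounded Ω) (hL : HasLipschitzBoundary Ω)
    (hφ : AEMeasurable φ (volume.restrict Ωᶜ)) (hu : u ∈ WObs s Ω A φ ψ)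
    (hv : v ∈ WObs s Ω A φ ψ) : IntegrableOn (areaDiff s u v) (Q Ω) := by
  have hum := WObs_aemeasurable hΩ.measurableSet hφ hu
  have hvm := WObs_aemeasurable hΩ.measurableSet hφ hv
  set w := fun x => u x - v x with hw
  have hwW : w ∈ W s Ω := W_sub hu.1 hv.1
  have hwm : AEMeasurable w := hum.sub hvm
  have hout : ∀ᵐ x, x ∉ Ω → w x = 0 := by
    filter_upwards [hu.2.1, hv.2.1] with x h1 h2 hx
    simp [hw, h1 hx, h2 hx]
  refine ⟨(aemeasurable_areaDiff hum hvm).restrict.aestronglyMeasurable, ?_⟩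
  rw [HasFiniteIntegral]
  have hle : ∀ p, ‖areaDiff s u v p‖ₑ ≤ ENNReal.ofReal (gMass n s) * gagDensity s w p := by
    intro p
    rw [← ofReal_norm, Real.norm_eq_abs, gagDensity, ← ENNReal.ofReal_mul (gMass_nonneg n s)]
    exact ENNReal.ofReal_le_ofReal (abs_areaDiff_le hn hs u v p)
  refine lt_of_le_of_lt (lintegral_mono hle) ?_
  rw [lintegral_const_mul' _ _ ENNReal.ofReal_ne_top]
  exact ENNReal.mul_lt_top ENNReal.ofReal_lt_top
    (lintegral_Q_gagDensity_lt_top hn hs hs1 hΩ hb hL hwW hwm hout)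

/-- The fractional area is midpoint convex. -/
theorem areaDiff_midpoint_nonneg (u v : Rn n → ℝ) (p : Rn n × Rn n) :
    0 ≤ areaDiff s u (fun x => (u x + v x) / 2) p + areaDiff s v (fun x => (u x + v x) / 2) p := by
  unfold areaDiff
  rw [← add_div]
  refine div_nonneg ?_ (Real.rpow_nonneg (norm_nonneg _) _)
  have := GG_midpoint n s ((u p.1 - u p.2) / ‖p.1 - p.2‖) ((v p.1 - v p.2) / ‖p.1 - p.2‖)
  rw [show ((u p.1 + v p.1) / 2 - (u p.2 + v p.2) / 2) / ‖p.1 - p.2‖ =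
    ((u p.1 - u p.2) / ‖p.1 - p.2‖ + (v p.1 - v p.2) / ‖p.1 - p.2‖) / 2 by ring]
  linarith

theorem sub_eq_sub_of_areaDiff_midpoint {p : Rn n × Rn n} (hp : p.1 ≠ p.2)
    (h : areaDiff s u (fun x => (u x + v x) / 2) p +
      areaDiff s v (fun x => (u x + v x) / 2) p = 0) :
    u p.1 - u p.2 = v p.1 - v p.2 := by
  have hr : 0 < ‖p.1 - p.2‖ := norm_pos_iff.2 (sub_ne_zero.2 hp)
  unfold areaDiff at h
  rw [← add_div, div_eq_zero_iff, or_iff_left (Real.rpow_pos_of_pos hr _).ne',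
    show ((u p.1 + v p.1) / 2 - (u p.2 + v p.2) / 2) / ‖p.1 - p.2‖ =
    ((u p.1 - u p.2) / ‖p.1 - p.2‖ + (v p.1 - v p.2) / ‖p.1 - p.2‖) / 2 by ring] at h
  have := eq_of_GG_midpoint (n := n) (s := s) (a := (u p.1 - u p.2) / ‖p.1 - p.2‖)
    (b := (v p.1 - v p.2) / ‖p.1 - p.2‖) (by linarith)
  rwa [div_left_inj' hr.ne'] at this

theorem volume_compl_ne_zero (hn : 1 ≤ n) (hb : Bornology.IsBounded Ω) : volume Ωᶜ ≠ 0 := by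
  have := nontrivial_Rn hn
  intro h
  have h1 : volume (Set.univ : Set (Rn n)) ≤ volume Ω + volume Ωᶜ := by
    rw [← Set.union_compl_self Ω]; exact measure_union_le _ _
  rw [h, add_zero, measure_univ_of_isAddLeftInvariant, top_le_iff] at h1
  exact hb.measure_lt_top.ne h1

/-- Two solutions coincide: strict convexity gives `u(x) - u(y) = v(x) - v(y)` for almost all
pairs in `Q(Ω)`, and one may take `y` outside `Ω`, where both are the exterior datum. -/
theorem SolvesObstacle.unique (hn : 1 ≤ n) (hΩ : IsOpen Ω) (hb : Bornology.IsBounded Ω)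
    (hu : SolvesObstacle s Ω A φ ψ u) (hv : SolvesObstacle s Ω A φ ψ v) :
    v =ᵐ[volume] u := by
  set m := fun x => (u x + v x) / 2 with hm
  have hmW : m ∈ WObs s Ω A φ ψ := WObs_midpoint hu.1 hv.1
  obtain ⟨i1, l1⟩ := hu.2 m hmW
  obtain ⟨i2, l2⟩ := hv.2 m hmW
  have hQm := measurableSet_Q hΩ.measurableSet
  have h0 : ∫ p in Q Ω, (areaDiff s u m p + areaDiff s v m p) = 0 := by
    apply le_antisymm
    · rw [integral_add i1 i2]; linarith
    · exact integral_nonneg fun p => areaDiff_midpoint_nonneg u v p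
  rw [integral_eq_zero_iff_of_nonneg (fun p => areaDiff_midpoint_nonneg u v p) (i1.add i2)] at h0
  have h1 : ∀ᵐ p : Rn n × Rn n, p ∈ Q Ω → u p.1 - u p.2 = v p.1 - v p.2 := by
    filter_upwards [(ae_restrict_iff' hQm).1 h0, ae_ne_diagonal hn] with p hp hne hpQ
    exact sub_eq_sub_of_areaDiff_midpoint hne (hp hpQ)
  rw [Measure.volume_eq_prod] at h1
  have h2 := (Measure.ae_ae_of_ae_prod h1)
  filter_upwards [h2, hu.1.2.1, hv.1.2.1] with x hx hux hvx
  by_cases hxΩ : x ∈ Ω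
  · have hne : (ae (volume.restrict Ωᶜ)).NeBot := by
      rw [ae_neBot, Ne, Measure.restrict_eq_zero]
      exact volume_compl_ne_zero hn hb
    obtain ⟨y, ⟨⟨h4, h5⟩, h6⟩, hy⟩ := ((ae_restrict_of_ae ((hx.and hu.1.2.1).and hv.1.2.1)).and
      (self_mem_ae_restrict hΩ.measurableSet.compl)).exists
    have := h4 (by simp [Q, hxΩ])
    rw [h5 hy, h6 hy] at this
    linarith
  · rw [hux hxΩ, hvx hxΩ]

end NonlocalObstacle

/-! ### Truncation decreases the area -/

namespace NonlocalObstacle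

variable {n : ℕ} {s : ℝ} {Ω A : Set (Rn n)} {φ ψ u v : Rn n → ℝ}

/-- The truncation of `v` in `Ω` between the levels `-N` and `N`. -/
noncomputable def truncOn (Ω : Set (Rn n)) (N : ℝ) (v : Rn n → ℝ) (x : Rn n) : ℝ :=
  open Classical in if x ∈ Ω then max (-N) (min (v x) N) else v x

theorem truncOn_of_mem {N : ℝ} {x : Rn n} (hx : x ∈ Ω) :
    truncOn Ω N v x = max (-N) (min (v x) N) := by
  simp [truncOn, hx]

theorem truncOn_of_notMem {N : ℝ} {x : Rn n} (hx : x ∉ Ω) : truncOn Ω N v x = v x := by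
  simp [truncOn, hx]

theorem abs_clamp_le {N a : ℝ} (hN : 0 ≤ N) : |max (-N) (min a N)| ≤ N := by
  rw [abs_le]
  exact ⟨le_max_left _ _, max_le (by linarith) (min_le_right _ _)⟩

theorem abs_clamp_sub_clamp_le (N a b : ℝ) :
    |max (-N) (min a N) - max (-N) (min b N)| ≤ |a - b| := by
  refine (abs_max_sub_max_le_max _ _ _ _).trans ?_
  rw [sub_self, abs_zero]
  refine max_le (abs_nonneg _) ((abs_min_sub_min_le_max _ _ _ _).trans ?_)
  rw [sub_self, abs_zero]
  exact max_le le_rfl (abs_nonneg _)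

/-- Clamping moves `a` towards every `c` with `|c| ≤ N`. -/
theorem abs_sub_eq_abs_clamp_sub_add {N a c : ℝ} (hc : |c| ≤ N) :
    |a - c| = |max (-N) (min a N) - c| + |a - max (-N) (min a N)| := by
  obtain ⟨h1, h2⟩ := abs_le.1 hc
  rcases le_total a N with h | h
  · rw [min_eq_left h]
    rcases le_total (-N) a with h' | h'
    · rw [max_eq_right h']; simp
    · rw [max_eq_left h', abs_of_nonpos (by linarith : a - c ≤ 0),
        abs_of_nonpos (by linarith : -N - c ≤ 0), abs_of_nonpos (by linarith : a - -N ≤ 0)]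
      ring
  · rw [min_eq_right h, max_eq_right (by linarith), abs_of_nonneg (by linarith : 0 ≤ a - c),
      abs_of_nonneg (by linarith : 0 ≤ N - c), abs_of_nonneg (by linarith : 0 ≤ a - N)]
    ring

/-- If clamping changes `a`, the clamped value is at distance at least `N - |c|` from `c`. -/
theorem le_abs_clamp_sub {N M a c : ℝ} (hN : 0 ≤ N) (hc : |c| ≤ M)
    (h : a ≠ max (-N) (min a N)) : N - M ≤ |max (-N) (min a N) - c| := by
  obtain ⟨h1, h2⟩ := abs_le.1 hc
  rcases le_total a N with h3 | h3
  · rw [min_eq_left h3] at h ⊢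
    rcases le_total (-N) a with h' | h'
    · rw [max_eq_right h'] at h; exact absurd rfl h
    · rw [max_eq_left h']
      have := neg_abs_le (-N - c)
      linarith
  · rw [min_eq_right h3, max_eq_right (by linarith)]
    have := le_abs_self (N - c)
    linarith

theorem truncOn_mem_WObs {N : ℝ} (hN : 0 ≤ N) (hΩ : MeasurableSet Ω) (hA : A ⊆ Ω)
    (hψ : ∀ᵐ x, x ∈ A → |ψ x| ≤ N) (hv : v ∈ WObs s Ω A φ ψ) :
    truncOn Ω N v ∈ WObs s Ω A φ ψ := by
  obtain ⟨h1, h2, h3⟩ := hv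
  refine ⟨?_, ?_, ?_⟩
  · have hW : (fun x => max (-N) (min (v x) N)) ∈ W s Ω := by
      refine W_of_lipschitz h1 ?_ fun x y => abs_clamp_sub_clamp_le N (v x) (v y)
      have hm := W_aemeasurable h1
      refine Integrable.mono h1.1 ((aemeasurable_const.max (hm.min
        aemeasurable_const)).aestronglyMeasurable) (Filter.Eventually.of_forall fun x => ?_)
      have := abs_clamp_sub_clamp_le N (v x) 0
      rwa [min_eq_left hN, max_eq_right (by linarith : -N ≤ 0), sub_zero, sub_zero] at this
    refine W_congr hW ?_
    filter_upwards [self_mem_ae_restrict hΩ] with x hx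
    rw [truncOn_of_mem hx]
  · filter_upwards [h2] with x hx hxΩ
    rw [truncOn_of_notMem hxΩ, hx hxΩ]
  · filter_upwards [h3, hψ] with x hx hx' hxA
    rw [truncOn_of_mem (hA hxA)]
    exact le_max_of_le_right (le_min (hx hxA) ((le_abs_self _).trans (hx' hxA)))

/-- The gain in the area density when the jump `a` over the distance `r` decreases to `b`. -/
theorem areaDensity_sub_le {a b q r : ℝ} (hr : 0 < r) (h : |a| = |b| + q) :
    (GG n s (b / r) - GG n s (a / r)) / r ^ ((n : ℝ) - 1 + s) ≤
      -(G n s (|b| / r) * q * (1 / r ^ ((n : ℝ) + s))) := by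
  have h1 := GG_tangent n s (|b| / r) (|a| / r)
  rw [← GG_abs n s (b / r), ← GG_abs n s (a / r), abs_div, abs_div, abs_of_pos hr]
  have hp : 0 < r ^ ((n : ℝ) - 1 + s) := Real.rpow_pos_of_pos hr _
  rw [show (n : ℝ) + s = ((n : ℝ) - 1 + s) + 1 by ring, Real.rpow_add_one hr.ne', div_le_iff₀ hp]
  have e : -(G n s (|b| / r) * q * (1 / (r ^ ((n : ℝ) - 1 + s) * r))) * r ^ ((n : ℝ) - 1 + s) =
      -(G n s (|b| / r) * (|a| / r - |b| / r)) := by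
    rw [h]; field_simp; ring
  rw [e]
  linarith

theorem diam_pos_of_isOpen (hn : 1 ≤ n) (hΩ : IsOpen Ω) (hb : Bornology.IsBounded Ω)
    (hne : Ω.Nonempty) : 0 < Metric.diam Ω := by
  have := nontrivial_Rn hn
  refine Metric.diam_pos ?_ hb
  by_contra h
  rw [Set.not_nontrivial_iff] at h
  have h1 := hΩ.measure_pos volume hne
  rw [h.measure_zero] at h1
  exact lt_irrefl _ h1

/-- The widths `Θ` for which the gain near `Ω` under truncation beats the loss far away. -/
theorem exists_width (n : ℕ) (hs : 0 < s) : ∃ Θ : ℝ, 4 ≤ Θ ∧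
    gMass n s * Θ ^ (-s) ≤ G n s 1 * (2 ^ (-s) - 4 ^ (-s)) := by
  have h1 : Filter.Tendsto (fun Θ : ℝ => gMass n s * Θ ^ (-s)) Filter.atTop
      (nhds (gMass n s * 0)) :=
    (tendsto_rpow_neg_atTop hs).const_mul _
  rw [mul_zero] at h1
  have h2 : 0 < G n s 1 * (2 ^ (-s) - 4 ^ (-s)) := by
    refine mul_pos (G_one_pos n s) (sub_pos.2 ?_)
    exact Real.rpow_lt_rpow_of_neg (by norm_num) (by norm_num) (by linarith)
  obtain ⟨Θ, h3, h4⟩ := ((h1.eventually_lt_const h2).and (Filter.eventually_ge_atTop 4)).exists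
  exact ⟨Θ, h4, h3.le⟩

theorem measurableSet_nbhd (Ω : Set (Rn n)) (δ : ℝ) : MeasurableSet (nbhd Ω δ) := by
  refine (isOpen_lt (f := signedDist Ω) ?_ continuous_const).measurableSet
  exact (Metric.continuous_infDist_pt Ω).sub (Metric.continuous_infDist_pt Ωᶜ)

theorem mem_nbhd_of_dist_lt {δ : ℝ} {x y : Rn n} (hx : x ∈ Ω) (hy : y ∉ Ω) (h : ‖x - y‖ < δ) :
    y ∈ nbhd Ω δ := by
  change Metric.infDist y Ω - Metric.infDist y Ωᶜ < δ
  rw [Metric.infDist_zero_of_mem (show y ∈ Ωᶜ from hy), sub_zero]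
  refine lt_of_le_of_lt (Metric.infDist_le_dist_of_mem hx) ?_
  rwa [dist_comm, dist_eq_norm]

/-- Truncation at a level `N` which is large compared with the obstacle, the exterior datum in the
neighbourhood of width `Θ diam Ω` and `diam Ω` does not increase the area. Where the truncation
changes `v(x)`, points `y ∉ Ω` of the annulus `2 diam Ω ≤ |x - y| < 4 diam Ω` contribute a gain,
and only points with `|x - y| ≥ Θ diam Ω` can contribute a loss; both are explicit. -/
theorem integral_areaDiff_truncOn_le (hn : 1 ≤ n) (hs : 0 < s) (hs1 : s < 1) {Θ : ℝ} (hΘ4 : 4 ≤ Θ)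
    (hΘ : gMass n s * Θ ^ (-s) ≤ G n s 1 * (2 ^ (-s) - 4 ^ (-s)))
    (hΩ : IsOpen Ω) (hb : Bornology.IsBounded Ω) (hne : Ω.Nonempty) (hL : HasLipschitzBoundary Ω)
    (hA : A ⊆ Ω) (hφm : AEMeasurable φ (volume.restrict Ωᶜ)) {M N : ℝ} (hM : 0 ≤ M)
    (hφ : ∀ᵐ x, x ∈ nbhd Ω (Θ * Metric.diam Ω) \ Ω → |φ x| ≤ M)
    (hN : M + 4 * Metric.diam Ω ≤ N) (hψ : ∀ᵐ x, x ∈ A → |ψ x| ≤ N)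
    (hv : v ∈ WObs s Ω A φ ψ) :
    ∫ p in Q Ω, areaDiff s (truncOn Ω N v) v p ≤ 0 := by
  set d := Metric.diam Ω with hd
  have hd0 : 0 < d := diam_pos_of_isOpen hn hΩ hb hne
  have hN0 : 0 ≤ N := by linarith
  have hΩm := hΩ.measurableSet
  set v' := truncOn Ω N v with hv'
  have hvW : v' ∈ WObs s Ω A φ ψ := truncOn_mem_WObs hN0 hΩm hA hψ hv
  have hint := integrableOn_areaDiff hn hs hs1 hΩ hb hL hφm hvW hv
  have hmeas : AEMeasurable (areaDiff s v' v) :=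
    aemeasurable_areaDiff (WObs_aemeasurable hΩm hφm hvW) (WObs_aemeasurable hΩm hφm hv)
  have hΩΩ : ∀ p ∈ Ω ×ˢ Ω, areaDiff s v' v p ≤ 0 := by
    rintro ⟨x, y⟩ ⟨hx, hy⟩
    refine div_nonpos_of_nonpos_of_nonneg ?_ (Real.rpow_nonneg (norm_nonneg _) _)
    rw [sub_nonpos]
    apply GG_mono
    rw [abs_div, abs_div]
    refine div_le_div_of_nonneg_right ?_ (abs_nonneg _)
    simp only [hv', truncOn_of_mem (v := v) (N := N) hx, truncOn_of_mem (v := v) (N := N) hy]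
    exact abs_clamp_sub_clamp_le _ _ _
  set q : Rn n → ℝ := fun x => |v x - v' x| with hq
  -- Both are proportional to `q x`. In the annulus the truncated jump is at least `N - M ≥ 4 d`,
  -- hence at least `|x - y|`, and there the slope of `𝒢_s` is at least `G_s(1)`.
  have hpt : ∀ x ∈ Ω, ∀ᵐ y, y ∈ Ωᶜ →
      ENNReal.ofReal (areaDiff s v' v (x, y)) ≤ ENNReal.ofReal (gMass n s * q x) *
        {y : Rn n | Θ * d ≤ ‖x - y‖}.indicator
          (fun y => ENNReal.ofReal (1 / ‖x - y‖ ^ ((n : ℝ) + s))) y ∧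
      ENNReal.ofReal (G n s 1 * q x) *
        {y : Rn n | 2 * d ≤ ‖x - y‖ ∧ ‖x - y‖ < 4 * d}.indicator
          (fun y => ENNReal.ofReal (1 / ‖x - y‖ ^ ((n : ℝ) + s))) y ≤
        ENNReal.ofReal (-areaDiff s v' v (x, y)) := by
    intro x hx
    filter_upwards [hφ, hv.2.1] with y hy1 hy2 hy
    have hy : y ∉ Ω := hy
    have hr : 0 < ‖x - y‖ := norm_pos_iff.2 (sub_ne_zero.2 fun h => hy (h ▸ hx))
    have hq0 : 0 ≤ q x := abs_nonneg _
    have hx' : v' x = max (-N) (min (v x) N) := truncOn_of_mem hx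
    have hy' : v' y = v y := truncOn_of_notMem hy
    by_cases hyn : y ∈ nbhd Ω (Θ * d)
    · have hφy : |v y| ≤ M := by rw [hy2 hy]; exact hy1 ⟨hyn, hy⟩
      have habs : |v x - v y| = |v' x - v y| + q x := by
        simp only [hq, hx']
        exact abs_sub_eq_abs_clamp_sub_add (by linarith)
      have hle := areaDensity_sub_le (n := n) (s := s) hr habs
      have hle' : areaDiff s v' v (x, y) ≤
          -(G n s (|v' x - v y| / ‖x - y‖) * q x * (1 / ‖x - y‖ ^ ((n : ℝ) + s))) := by
        unfold areaDiff
        simp only [hy']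
        exact hle
      have hG0 : 0 ≤ G n s (|v' x - v y| / ‖x - y‖) := by
        simpa using (strictMono_G n s).monotone (show 0 ≤ |v' x - v y| / ‖x - y‖ by positivity)
      have hnonpos : areaDiff s v' v (x, y) ≤ 0 := by
        refine hle'.trans ?_
        rw [neg_nonpos]
        positivity
      refine ⟨by rw [ENNReal.ofReal_of_nonpos hnonpos]; exact zero_le, ?_⟩
      by_cases hann : y ∈ {y : Rn n | 2 * d ≤ ‖x - y‖ ∧ ‖x - y‖ < 4 * d}
      · rw [Set.indicator_of_mem hann, ← ENNReal.ofReal_mul (mul_nonneg (G_one_pos n s).le hq0)]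
        apply ENNReal.ofReal_le_ofReal
        refine le_trans ?_ (le_neg_of_le_neg hle')
        by_cases hqx : v x = v' x
        · have : q x = 0 := by simp [hq, hqx]
          simp [this]
        · gcongr
          refine (strictMono_G n s).monotone ?_
          rw [le_div_iff₀ hr, one_mul]
          rw [hx'] at hqx ⊢
          have := le_abs_clamp_sub hN0 hφy hqx
          linarith [hann.2]
      · simp [hann]
    · have hfar : Θ * d ≤ ‖x - y‖ := by
        by_contra h
        exact hyn (mem_nbhd_of_dist_lt hx hy (not_le.1 h))
      constructor
      · rw [Set.indicator_of_mem (show y ∈ {y : Rn n | Θ * d ≤ ‖x - y‖} from hfar),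
          ← ENNReal.ofReal_mul (mul_nonneg (gMass_nonneg n s) hq0)]
        apply ENNReal.ofReal_le_ofReal
        refine (le_abs_self _).trans ((abs_areaDiff_le hn hs v' v (x, y)).trans (le_of_eq ?_))
        simp only [hy', sub_self, sub_zero, hq]
        rw [abs_sub_comm]
        ring
      · have : y ∉ {y : Rn n | 2 * d ≤ ‖x - y‖ ∧ ‖x - y‖ < 4 * d} := by
          rintro ⟨_, h⟩
          have : 4 * d ≤ Θ * d := by gcongr
          linarith
        simp [this]
  have hx : ∀ x ∈ Ω, ∫⁻ y in Ωᶜ, ENNReal.ofReal (areaDiff s v' v (x, y)) ≤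
      ∫⁻ y in Ωᶜ, ENNReal.ofReal (-areaDiff s v' v (x, y)) := by
    intro x hx
    have hΘd : 0 < Θ * d := by positivity
    have hq0 : 0 ≤ q x := abs_nonneg _
    have hfarm : MeasurableSet {y : Rn n | Θ * d ≤ ‖x - y‖} :=
      measurableSet_le measurable_const (by fun_prop)
    have hannm : MeasurableSet {y : Rn n | 2 * d ≤ ‖x - y‖ ∧ ‖x - y‖ < 4 * d} :=
      (measurableSet_le (f := fun _ => 2 * d) (g := fun y : Rn n => ‖x - y‖)
        measurable_const (by fun_prop)).inter
        (measurableSet_lt (f := fun y : Rn n => ‖x - y‖) (g := fun _ => 4 * d)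
          (by fun_prop) measurable_const)
    have hsub : {y : Rn n | 2 * d ≤ ‖x - y‖ ∧ ‖x - y‖ < 4 * d} ⊆ Ωᶜ := by
      intro y hy hyΩ
      have := Metric.dist_le_diam_of_mem hb hx hyΩ
      rw [dist_eq_norm] at this
      linarith [hy.1]
    have hc := farConst_pos hn hs
    have key : gMass n s * (farConst n s * (Θ * d) ^ (-s)) ≤
        G n s 1 * (farConst n s * (2 * d) ^ (-s) - farConst n s * (4 * d) ^ (-s)) := by
      rw [Real.mul_rpow (by linarith) hd0.le, Real.mul_rpow (by norm_num) hd0.le,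
        Real.mul_rpow (by norm_num) hd0.le]
      have := mul_le_mul_of_nonneg_left hΘ
        (mul_nonneg hc.le (Real.rpow_nonneg hd0.le (-s)))
      linarith
    calc ∫⁻ y in Ωᶜ, ENNReal.ofReal (areaDiff s v' v (x, y))
        ≤ ∫⁻ y in Ωᶜ, ENNReal.ofReal (gMass n s * q x) * {y : Rn n | Θ * d ≤ ‖x - y‖}.indicator
            (fun y => ENNReal.ofReal (1 / ‖x - y‖ ^ ((n : ℝ) + s))) y :=
          lintegral_mono_ae ((ae_restrict_iff' hΩm.compl).2
            ((hpt x hx).mono fun y h hy => (h hy).1))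
      _ ≤ ∫⁻ y, ENNReal.ofReal (gMass n s * q x) * {y : Rn n | Θ * d ≤ ‖x - y‖}.indicator
            (fun y => ENNReal.ofReal (1 / ‖x - y‖ ^ ((n : ℝ) + s))) y :=
          setLIntegral_le_lintegral _ _
      _ = ENNReal.ofReal (gMass n s * q x) * ENNReal.ofReal (farConst n s * (Θ * d) ^ (-s)) := by
          rw [lintegral_const_mul' _ _ ENNReal.ofReal_ne_top, lintegral_indicator hfarm,
            lintegral_far_sub hn hs hΘd]
      _ ≤ ENNReal.ofReal (G n s 1 * q x) *
            ENNReal.ofReal (farConst n s * (2 * d) ^ (-s) - farConst n s * (4 * d) ^ (-s)) := by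
          rw [← ENNReal.ofReal_mul (mul_nonneg (gMass_nonneg n s) hq0),
            ← ENNReal.ofReal_mul (mul_nonneg (G_one_pos n s).le hq0)]
          apply ENNReal.ofReal_le_ofReal
          have := mul_le_mul_of_nonneg_right key hq0
          linarith
      _ = ENNReal.ofReal (G n s 1 * q x) *
            ∫⁻ y in {y : Rn n | 2 * d ≤ ‖x - y‖ ∧ ‖x - y‖ < 4 * d},
              ENNReal.ofReal (1 / ‖x - y‖ ^ ((n : ℝ) + s)) := by
          congr 1
          have := lintegral_annulus_add_far hn hs (a := 2 * d) (b := 4 * d) (by positivity)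
            (by linarith) x
          rw [ENNReal.ofReal_sub _ (by positivity), ← this,
            ENNReal.add_sub_cancel_right ENNReal.ofReal_ne_top]
      _ = ∫⁻ y in Ωᶜ, ENNReal.ofReal (G n s 1 * q x) *
            {y : Rn n | 2 * d ≤ ‖x - y‖ ∧ ‖x - y‖ < 4 * d}.indicator
              (fun y => ENNReal.ofReal (1 / ‖x - y‖ ^ ((n : ℝ) + s))) y := by
          rw [lintegral_const_mul' _ _ ENNReal.ofReal_ne_top, setLIntegral_indicator hannm,
            Set.inter_eq_left.2 hsub]
      _ ≤ ∫⁻ y in Ωᶜ, ENNReal.ofReal (-areaDiff s v' v (x, y)) :=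
          lintegral_mono_ae ((ae_restrict_iff' hΩm.compl).2
            ((hpt x hx).mono fun y h hy => (h hy).2))
  have hcross : ∫⁻ p in Ω ×ˢ Ωᶜ, ENNReal.ofReal (areaDiff s v' v p) ≤
      ∫⁻ p in Ω ×ˢ Ωᶜ, ENNReal.ofReal (-areaDiff s v' v p) := by
    have m1 : AEMeasurable (fun p => ENNReal.ofReal (areaDiff s v' v p))
        (volume.restrict (Ω ×ˢ Ωᶜ)) := (ENNReal.measurable_ofReal.comp_aemeasurable hmeas).restrict
    have m2 : AEMeasurable (fun p => ENNReal.ofReal (-areaDiff s v' v p))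
        (volume.restrict (Ω ×ˢ Ωᶜ)) :=
      (ENNReal.measurable_ofReal.comp_aemeasurable hmeas.neg).restrict
    rw [Measure.volume_eq_prod, ← Measure.prod_restrict] at m1 m2 ⊢
    rw [lintegral_prod _ m1, lintegral_prod _ m2]
    exact setLIntegral_mono' hΩm hx
  rw [integral_eq_lintegral_pos_part_sub_lintegral_neg_part hint, sub_nonpos]
  have hsymm := areaDiff_swap s v' v
  refine ENNReal.toReal_mono hint.neg.lintegral_lt_top.ne ?_
  have hR : ∫⁻ p in Q Ω, ENNReal.ofReal (areaDiff s v' v p) ≤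
      ∫⁻ p in Q Ω, ENNReal.ofReal (-areaDiff s v' v p) := by
    rw [lintegral_Q_of_symm hΩm (fun p => by rw [hsymm]),
      lintegral_Q_of_symm hΩm (F := fun p => ENNReal.ofReal (-areaDiff s v' v p))
        (fun p => by rw [hsymm])]
    refine add_le_add ?_ (mul_le_mul' le_rfl hcross)
    refine setLIntegral_mono' (hΩm.prod hΩm) fun p hp => ?_
    rw [ENNReal.ofReal_of_nonpos (hΩΩ p hp)]
    exact zero_le
  exact hR

end NonlocalObstacle

/-! ### Existence of a minimizer -/

namespace NonlocalObstacle

/-- From a decreasing sequence of nonempty, bounded, midpoint convex sets in a Hilbert space one can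
select a Cauchy sequence: take points of almost minimal norm and use the parallelogram law. -/
theorem exists_cauchySeq_of_midpoint {H : Type*} [NormedAddCommGroup H] [InnerProductSpace ℝ H]
    {S : ℕ → Set H} (hanti : Antitone S) (hne : ∀ k, (S k).Nonempty) {R : ℝ}
    (hbd : ∀ x ∈ S 0, ‖x‖ ≤ R)
    (hmid : ∀ k, ∀ x ∈ S k, ∀ y ∈ S k, (1 / 2 : ℝ) • (x + y) ∈ S k) :
    ∃ v : ℕ → H, (∀ k, v k ∈ S k) ∧ CauchySeq v := by
  set r : ℕ → ℝ := fun k => sInf ((fun x => ‖x‖ ^ 2) '' S k) with hr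
  have hbelow : ∀ k, BddBelow ((fun x : H => ‖x‖ ^ 2) '' S k) := fun k =>
    ⟨0, by rintro _ ⟨x, _, rfl⟩; positivity⟩
  have hle : ∀ k, ∀ x ∈ S k, r k ≤ ‖x‖ ^ 2 := fun k x hx => csInf_le (hbelow k) ⟨x, hx, rfl⟩
  have hmono : Monotone r := fun k l hkl =>
    csInf_le_csInf (hbelow k) ((hne l).image _) (Set.image_mono (hanti hkl))
  have hR : ∀ k, r k ≤ R ^ 2 := by
    intro k
    obtain ⟨x, hx⟩ := hne k
    have h1 := hbd x (hanti (Nat.zero_le k) hx)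
    exact (hle k x hx).trans (by gcongr)
  have hex : ∀ k : ℕ, ∃ x ∈ S k, ‖x‖ ^ 2 < r k + 1 / ((k : ℝ) + 1) := by
    intro k
    have : r k < r k + 1 / ((k : ℝ) + 1) := by
      have : (0 : ℝ) < 1 / ((k : ℝ) + 1) := by positivity
      linarith
    obtain ⟨_, ⟨x, hx, rfl⟩, h⟩ := exists_lt_of_csInf_lt ((hne k).image _) this
    exact ⟨x, hx, h⟩
  choose v hvS hv using hex
  refine ⟨v, hvS, ?_⟩
  have hbdd : BddAbove (Set.range r) := ⟨R ^ 2, by rintro _ ⟨k, rfl⟩; exact hR k⟩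
  set ρ := ⨆ k, r k with hρ
  have hlim : Filter.Tendsto r Filter.atTop (nhds ρ) := tendsto_atTop_ciSup hmono hbdd
  set b : ℕ → ℝ := fun k => 2 * (ρ - r k) + 4 * (1 / ((k : ℝ) + 1)) with hb
  have hb0 : Filter.Tendsto b Filter.atTop (nhds 0) := by
    have h1 := ((tendsto_const_nhds (x := ρ)).sub hlim).const_mul 2
    have h2 := (tendsto_one_div_add_atTop_nhds_zero_nat (𝕜 := ℝ)).const_mul 4
    have h3 := h1.add h2
    rwa [sub_self, mul_zero, mul_zero, add_zero] at h3
  have hinv : ∀ {k l : ℕ}, k ≤ l → 1 / ((l : ℝ) + 1) ≤ 1 / ((k : ℝ) + 1) := by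
    intro k l hkl
    have : (k : ℝ) ≤ l := by exact_mod_cast hkl
    apply one_div_le_one_div_of_le (by positivity)
    linarith
  have key : ∀ k l, k ≤ l → ‖v k - v l‖ ^ 2 ≤ b k := by
    intro k l hkl
    have h1 := hle k _ (hmid k _ (hvS k) _ (hanti hkl (hvS l)))
    rw [norm_smul, mul_pow] at h1
    norm_num at h1
    have h2 := parallelogram_law_with_norm ℝ (v k) (v l)
    have h3 := hv k
    have h4 := hv l
    have h5 : r l ≤ ρ := le_ciSup hbdd l
    have h6 := hinv hkl
    simp only [hb]
    nlinarith
  refine cauchySeq_of_le_tendsto_0 (fun k => Real.sqrt (b k)) (fun k l N hk hl => ?_) ?_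
  · have hbN : ∀ k, N ≤ k → b k ≤ b N := by
      intro k hk
      have h1 := hmono hk
      have h2 := hinv hk
      simp only [hb]
      linarith
    rw [dist_eq_norm]
    apply Real.le_sqrt_of_sq_le
    rcases le_total k l with h | h
    · exact (key k l h).trans (hbN k hk)
    · rw [norm_sub_rev]
      exact (key l k h).trans (hbN l hl)
  · have := (Real.continuous_sqrt.tendsto 0).comp hb0
    rwa [Real.sqrt_zero] at this

variable {n : ℕ} {s : ℝ} {Ω A : Set (Rn n)} {φ ψ u v : Rn n → ℝ}

/-- A function has finite Gagliardo seminorm on a bounded set if its fractional area is finite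
there, since `𝒢_s` grows linearly. -/
theorem gagliardo_lt_top_of_area (hn : 1 ≤ n) (hs1 : s < 1) (hΩ : MeasurableSet Ω)
    (hb : Bornology.IsBounded Ω) (hu : AEMeasurable u (volume.restrict Ω))
    (h : ∫⁻ p in Ω ×ˢ Ω, ENNReal.ofReal (GG n s ((u p.1 - u p.2) / ‖p.1 - p.2‖) /
      ‖p.1 - p.2‖ ^ ((n : ℝ) - 1 + s)) < ⊤) : gagliardo s Ω u < ⊤ := by
  have hG := G_one_pos n s
  rw [gagliardo_eq_lintegral_prod hu]
  have hpt : ∀ p : Rn n × Rn n, p.1 ≠ p.2 → gagDensity s u p ≤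
      ENNReal.ofReal (1 / G n s 1) * ENNReal.ofReal (GG n s ((u p.1 - u p.2) / ‖p.1 - p.2‖) /
        ‖p.1 - p.2‖ ^ ((n : ℝ) - 1 + s)) +
      ENNReal.ofReal (1 / ‖p.1 - p.2‖ ^ ((n : ℝ) - 1 + s)) := by
    intro p hp
    have hr : 0 < ‖p.1 - p.2‖ := norm_pos_iff.2 (sub_ne_zero.2 hp)
    have hrp : 0 < ‖p.1 - p.2‖ ^ ((n : ℝ) - 1 + s) := Real.rpow_pos_of_pos hr _
    have h1 := GG_lower n s ((u p.1 - u p.2) / ‖p.1 - p.2‖)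
    have h0 := GG_nonneg n s ((u p.1 - u p.2) / ‖p.1 - p.2‖)
    rw [abs_div, abs_of_pos hr] at h1
    rw [← ENNReal.ofReal_mul (by positivity), ← ENNReal.ofReal_add (by positivity) (by positivity)]
    apply ENNReal.ofReal_le_ofReal
    rw [show (n : ℝ) + s = ((n : ℝ) - 1 + s) + 1 by ring, Real.rpow_add_one hr.ne']
    have h2 : |u p.1 - u p.2| / ‖p.1 - p.2‖ ≤
        1 / G n s 1 * GG n s ((u p.1 - u p.2) / ‖p.1 - p.2‖) + 1 := by
      have h3 : |u p.1 - u p.2| / ‖p.1 - p.2‖ - 1 ≤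
          GG n s ((u p.1 - u p.2) / ‖p.1 - p.2‖) / G n s 1 := by
        rw [le_div_iff₀ hG]; linarith
      rw [one_div_mul_eq_div]
      linarith
    have h4 := div_le_div_of_nonneg_right h2 hrp.le
    calc |u p.1 - u p.2| / (‖p.1 - p.2‖ ^ ((n : ℝ) - 1 + s) * ‖p.1 - p.2‖)
        = |u p.1 - u p.2| / ‖p.1 - p.2‖ / ‖p.1 - p.2‖ ^ ((n : ℝ) - 1 + s) := by
          rw [div_div, mul_comm]
      _ ≤ _ := h4
      _ = _ := by ring
  refine lt_of_le_of_lt (lintegral_mono_ae (ae_restrict_of_ae ((ae_ne_diagonal hn).mono hpt))) ?_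
  rw [lintegral_add_right' _ (Measurable.aemeasurable (by fun_prop)),
    lintegral_const_mul' _ _ ENNReal.ofReal_ne_top]
  refine ENNReal.add_lt_top.2 ⟨ENNReal.mul_lt_top ENNReal.ofReal_lt_top h, ?_⟩
  rw [Measure.volume_eq_prod, ← Measure.prod_restrict, lintegral_prod _
    (Measurable.aemeasurable (by fun_prop))]
  exact lintegral_lintegral_bounded_lt_top hn hs1 hΩ hb

theorem areaDiff_congr_ae {u' v' : Rn n → ℝ} (hu : u =ᵐ[volume] u') (hv : v =ᵐ[volume] v') :
    areaDiff s u v =ᵐ[volume] areaDiff s u' v' := by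
  have f1 := Measure.quasiMeasurePreserving_fst (μ := (volume : Measure (Rn n)))
    (ν := (volume : Measure (Rn n)))
  have f2 := Measure.quasiMeasurePreserving_snd (μ := (volume : Measure (Rn n)))
    (ν := (volume : Measure (Rn n)))
  rw [Measure.volume_eq_prod]
  filter_upwards [f1.ae hu, f2.ae hu, f1.ae hv, f2.ae hv] with p h1 h2 h3 h4
  unfold areaDiff
  rw [h1, h2, h3, h4]

theorem WObs_congr (hu : u ∈ WObs s Ω A φ ψ) (h : u =ᵐ[volume] v) :
    v ∈ WObs s Ω A φ ψ := by
  obtain ⟨h1, h2, h3⟩ := hu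
  refine ⟨W_congr h1 (ae_restrict_of_ae h), ?_, ?_⟩
  · filter_upwards [h2, h] with x hx hx' hxΩ
    rw [← hx', hx hxΩ]
  · filter_upwards [h3, h] with x hx hx' hxA
    rw [← hx']; exact hx hxA

/-- The function equal to `f` in `Ω` and to `φ` outside. -/
noncomputable def glue (Ω : Set (Rn n)) (φ f : Rn n → ℝ) (x : Rn n) : ℝ :=
  open Classical in if x ∈ Ω then f x else φ x

theorem glue_of_mem {f : Rn n → ℝ} {x : Rn n} (hx : x ∈ Ω) : glue Ω φ f x = f x := by
  simp [glue, hx]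

theorem glue_of_notMem {f : Rn n → ℝ} {x : Rn n} (hx : x ∉ Ω) : glue Ω φ f x = φ x := by
  simp [glue, hx]

theorem glue_ae_eq (hΩ : MeasurableSet Ω) {f : Rn n → ℝ} :
    glue Ω φ f =ᵐ[volume.restrict Ω] f := by
  filter_upwards [self_mem_ae_restrict hΩ] with x hx
  exact glue_of_mem hx

theorem const_mem_W (hb : Bornology.IsBounded Ω) (c : ℝ) : (fun _ : Rn n => c) ∈ W s Ω := by
  refine ⟨integrableOn_const hb.measure_lt_top.ne, ?_⟩
  simp [gagliardo]

/-- The admissible functions bounded by `N` in `Ω`. -/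
def WObsBdd (s : ℝ) (Ω A : Set (Rn n)) (φ ψ : Rn n → ℝ) (N : ℝ) : Set (Rn n → ℝ) :=
  {v | v ∈ WObs s Ω A φ ψ ∧ ∀ᵐ x, x ∈ Ω → |v x| ≤ N}

theorem glue_const_mem (hΩ : MeasurableSet Ω) (hb : Bornology.IsBounded Ω) (hA : A ⊆ Ω) {N : ℝ}
    (hN : 0 ≤ N) (hψ : ∀ᵐ x, x ∈ A → |ψ x| ≤ N) :
    glue Ω φ (fun _ => N) ∈ WObsBdd s Ω A φ ψ N := by
  refine ⟨⟨W_congr (const_mem_W hb N) (glue_ae_eq hΩ).symm, ?_, ?_⟩, ?_⟩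
  · exact Filter.Eventually.of_forall fun x hx => glue_of_notMem hx
  · filter_upwards [hψ] with x hx hxA
    rw [glue_of_mem (hA hxA)]
    exact (le_abs_self _).trans (hx hxA)
  · refine Filter.Eventually.of_forall fun x hx => ?_
    rw [glue_of_mem hx, abs_of_nonneg hN]

/-- An integrable lower bound for the area differences between bounded admissible functions and the
admissible function equal to `N` in `Ω`. -/
noncomputable def lowerBound (s : ℝ) (Ω : Set (Rn n)) (N : ℝ) (p : Rn n × Rn n) : ℝ :=
  gMass n s * (|Ω.indicator (fun _ => 2 * N) p.1 - Ω.indicator (fun _ => 2 * N) p.2| /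
    ‖p.1 - p.2‖ ^ ((n : ℝ) + s))

theorem lowerBound_nonneg (N : ℝ) (p : Rn n × Rn n) : 0 ≤ lowerBound s Ω N p :=
  mul_nonneg (gMass_nonneg n s) (by positivity)

theorem measurable_lowerBound (hΩ : MeasurableSet Ω) (N : ℝ) :
    Measurable (lowerBound s Ω N) := by
  have h : Measurable (Ω.indicator fun _ : Rn n => 2 * N) := measurable_const.indicator hΩ
  unfold lowerBound
  fun_prop

theorem integrableOn_lowerBound (hn : 1 ≤ n) (hs : 0 < s) (hs1 : s < 1) (hΩ : IsOpen Ω)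
    (hb : Bornology.IsBounded Ω) (hL : HasLipschitzBoundary Ω) (N : ℝ) :
    IntegrableOn (lowerBound s Ω N) (Q Ω) := by
  have hm : Measurable (Ω.indicator fun _ : Rn n => 2 * N) :=
    measurable_const.indicator hΩ.measurableSet
  have hW : (Ω.indicator fun _ : Rn n => 2 * N) ∈ W s Ω := by
    refine W_congr (const_mem_W hb (2 * N)) ?_
    filter_upwards [self_mem_ae_restrict hΩ.measurableSet] with x hx
    rw [Set.indicator_of_mem hx]
  refine ⟨(measurable_lowerBound hΩ.measurableSet N).aestronglyMeasurable, ?_⟩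
  have := lintegral_Q_gagDensity_lt_top hn hs hs1 hΩ hb hL hW hm.aemeasurable
    (Filter.Eventually.of_forall fun x hx => Set.indicator_of_notMem hx _)
  rw [HasFiniteIntegral]
  calc ∫⁻ p in Q Ω, ‖lowerBound s Ω N p‖ₑ
      = ∫⁻ p in Q Ω, ENNReal.ofReal (gMass n s) *
          gagDensity s (Ω.indicator fun _ : Rn n => 2 * N) p := by
        refine lintegral_congr fun p => ?_
        rw [← ofReal_norm, Real.norm_of_nonneg (lowerBound_nonneg N p), lowerBound,
          ENNReal.ofReal_mul (gMass_nonneg n s), gagDensity]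
    _ < ⊤ := by
        rw [lintegral_const_mul' _ _ ENNReal.ofReal_ne_top]
        exact ENNReal.mul_lt_top ENNReal.ofReal_lt_top this

theorem neg_lowerBound_le (hn : 1 ≤ n) (hs : 0 < s) {N : ℝ} (hN : 0 ≤ N)
    (hv : v ∈ WObsBdd s Ω A φ ψ N) :
    ∀ᵐ p, p ∈ Q Ω → 0 ≤ areaDiff s v (glue Ω φ fun _ => N) p + lowerBound s Ω N p := by
  have f1 := Measure.quasiMeasurePreserving_fst (μ := (volume : Measure (Rn n)))
    (ν := (volume : Measure (Rn n)))
  have f2 := Measure.quasiMeasurePreserving_snd (μ := (volume : Measure (Rn n)))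
    (ν := (volume : Measure (Rn n)))
  rw [Measure.volume_eq_prod]
  filter_upwards [f1.ae hv.1.2.1, f2.ae hv.1.2.1, f1.ae hv.2, f2.ae hv.2] with p h1 h2 h3 h4 hp
  have hb : ∀ x ∈ Ω, |v x| ≤ N → |v x - N| ≤ 2 * N := by
    intro x _ h
    rw [abs_le] at h ⊢
    constructor <;> linarith [h.1, h.2]
  have habs := abs_areaDiff_le hn hs v (glue Ω φ fun _ => N) p
  have hlow : |(v p.1 - glue Ω φ (fun _ => N) p.1) - (v p.2 - glue Ω φ (fun _ => N) p.2)| ≤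
      |Ω.indicator (fun _ => 2 * N) p.1 - Ω.indicator (fun _ => 2 * N) p.2| →
      0 ≤ areaDiff s v (glue Ω φ fun _ => N) p + lowerBound s Ω N p := by
    intro h
    have h5 : gMass n s * (|(v p.1 - glue Ω φ (fun _ => N) p.1) -
        (v p.2 - glue Ω φ (fun _ => N) p.2)| / ‖p.1 - p.2‖ ^ ((n : ℝ) + s)) ≤
        lowerBound s Ω N p := by
      unfold lowerBound
      exact mul_le_mul_of_nonneg_left (div_le_div_of_nonneg_right h (by positivity))
        (gMass_nonneg n s)
    have := neg_abs_le (areaDiff s v (glue Ω φ fun _ => N) p)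
    linarith
  by_cases hx : p.1 ∈ Ω
  · by_cases hy : p.2 ∈ Ω
    · refine add_nonneg ?_ (lowerBound_nonneg N p)
      unfold areaDiff
      rw [glue_of_mem hx, glue_of_mem hy]
      simp only [sub_self, zero_div, GG_zero, sub_zero]
      exact div_nonneg (GG_nonneg _ _ _) (by positivity)
    · apply hlow
      rw [glue_of_mem hx, glue_of_notMem hy, h2 hy, Set.indicator_of_mem hx,
        Set.indicator_of_notMem hy, sub_self, sub_zero, sub_zero,
        abs_of_nonneg (by linarith : 0 ≤ 2 * N)]
      exact hb _ hx (h3 hx)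
  · by_cases hy : p.2 ∈ Ω
    · apply hlow
      rw [glue_of_mem hy, glue_of_notMem hx, h1 hx, Set.indicator_of_mem hy,
        Set.indicator_of_notMem hx, sub_self, zero_sub, zero_sub, abs_neg, abs_neg,
        abs_of_nonneg (by linarith : 0 ≤ 2 * N)]
      exact hb _ hy (h4 hy)
    · exact absurd ⟨hx, hy⟩ hp

theorem WObsBdd_congr {N : ℝ} (hu : u ∈ WObsBdd s Ω A φ ψ N) (h : u =ᵐ[volume] v) :
    v ∈ WObsBdd s Ω A φ ψ N := by
  refine ⟨WObs_congr hu.1 h, ?_⟩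
  filter_upwards [hu.2, h] with x hx hx' hxΩ
  rw [← hx']; exact hx hxΩ

theorem WObsBdd_midpoint {N : ℝ} (hu : u ∈ WObsBdd s Ω A φ ψ N) (hv : v ∈ WObsBdd s Ω A φ ψ N) :
    (fun x => (u x + v x) / 2) ∈ WObsBdd s Ω A φ ψ N := by
  refine ⟨WObs_midpoint hu.1 hv.1, ?_⟩
  filter_upwards [hu.2, hv.2] with x h1 h2 hx
  have h1 := abs_le.1 (h1 hx)
  have h2 := abs_le.1 (h2 hx)
  rw [abs_le]
  constructor <;> linarith [h1.1, h1.2, h2.1, h2.2]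

/-- The area, relative to a fixed admissible function, is lower semicontinuous under almost
everywhere convergence of bounded admissible functions; the limit is admissible. -/
theorem area_lowerSemicontinuous (hn : 1 ≤ n) (hs : 0 < s) (hs1 : s < 1) (hΩ : IsOpen Ω)
    (hb : Bornology.IsBounded Ω) (hL : HasLipschitzBoundary Ω) (hA : A ⊆ Ω)
    (hφ : AEMeasurable φ (volume.restrict Ωᶜ)) {N : ℝ} (hN : 0 ≤ N)
    (hψ : ∀ᵐ x, x ∈ A → |ψ x| ≤ N) {f : ℕ → Rn n → ℝ}
    (hf : ∀ k, f k ∈ WObsBdd s Ω A φ ψ N) (hum : AEMeasurable u)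
    (hlim : ∀ᵐ x, Filter.Tendsto (fun k => f k x) Filter.atTop (nhds (u x))) {m : ℝ}
    {b : ℕ → ℝ} (hbm : Filter.Tendsto b Filter.atTop (nhds m))
    (hJ : ∀ k, ∫ p in Q Ω, areaDiff s (f k) (glue Ω φ fun _ => N) p ≤ b k) :
    u ∈ WObsBdd s Ω A φ ψ N ∧ ∫ p in Q Ω, areaDiff s u (glue Ω φ fun _ => N) p ≤ m := by
  have hΩm := hΩ.measurableSet
  set v₀ := glue Ω φ fun _ => N with hv₀
  have hv₀m : v₀ ∈ WObsBdd s Ω A φ ψ N := glue_const_mem hΩm hb hA hN hψ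
  set D := lowerBound s Ω N with hD
  have hDi : IntegrableOn D (Q Ω) := integrableOn_lowerBound hn hs hs1 hΩ hb hL N
  have hQ := measurableSet_Q hΩm
  have hallf : ∀ᵐ x, ∀ k, (x ∈ Ω → |f k x| ≤ N) ∧ (x ∉ Ω → f k x = φ x) ∧
      (x ∈ A → ψ x ≤ f k x) := by
    rw [ae_all_iff]
    intro k
    filter_upwards [(hf k).2, (hf k).1.2.1, (hf k).1.2.2] with x h1 h2 h3
    exact ⟨h1, h2, h3⟩
  have hubd : ∀ᵐ x, x ∈ Ω → |u x| ≤ N := by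
    filter_upwards [hallf, hlim] with x h1 h2 hx
    exact le_of_tendsto h2.abs (Filter.Eventually.of_forall fun k => (h1 k).1 hx)
  have huφ : ∀ᵐ x, x ∉ Ω → u x = φ x := by
    filter_upwards [hallf, hlim] with x h1 h2 hx
    refine tendsto_nhds_unique h2 ?_
    simp_rw [fun k => (h1 k).2.1 hx]
    exact tendsto_const_nhds
  have huψ : ∀ᵐ x, x ∈ A → ψ x ≤ u x := by
    filter_upwards [hallf, hlim] with x h1 h2 hx
    exact ge_of_tendsto h2 (Filter.Eventually.of_forall fun k => (h1 k).2.2 hx)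
  -- Fatou's lemma is applied to the densities made nonnegative by the lower bound `D`.
  set F : (Rn n → ℝ) → Rn n × Rn n → ENNReal := fun v p =>
    ENNReal.ofReal (areaDiff s v v₀ p + D p) with hF
  have hFv : ∀ v ∈ WObsBdd s Ω A φ ψ N, ∫⁻ p in Q Ω, F v p =
      ENNReal.ofReal ((∫ p in Q Ω, areaDiff s v v₀ p) + ∫ p in Q Ω, D p) := by
    intro v hv
    have hi := integrableOn_areaDiff hn hs hs1 hΩ hb hL hφ hv.1 hv₀m.1
    rw [← integral_add hi hDi, ofReal_integral_eq_lintegral_ofReal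
      (f := fun p => areaDiff s v v₀ p + D p) (hi.add hDi)]
    exact (ae_restrict_iff' hQ).2 (neg_lowerBound_le hn hs hN hv)
  have hv₀meas : AEMeasurable v₀ := WObs_aemeasurable hΩm hφ hv₀m.1
  have hFm : ∀ v, AEMeasurable v → AEMeasurable (F v) := fun v hv =>
    ENNReal.measurable_ofReal.comp_aemeasurable ((aemeasurable_areaDiff hv hv₀meas).add
      (measurable_lowerBound hΩm N).aemeasurable)
  have hFlim : ∀ᵐ p, Filter.Tendsto (fun k => F (f k) p) Filter.atTop (nhds (F u p)) := by
    have f1 := Measure.quasiMeasurePreserving_fst (μ := (volume : Measure (Rn n)))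
      (ν := (volume : Measure (Rn n)))
    have f2 := Measure.quasiMeasurePreserving_snd (μ := (volume : Measure (Rn n)))
      (ν := (volume : Measure (Rn n)))
    rw [Measure.volume_eq_prod]
    filter_upwards [f1.ae hlim, f2.ae hlim] with p h1 h2
    refine (ENNReal.continuous_ofReal.tendsto _).comp (Filter.Tendsto.add_const _ ?_)
    unfold areaDiff
    exact ((((continuous_GG n s).tendsto _).comp ((h1.sub h2).div_const _)).sub_const _).div_const _
  have hFu : ∫⁻ p in Q Ω, F u p ≤ ENNReal.ofReal (m + ∫ p in Q Ω, D p) := by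
    calc ∫⁻ p in Q Ω, F u p = ∫⁻ p in Q Ω, Filter.liminf (fun k => F (f k) p) Filter.atTop := by
          refine lintegral_congr_ae (ae_restrict_of_ae ?_)
          filter_upwards [hFlim] with p hp
          exact hp.liminf_eq.symm
      _ ≤ Filter.liminf (fun k => ∫⁻ p in Q Ω, F (f k) p) Filter.atTop :=
          lintegral_liminf_le' fun k => (hFm _ (WObs_aemeasurable hΩm hφ (hf k).1)).restrict
      _ ≤ Filter.liminf (fun k => ENNReal.ofReal (b k + ∫ p in Q Ω, D p)) Filter.atTop := by
          refine Filter.liminf_le_liminf (Filter.Eventually.of_forall fun k => ?_)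
          rw [hFv _ (hf k)]
          exact ENNReal.ofReal_le_ofReal (by linarith [hJ k])
      _ = ENNReal.ofReal (m + ∫ p in Q Ω, D p) :=
          ((ENNReal.continuous_ofReal.tendsto _).comp (hbm.add_const _)).liminf_eq
  have huint : IntegrableOn u Ω := by
    refine Measure.integrableOn_of_bounded (M := N) hb.measure_lt_top.ne hum.aestronglyMeasurable ?_
    exact (ae_restrict_iff' hΩm).2 hubd
  have hugag : gagliardo s Ω u < ⊤ := by
    refine gagliardo_lt_top_of_area hn hs1 hΩm hb hum.restrict ?_
    calc ∫⁻ p in Ω ×ˢ Ω, ENNReal.ofReal (GG n s ((u p.1 - u p.2) / ‖p.1 - p.2‖) /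
          ‖p.1 - p.2‖ ^ ((n : ℝ) - 1 + s))
        ≤ ∫⁻ p in Ω ×ˢ Ω, F u p := by
          refine setLIntegral_mono' (hΩm.prod hΩm) fun p hp => ENNReal.ofReal_le_ofReal ?_
          refine le_add_of_le_of_nonneg (le_of_eq ?_) (lowerBound_nonneg N p)
          unfold areaDiff
          rw [hv₀, glue_of_mem hp.1, glue_of_mem hp.2]
          simp
      _ ≤ ∫⁻ p in Q Ω, F u p := lintegral_mono_set fun p hp h => h.1 hp.1
      _ < ⊤ := hFu.trans_lt ENNReal.ofReal_lt_top
  have huW : u ∈ WObsBdd s Ω A φ ψ N := ⟨⟨⟨huint, hugag⟩, huφ, huψ⟩, hubd⟩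
  refine ⟨huW, ?_⟩
  have hnn : ∀ v ∈ WObsBdd s Ω A φ ψ N,
      0 ≤ (∫ p in Q Ω, areaDiff s v v₀ p) + ∫ p in Q Ω, D p := by
    intro v hv
    rw [← integral_add (integrableOn_areaDiff hn hs hs1 hΩ hb hL hφ hv.1 hv₀m.1) hDi]
    exact integral_nonneg_of_ae ((ae_restrict_iff' hQ).2 (neg_lowerBound_le hn hs hN hv))
  have hm0 : 0 ≤ m + ∫ p in Q Ω, D p :=
    ge_of_tendsto (hbm.add_const _) (Filter.Eventually.of_forall fun k =>
      (hnn _ (hf k)).trans (by linarith [hJ k]))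
  rw [hFv u huW, ENNReal.ofReal_le_ofReal_iff hm0] at hFu
  linarith

theorem integral_areaDiff_add (hn : 1 ≤ n) (hs : 0 < s) (hs1 : s < 1) (hΩ : IsOpen Ω)
    (hb : Bornology.IsBounded Ω) (hL : HasLipschitzBoundary Ω)
    (hφ : AEMeasurable φ (volume.restrict Ωᶜ)) {w : Rn n → ℝ} (hu : u ∈ WObs s Ω A φ ψ)
    (hv : v ∈ WObs s Ω A φ ψ) (hw : w ∈ WObs s Ω A φ ψ) :
    (∫ p in Q Ω, areaDiff s u v p) + ∫ p in Q Ω, areaDiff s v w p =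
      ∫ p in Q Ω, areaDiff s u w p := by
  rw [← integral_add (integrableOn_areaDiff hn hs hs1 hΩ hb hL hφ hu hv)
    (integrableOn_areaDiff hn hs hs1 hΩ hb hL hφ hv hw)]
  simp_rw [areaDiff_add]

/-- The direct method in `L²(Ω)` among the admissible functions bounded by `N`. The almost
minimizers form decreasing convex subsets of `L²(Ω)`, and convexity replaces a compactness
argument for the minimizing sequence. -/
theorem exists_minimizer_bdd (hn : 1 ≤ n) (hs : 0 < s) (hs1 : s < 1) (hΩ : IsOpen Ω)
    (hb : Bornology.IsBounded Ω) (hL : HasLipschitzBoundary Ω) (hA : A ⊆ Ω)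
    (hφ : AEMeasurable φ (volume.restrict Ωᶜ)) {N : ℝ} (hN : 0 ≤ N)
    (hψ : ∀ᵐ x, x ∈ A → |ψ x| ≤ N) :
    ∃ u ∈ WObsBdd s Ω A φ ψ N, ∀ v ∈ WObsBdd s Ω A φ ψ N,
      ∫ p in Q Ω, areaDiff s u v p ≤ 0 := by
  have hΩm := hΩ.measurableSet
  set v₀ := glue Ω φ fun _ => N with hv₀
  have hv₀m : v₀ ∈ WObsBdd s Ω A φ ψ N := glue_const_mem hΩm hb hA hN hψ
  set C := WObsBdd s Ω A φ ψ N with hC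
  set J : (Rn n → ℝ) → ℝ := fun v => ∫ p in Q Ω, areaDiff s v v₀ p with hJ
  have hint : ∀ v ∈ C, IntegrableOn (areaDiff s v v₀) (Q Ω) := fun v hv =>
    integrableOn_areaDiff hn hs hs1 hΩ hb hL hφ hv.1 hv₀m.1
  have hJcongr : ∀ v w : Rn n → ℝ, v =ᵐ[volume] w → J v = J w := fun v w h =>
    integral_congr_ae (ae_restrict_of_ae (areaDiff_congr_ae h (Filter.EventuallyEq.refl _ _)))
  have hJmid : ∀ v ∈ C, ∀ w ∈ C, J (fun x => (v x + w x) / 2) ≤ (J v + J w) / 2 := by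
    intro v hv w hw
    have hm := WObsBdd_midpoint hv hw
    have h1 : 2 * J (fun x => (v x + w x) / 2) ≤ J v + J w := by
      rw [hJ, ← integral_add (hint v hv) (hint w hw), ← integral_const_mul]
      refine integral_mono ((hint _ hm).const_mul 2) ((hint v hv).add (hint w hw)) fun p => ?_
      have h2 := areaDiff_midpoint_nonneg (s := s) v w p
      have h3 := areaDiff_add s v (fun x => (v x + w x) / 2) v₀ p
      have h4 := areaDiff_add s w (fun x => (v x + w x) / 2) v₀ p
      linarith
    linarith
  have hDi := integrableOn_lowerBound hn hs hs1 hΩ hb hL N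
  have hJbelow : BddBelow (J '' C) := by
    refine ⟨-∫ p in Q Ω, lowerBound s Ω N p, ?_⟩
    rintro _ ⟨v, hv, rfl⟩
    have h1 : 0 ≤ J v + ∫ p in Q Ω, lowerBound s Ω N p := by
      rw [hJ, ← integral_add (hint v hv) hDi]
      exact integral_nonneg_of_ae ((ae_restrict_iff' (measurableSet_Q hΩm)).2
        (neg_lowerBound_le hn hs hN hv))
    linarith
  set m := sInf (J '' C) with hm
  have hmle : ∀ v ∈ C, m ≤ J v := fun v hv => csInf_le hJbelow ⟨v, hv, rfl⟩
  have : IsFiniteMeasure (volume.restrict Ω) := ⟨by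
    rw [Measure.restrict_apply_univ]; exact hb.measure_lt_top⟩
  set S : ℕ → Set (Lp ℝ 2 (volume.restrict Ω)) := fun k =>
    {f | glue Ω φ f ∈ C ∧ J (glue Ω φ f) ≤ m + 1 / ((k : ℝ) + 1)} with hS
  have hanti : Antitone S := by
    rintro k l hkl f ⟨h1, h2⟩
    refine ⟨h1, h2.trans ?_⟩
    have : (k : ℝ) ≤ l := by exact_mod_cast hkl
    have : 1 / ((l : ℝ) + 1) ≤ 1 / ((k : ℝ) + 1) :=
      one_div_le_one_div_of_le (by positivity) (by linarith)
    linarith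
  have hglue : ∀ (f : Rn n → ℝ) (v : Rn n → ℝ), v ∈ C → f =ᵐ[volume.restrict Ω] v →
      v =ᵐ[volume] glue Ω φ f := by
    intro f v hv h
    filter_upwards [(ae_restrict_iff' hΩm).1 h, hv.1.2.1] with x h1 h2
    by_cases hx : x ∈ Ω
    · rw [glue_of_mem hx, h1 hx]
    · rw [glue_of_notMem hx, h2 hx]
  have hne : ∀ k, (S k).Nonempty := by
    intro k
    have : m < m + 1 / ((k : ℝ) + 1) := by
      have : (0 : ℝ) < 1 / ((k : ℝ) + 1) := by positivity
      linarith
    obtain ⟨_, ⟨v, hv, rfl⟩, h⟩ := exists_lt_of_csInf_lt (Set.Nonempty.image J ⟨v₀, hv₀m⟩) this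
    have hLp : MemLp v 2 (volume.restrict Ω) := by
      refine MemLp.of_bound hv.1.1.1.aestronglyMeasurable N ?_
      exact (ae_restrict_iff' hΩm).2 hv.2
    have hae := hglue (hLp.toLp v) v hv hLp.coeFn_toLp
    exact ⟨hLp.toLp v, WObsBdd_congr hv hae, by rw [← hJcongr _ _ hae]; exact h.le⟩
  have hbd : ∀ f ∈ S 0, ‖f‖ ≤
      (volume.restrict Ω).real Set.univ ^ ((2 : ENNReal).toReal)⁻¹ * N := by
    rintro f ⟨h1, _⟩
    refine Lp.norm_le_of_ae_bound hN ((ae_restrict_iff' hΩm).2 ?_)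
    filter_upwards [h1.2] with x h hx
    have := h hx
    rwa [glue_of_mem hx] at this
  have hmid : ∀ k, ∀ f ∈ S k, ∀ h ∈ S k, (1 / 2 : ℝ) • (f + h) ∈ S k := by
    rintro k f ⟨f1, f2⟩ h ⟨h1, h2⟩
    have hmm := WObsBdd_midpoint f1 h1
    have hae := hglue ((1 / 2 : ℝ) • (f + h) : Lp ℝ 2 (volume.restrict Ω)) _ hmm (by
      filter_upwards [Lp.coeFn_smul (1 / 2 : ℝ) (f + h), Lp.coeFn_add f h,
        self_mem_ae_restrict hΩm] with x e1 e2 hx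
      rw [e1, Pi.smul_apply, e2, Pi.add_apply, glue_of_mem hx, glue_of_mem hx, smul_eq_mul]
      ring)
    refine ⟨WObsBdd_congr hmm hae, ?_⟩
    rw [← hJcongr _ _ hae]
    have := hJmid _ f1 _ h1
    linarith
  obtain ⟨f, hfS, hfc⟩ := exists_cauchySeq_of_midpoint hanti hne hbd hmid
  obtain ⟨f₀, hf₀⟩ := cauchySeq_tendsto_of_complete hfc
  obtain ⟨ns, hns, hlim⟩ := (tendstoInMeasure_of_tendsto_Lp hf₀).exists_seq_tendsto_ae
  set u := glue Ω φ f₀ with hu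
  have hum : AEMeasurable u := by
    refine aemeasurable_of_restrict_compl hΩm ?_ ?_
    · exact (Lp.aestronglyMeasurable f₀).aemeasurable.congr (glue_ae_eq hΩm).symm
    · refine hφ.congr ?_
      filter_upwards [self_mem_ae_restrict hΩm.compl] with x hx
      exact (glue_of_notMem hx).symm
  have hlim' : ∀ᵐ x, Filter.Tendsto (fun k => glue Ω φ (f (ns k)) x) Filter.atTop
      (nhds (u x)) := by
    filter_upwards [(ae_restrict_iff' hΩm).1 hlim] with x h
    by_cases hx : x ∈ Ω
    · simp only [hu, glue_of_mem hx]
      exact h hx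
    · simp only [hu, glue_of_notMem hx]
      exact tendsto_const_nhds
  have hb0 : Filter.Tendsto (fun k : ℕ => m + 1 / ((ns k : ℝ) + 1)) Filter.atTop (nhds m) := by
    have := ((tendsto_one_div_add_atTop_nhds_zero_nat (𝕜 := ℝ)).comp hns.tendsto_atTop).const_add m
    rwa [add_zero] at this
  obtain ⟨huC, huJ⟩ := area_lowerSemicontinuous hn hs hs1 hΩ hb hL hA hφ hN hψ
    (f := fun k => glue Ω φ (f (ns k))) (fun k => (hfS (ns k)).1) hum hlim' hb0
    (fun k => (hfS (ns k)).2)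
  refine ⟨u, huC, fun v hv => ?_⟩
  have h1 := integral_areaDiff_add hn hs hs1 hΩ hb hL hφ huC.1 hv.1 hv₀m.1
  have h2 := hmle v hv
  simp only [hJ] at h2
  linarith

/-- The minimizer among bounded functions is a solution, because truncating a competitor does not
increase the area. -/
theorem exists_solution_of_nonempty (hn : 1 ≤ n) (hs : 0 < s) (hs1 : s < 1) {Θ : ℝ} (hΘ4 : 4 ≤ Θ)
    (hΘ : gMass n s * Θ ^ (-s) ≤ G n s 1 * (2 ^ (-s) - 4 ^ (-s)))
    (hΩ : IsOpen Ω) (hb : Bornology.IsBounded Ω) (hne : Ω.Nonempty) (hL : HasLipschitzBoundary Ω)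
    (hA : A ⊆ Ω) (hφm : AEMeasurable φ (volume.restrict Ωᶜ)) {M K : ℝ} (hM : 0 ≤ M)
    (hφ : ∀ᵐ x, x ∈ nbhd Ω (Θ * Metric.diam Ω) \ Ω → |φ x| ≤ M)
    (hψ : ∀ᵐ x, x ∈ A → |ψ x| ≤ K) :
    ∃ u, SolvesObstacle s Ω A φ ψ u := by
  set N := max (M + 4 * Metric.diam Ω) K with hN
  have hN1 : M + 4 * Metric.diam Ω ≤ N := le_max_left _ _
  have hN0 : 0 ≤ N := le_trans (by have := Metric.diam_nonneg (s := Ω); positivity) hN1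
  have hψN : ∀ᵐ x, x ∈ A → |ψ x| ≤ N := hψ.mono fun x h hx => (h hx).trans (le_max_right _ _)
  obtain ⟨u, hu, hmin⟩ := exists_minimizer_bdd hn hs hs1 hΩ hb hL hA hφm hN0 hψN
  refine ⟨u, hu.1, fun v hv => ⟨integrableOn_areaDiff hn hs hs1 hΩ hb hL hφm hu.1 hv, ?_⟩⟩
  have ht : truncOn Ω N v ∈ WObsBdd s Ω A φ ψ N := by
    refine ⟨truncOn_mem_WObs hN0 hΩ.measurableSet hA hψN hv, Filter.Eventually.of_forall
      fun x hx => ?_⟩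
    rw [truncOn_of_mem hx]
    exact abs_clamp_le hN0
  have h1 := hmin _ ht
  have h2 := integral_areaDiff_truncOn_le hn hs hs1 hΘ4 hΘ hΩ hb hne hL hA hφm hM hφ hN1 hψN hv
  have h3 := integral_areaDiff_add hn hs hs1 hΩ hb hL hφm hu.1 ht.1 hv
  linarith

/-- For `Ω = ∅` the set `Q(Ω)` is empty and every function is a solution; this case is separate
because the truncation argument needs a positive diameter. -/
theorem exists_solution_of_empty (s : ℝ) (A : Set (Rn n)) (φ ψ : Rn n → ℝ) (hA : A ⊆ ∅) :
    SolvesObstacle s ∅ A φ ψ φ := by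
  have hQ : Q (∅ : Set (Rn n)) = ∅ := by simp [Q]
  refine ⟨⟨⟨by simp, by simp [gagliardo]⟩, by simp, ?_⟩, fun v _ => by simp [hQ]⟩
  exact Filter.Eventually.of_forall fun x hx => absurd (hA hx) (Set.notMem_empty x)

end NonlocalObstacle

/-! ### Interactions of vertical fibres -/

namespace NonlocalObstacle

/-- The kernel `|X - Y|^{-(n+1+s)}` for points of `ℝⁿ⁺¹` with horizontal distance `r` and vertical
displacement `h`. -/
noncomputable def fibreKernel (n : ℕ) (s r h : ℝ) : ℝ :=
  1 / Real.sqrt (r ^ 2 + h ^ 2) ^ ((n : ℝ) + 1 + s)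

theorem fibreKernel_nonneg (n : ℕ) (s r h : ℝ) : 0 ≤ fibreKernel n s r h := by
  unfold fibreKernel; positivity

theorem measurable_fibreKernel (n : ℕ) (s : ℝ) :
    Measurable fun q : ℝ × ℝ => fibreKernel n s q.1 q.2 := by
  unfold fibreKernel; fun_prop

theorem fibreKernel_eq {n : ℕ} {s r : ℝ} (hr : 0 < r) (h : ℝ) :
    fibreKernel n s r h = g n s (h / r) / r ^ ((n : ℝ) + 1 + s) := by
  have h1 : r ^ 2 + h ^ 2 = r ^ 2 * (1 + (h / r) ^ 2) := by field_simp
  unfold fibreKernel g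
  rw [h1, Real.sqrt_mul (by positivity), Real.sqrt_sq hr.le, Real.mul_rpow hr.le (by positivity),
    Real.sqrt_eq_rpow, ← Real.rpow_mul (by positivity), div_div, mul_comm (r ^ _)]
  congr 3
  ring

theorem lintegral_fibreKernel {n : ℕ} (hn : 1 ≤ n) {s r : ℝ} (hs : 0 < s) (hr : 0 < r) :
    ∫⁻ h, ENNReal.ofReal (fibreKernel n s r h) =
      ENNReal.ofReal (gMass n s * (1 / r ^ ((n : ℝ) + s))) := by
  simp_rw [fibreKernel_eq hr]
  have hi : Integrable fun h => g n s (h / r) / r ^ ((n : ℝ) + 1 + s) :=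
    ((integrable_g hn hs).comp_div hr.ne').div_const _
  rw [← ofReal_integral_eq_lintegral_ofReal hi (Filter.Eventually.of_forall fun h =>
    div_nonneg (g_nonneg _ _ _) (by positivity)), integral_div,
    Measure.integral_comp_div (g n s) r, abs_of_pos hr, smul_eq_mul]
  congr 1
  rw [show (n : ℝ) + 1 + s = (n + s) + 1 by ring, Real.rpow_add_one hr.ne', gMass]
  have : 0 < r ^ ((n : ℝ) + s) := Real.rpow_pos_of_pos hr _
  field_simp

/-- The first absolute moment of `g_s`. -/
noncomputable def gMoment (n : ℕ) (s : ℝ) : ℝ := ∫ z, g n s z * |z|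

theorem gMoment_nonneg (n : ℕ) (s : ℝ) : 0 ≤ gMoment n s :=
  integral_nonneg fun _ => mul_nonneg (g_nonneg _ _ _) (abs_nonneg _)

/-- The interaction of two half-lines with end points at height difference `δ` is the area density
`𝒢_s(δ/r) / r^{n-1+s}`, up to the factor `2` and a term which does not depend on `δ`. -/
theorem lintegral_fibreKernel_mul_abs_sub {n : ℕ} (hn : 1 ≤ n) {s r : ℝ} (hs : 0 < s) (hr : 0 < r)
    (δ : ℝ) :
    ∫⁻ h, ENNReal.ofReal (fibreKernel n s r h) * ENNReal.ofReal |δ - h| =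
      ENNReal.ofReal (gMoment n s / r ^ ((n : ℝ) - 1 + s) +
        2 * (GG n s (δ / r) / r ^ ((n : ℝ) - 1 + s))) := by
  have hp : 0 < r ^ ((n : ℝ) - 1 + s) := Real.rpow_pos_of_pos hr _
  have e1 : ∀ h, ENNReal.ofReal (fibreKernel n s r h) * ENNReal.ofReal |δ - h| =
      ENNReal.ofReal ((fun z => g n s z * |δ / r - z|) (h / r) / (r ^ ((n : ℝ) - 1 + s) * r)) := by
    intro h
    rw [← ENNReal.ofReal_mul (fibreKernel_nonneg _ _ _ _), fibreKernel_eq hr]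
    congr 1
    simp only
    rw [← sub_div, abs_div, abs_of_pos hr,
      show (n : ℝ) + 1 + s = ((n : ℝ) - 1 + s) + 1 + 1 by ring, Real.rpow_add_one hr.ne',
      Real.rpow_add_one hr.ne']
    field_simp
  simp_rw [e1]
  have hi : Integrable fun h => (fun z => g n s z * |δ / r - z|) (h / r) /
      (r ^ ((n : ℝ) - 1 + s) * r) :=
    ((integrable_g_mul_abs_sub hn hs (δ / r)).comp_div hr.ne').div_const _
  rw [← ofReal_integral_eq_lintegral_ofReal hi (Filter.Eventually.of_forall fun h =>
    div_nonneg (mul_nonneg (g_nonneg _ _ _) (abs_nonneg _)) (by positivity)), integral_div,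
    Measure.integral_comp_div (fun z => g n s z * |δ / r - z|) r, abs_of_pos hr, smul_eq_mul,
    integral_g_mul_abs_sub hn hs]
  congr 1
  change r * (gMoment n s + _) / _ = _
  field_simp

/-- The indicator function of the half-line below `p`. -/
noncomputable def halfLine (p : ℝ) : ℝ → ℝ := (Set.Iio p).indicator fun _ => 1

theorem measurable_halfLine (p : ℝ) : Measurable (halfLine p) :=
  measurable_const.indicator measurableSet_Iio

theorem halfLine_sub (p q h : ℝ) : halfLine q (p - h) = halfLine (q + h) p := by
  unfold halfLine Set.indicator
  simp only [Set.mem_Iio, sub_lt_iff_lt_add]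

theorem halfLine_sub_halfLine_of_le {p q : ℝ} (h : q ≤ p) (t : ℝ) :
    halfLine p t - halfLine q t = (Set.Ico q p).indicator (fun _ => (1 : ℝ)) t := by
  unfold halfLine Set.indicator
  simp only [Set.mem_Iio, Set.mem_Ico]
  by_cases h1 : t < q
  · simp [h1, h1.trans_le h, not_le.2 h1]
  · by_cases h2 : t < p
    · simp [h1, h2, not_lt.1 h1]
    · simp [h1, h2]

theorem integrable_halfLine_sub (p q : ℝ) : Integrable fun t => halfLine p t - halfLine q t := by
  have key : ∀ {p q : ℝ}, q ≤ p → Integrable fun t => halfLine p t - halfLine q t := by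
    intro p q h
    simp_rw [halfLine_sub_halfLine_of_le h]
    rw [integrable_indicator_iff measurableSet_Ico]
    exact integrableOn_const (by simp)
  rcases le_total q p with h | h
  · exact key h
  · have := (key h).neg
    refine this.congr (Filter.Eventually.of_forall fun t => ?_)
    simp

theorem integral_halfLine_sub (p q : ℝ) : ∫ t, (halfLine p t - halfLine q t) = p - q := by
  have key : ∀ {p q : ℝ}, q ≤ p → ∫ t, (halfLine p t - halfLine q t) = p - q := by
    intro p q h
    simp_rw [halfLine_sub_halfLine_of_le h]
    rw [integral_indicator measurableSet_Ico]
    simp [h]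
  rcases le_total q p with h | h
  · exact key h
  · rw [← neg_sub q p, ← key h, ← integral_neg]
    simp

theorem lintegral_abs_halfLine_sub (p q : ℝ) :
    ∫⁻ t, ENNReal.ofReal |halfLine p t - halfLine q t| = ENNReal.ofReal |p - q| := by
  have key : ∀ {p q : ℝ}, q ≤ p →
      ∫⁻ t, ENNReal.ofReal |halfLine p t - halfLine q t| = ENNReal.ofReal |p - q| := by
    intro p q h
    have e : ∀ t, ENNReal.ofReal |halfLine p t - halfLine q t| =
        (Set.Ico q p).indicator (fun _ => (1 : ENNReal)) t := by
      intro t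
      rw [halfLine_sub_halfLine_of_le h]
      by_cases ht : t ∈ Set.Ico q p <;> simp [ht]
    simp_rw [e]
    rw [lintegral_indicator_const measurableSet_Ico, one_mul, Real.volume_Ico,
      abs_of_nonneg (by linarith)]
  rcases le_total q p with h | h
  · exact key h
  · simp_rw [abs_sub_comm (halfLine p _), abs_sub_comm p q]
    exact key h

/-- The interaction `∬ |a(t) - b(τ)| k(t - τ) dt dτ` of two functions on vertical fibres. -/
noncomputable def interaction (k : ℝ → ENNReal) (a b : ℝ → ℝ) : ENNReal :=
  ∫⁻ t, ∫⁻ τ, ENNReal.ofReal |a t - b τ| * k (t - τ)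

theorem interaction_eq {k : ℝ → ENNReal} (hk : Measurable k) {a b : ℝ → ℝ} (ha : Measurable a)
    (hb : Measurable b) :
    interaction k a b = ∫⁻ h, k h * ∫⁻ t, ENNReal.ofReal |a t - b (t - h)| := by
  unfold interaction
  calc ∫⁻ t, ∫⁻ τ, ENNReal.ofReal |a t - b τ| * k (t - τ)
      = ∫⁻ t, ∫⁻ h, ENNReal.ofReal |a t - b (t - h)| * k h := by
        refine lintegral_congr fun t => ?_
        rw [← lintegral_sub_left_eq_self _ t]
        simp
    _ = ∫⁻ h, ∫⁻ t, ENNReal.ofReal |a t - b (t - h)| * k h :=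
        lintegral_lintegral_swap (Measurable.aemeasurable (by
          unfold Function.uncurry
          fun_prop))
    _ = ∫⁻ h, k h * ∫⁻ t, ENNReal.ofReal |a t - b (t - h)| := by
        refine lintegral_congr fun h => ?_
        rw [lintegral_mul_const _ (by fun_prop), mul_comm]

theorem interaction_halfLine {k : ℝ → ENNReal} (hk : Measurable k) (p q : ℝ) :
    interaction k (halfLine p) (halfLine q) = ∫⁻ h, k h * ENNReal.ofReal |p - q - h| := by
  rw [interaction_eq hk (measurable_halfLine p) (measurable_halfLine q)]
  refine lintegral_congr fun h => ?_
  simp_rw [halfLine_sub]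
  rw [lintegral_abs_halfLine_sub, sub_add_eq_sub_sub]

/-- Rearranging two fibres into half-lines of the same renormalized mass does not increase their
interaction, whatever the kernel: for each vertical displacement `h` the quantity `|α - β - h|` is
the absolute value of the integral whose integrand has absolute value `|a(t) - b(t - h)|`, and for
half-lines the integrand has constant sign. -/
theorem lintegral_le_interaction {k : ℝ → ENNReal} (hk : Measurable k) {a b : ℝ → ℝ}
    (ha : Measurable a) (hb : Measurable b) {p q : ℝ}
    (hap : Integrable fun t => a t - halfLine p t) (hbq : Integrable fun t => b t - halfLine q t) :
    ∫⁻ h, k h * ENNReal.ofReal |(p + ∫ t, (a t - halfLine p t)) -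
      (q + ∫ t, (b t - halfLine q t)) - h| ≤ interaction k a b := by
  rw [interaction_eq hk ha hb]
  refine lintegral_mono fun h => mul_le_mul' le_rfl ?_
  have hbh : Integrable fun t => b (t - h) - halfLine q (t - h) := hbq.comp_sub_right h
  have h1 : ∫ t, (b (t - h) - halfLine q (t - h)) = ∫ t, (b t - halfLine q t) :=
    integral_sub_right_eq_self (fun t => b t - halfLine q t) h
  have h2 := integrable_halfLine_sub p (q + h)
  have hi : Integrable fun t => a t - b (t - h) := by
    refine ((hap.add h2).sub hbh).congr (Filter.Eventually.of_forall fun t => ?_)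
    simp only [Pi.sub_apply, Pi.add_apply, halfLine_sub]
    ring
  have hval : ∫ t, (a t - b (t - h)) = (p + ∫ t, (a t - halfLine p t)) -
      (q + ∫ t, (b t - halfLine q t)) - h := by
    have : ∫ t, (a t - b (t - h)) = ∫ t, ((a t - halfLine p t) +
        (halfLine p t - halfLine (q + h) t) - (b (t - h) - halfLine q (t - h))) := by
      refine integral_congr_ae (Filter.Eventually.of_forall fun t => ?_)
      simp only [halfLine_sub]
      ring
    rw [this, integral_sub (f := fun t => (a t - halfLine p t) +
      (halfLine p t - halfLine (q + h) t)) (hap.add h2) hbh, integral_add hap h2, h1,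
      integral_halfLine_sub]
    ring
  rw [← hval, ← Real.norm_eq_abs, ofReal_norm]
  refine (enorm_integral_le_lintegral_enorm _).trans (le_of_eq ?_)
  refine lintegral_congr fun t => ?_
  rw [← ofReal_norm, Real.norm_eq_abs]

end NonlocalObstacle

/-! ### Slicing the fractional perimeter -/

namespace NonlocalObstacle

variable {n : ℕ} {s : ℝ}

theorem measurable_sliced {α β : Type*} [MeasurableSpace α] [MeasurableSpace β]
    {ν : Measure β} [SFinite ν] {D : (α × β) × (α × β) → ENNReal} (hD : Measurable D) :
    Measurable fun p : α × α => ∫⁻ t, ∫⁻ τ, D ((p.1, t), (p.2, τ)) ∂ν ∂ν := by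
  have h1 : Measurable fun z : ((α × α) × β) × β => D ((z.1.1.1, z.1.2), (z.1.1.2, z.2)) := by
    fun_prop
  exact h1.lintegral_prod_right'.lintegral_prod_right'

theorem lintegral_sliced {α β : Type*} [MeasurableSpace α] [MeasurableSpace β]
    {μ : Measure α} {ν : Measure β} [SFinite μ] [SFinite ν] {D : (α × β) × (α × β) → ENNReal}
    (hD : Measurable D) :
    ∫⁻ q, D q ∂((μ.prod ν).prod (μ.prod ν)) =
      ∫⁻ p, ∫⁻ t, ∫⁻ τ, D ((p.1, t), (p.2, τ)) ∂ν ∂ν ∂(μ.prod μ) := by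
  have h1 : Measurable fun z : (α × β) × α => ∫⁻ τ, D (z.1, (z.2, τ)) ∂ν := by
    have : Measurable fun y : ((α × β) × α) × β => D (y.1.1, (y.1.2, y.2)) := by fun_prop
    exact this.lintegral_prod_right'
  have h2 : Measurable fun X : α × β => ∫⁻ y, ∫⁻ τ, D (X, (y, τ)) ∂ν ∂μ :=
    h1.lintegral_prod_right'
  rw [lintegral_prod _ hD.aemeasurable, lintegral_prod _ (measurable_sliced hD).aemeasurable]
  calc ∫⁻ X, ∫⁻ Y, D (X, Y) ∂(μ.prod ν) ∂(μ.prod ν)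
      = ∫⁻ X, ∫⁻ y, ∫⁻ τ, D (X, (y, τ)) ∂ν ∂μ ∂(μ.prod ν) := by
        refine lintegral_congr fun X => ?_
        rw [lintegral_prod _ (Measurable.aemeasurable (by fun_prop))]
    _ = ∫⁻ x, ∫⁻ t, ∫⁻ y, ∫⁻ τ, D ((x, t), (y, τ)) ∂ν ∂μ ∂ν ∂μ :=
        lintegral_prod _ h2.aemeasurable
    _ = ∫⁻ x, ∫⁻ y, ∫⁻ t, ∫⁻ τ, D ((x, t), (y, τ)) ∂ν ∂ν ∂μ ∂μ := by
        refine lintegral_congr fun x => ?_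
        refine lintegral_lintegral_swap (Measurable.aemeasurable ?_)
        exact h1.comp (f := fun z : β × α => ((x, z.1), z.2)) (by fun_prop)

/-- The characteristic function of the fibre of `F` over `x`. -/
noncomputable def fibre (F : Set (RnSucc n)) (x : Rn n) (t : ℝ) : ℝ :=
  F.indicator (fun _ => 1) (x, t)

theorem measurable_fibre_uncurry {F : Set (RnSucc n)} (hF : MeasurableSet F) :
    Measurable fun q : RnSucc n => fibre F q.1 q.2 :=
  measurable_const.indicator hF

theorem measurable_fibre {F : Set (RnSucc n)} (hF : MeasurableSet F) (x : Rn n) :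
    Measurable (fibre F x) :=
  (measurable_fibre_uncurry hF).comp (measurable_const.prodMk measurable_id)

theorem fibre_subgraph (u : Rn n → ℝ) (x : Rn n) :
    fibre (subgraph u Set.univ) x = halfLine (u x) := by
  funext t
  simp [fibre, subgraph, halfLine, Set.indicator]

theorem abs_fibre_sub_le (F : Set (RnSucc n)) (x y : Rn n) (t τ : ℝ) :
    |fibre F x t - fibre F y τ| ≤ 1 := by
  unfold fibre Set.indicator
  split_ifs <;> simp

/-- The integrand of the fractional perimeter. -/
noncomputable def perDensity (s : ℝ) (F : Set (RnSucc n)) (q : RnSucc n × RnSucc n) : ENNReal :=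
  ENNReal.ofReal |fibre F q.1.1 q.1.2 - fibre F q.2.1 q.2.2| *
    ENNReal.ofReal (fibreKernel n s ‖q.1.1 - q.2.1‖ (q.1.2 - q.2.2))

theorem measurable_perDensity (s : ℝ) {F : Set (RnSucc n)} (hF : MeasurableSet F) :
    Measurable (perDensity s F) := by
  have h1 : Measurable fun q : RnSucc n × RnSucc n => fibre F q.1.1 q.1.2 :=
    (measurable_fibre_uncurry hF).comp measurable_fst
  have h2 : Measurable fun q : RnSucc n × RnSucc n => fibre F q.2.1 q.2.2 :=
    (measurable_fibre_uncurry hF).comp measurable_snd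
  have h3 : Measurable fun q : RnSucc n × RnSucc n =>
      fibreKernel n s ‖q.1.1 - q.2.1‖ (q.1.2 - q.2.2) :=
    (measurable_fibreKernel n s).comp
      (f := fun q : RnSucc n × RnSucc n => (‖q.1.1 - q.2.1‖, q.1.2 - q.2.2)) (by fun_prop)
  exact (h1.sub h2).abs.ennreal_ofReal.mul h3.ennreal_ofReal

/-- The part of the interaction of the fibres of `F` over the points of the pair `p` which comes
from the region `R`. -/
noncomputable def fibrePart (s : ℝ) (F : Set (RnSucc n)) (R : Set (RnSucc n × RnSucc n))
    (p : Rn n × Rn n) : ENNReal :=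
  ∫⁻ t, ∫⁻ τ, R.indicator (perDensity s F) ((p.1, t), (p.2, τ))

theorem measurable_fibrePart {F : Set (RnSucc n)} (hF : MeasurableSet F)
    {R : Set (RnSucc n × RnSucc n)} (hR : MeasurableSet R) : Measurable (fibrePart s F R) :=
  measurable_sliced ((measurable_perDensity s hF).indicator hR)

theorem fibrePart_add_compl {F : Set (RnSucc n)} (hF : MeasurableSet F)
    {R : Set (RnSucc n × RnSucc n)} (hR : MeasurableSet R) (p : Rn n × Rn n) :
    fibrePart s F R p + fibrePart s F Rᶜ p =
      interaction (fun h => ENNReal.ofReal (fibreKernel n s ‖p.1 - p.2‖ h))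
        (fibre F p.1) (fibre F p.2) := by
  have m1 : Measurable fun z : ℝ × ℝ => R.indicator (perDensity s F) ((p.1, z.1), (p.2, z.2)) :=
    ((measurable_perDensity s hF).indicator hR).comp
      (f := fun z : ℝ × ℝ => (((p.1, z.1), (p.2, z.2)) : RnSucc n × RnSucc n)) (by fun_prop)
  unfold fibrePart interaction
  rw [← lintegral_add_left m1.lintegral_prod_right']
  refine lintegral_congr fun t => ?_
  have m2 : Measurable fun τ : ℝ => R.indicator (perDensity s F) ((p.1, t), (p.2, τ)) :=
    m1.comp (measurable_prodMk_left (x := t))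
  change (∫⁻ τ, R.indicator (perDensity s F) ((p.1, t), (p.2, τ))) + _ = _
  rw [← lintegral_add_left m2]
  refine lintegral_congr fun τ => ?_
  exact Set.indicator_self_add_compl_apply R (perDensity s F) ((p.1, t), (p.2, τ))

/-- The pairs which contribute to the fractional perimeter in `O`. -/
def perRegion (O : Set (RnSucc n)) : Set (RnSucc n × RnSucc n) := (Oᶜ ×ˢ Oᶜ)ᶜ

theorem measurableSet_perRegion {O : Set (RnSucc n)} (hO : MeasurableSet O) :
    MeasurableSet (perRegion O) :=
  (hO.compl.prod hO.compl).compl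

theorem fibrePart_eq_zero (F : Set (RnSucc n)) {Ω : Set (Rn n)} (M : ℝ) {p : Rn n × Rn n}
    (hp : p ∉ Q Ω) : fibrePart s F (perRegion (cylinder Ω M)) p = 0 := by
  have h : p.1 ∉ Ω ∧ p.2 ∉ Ω := by simpa [Q] using hp
  have e : ∀ t τ : ℝ, (perRegion (cylinder Ω M)).indicator (perDensity s F)
      ((p.1, t), (p.2, τ)) = 0 := by
    intro t τ
    apply Set.indicator_of_notMem
    simp [perRegion, cylinder, h.1, h.2]
  simp [fibrePart, e]

theorem fracPer_eq {F : Set (RnSucc n)} (hF : MeasurableSet F) {Ω : Set (Rn n)}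
    (hΩ : MeasurableSet Ω) (M : ℝ) :
    fracPer s F (cylinder Ω M) = ∫⁻ p in Q Ω, fibrePart s F (perRegion (cylinder Ω M)) p := by
  have hR : MeasurableSet (perRegion (cylinder Ω M)) :=
    measurableSet_perRegion (hΩ.prod measurableSet_Ioo)
  have h1 : fracPer s F (cylinder Ω M) =
      ∫⁻ p, fibrePart s F (perRegion (cylinder Ω M)) p := by
    unfold fracPer fibrePart
    refine Eq.trans ?_ (lintegral_sliced (μ := (volume : Measure (Rn n)))
      (ν := (volume : Measure ℝ)) ((measurable_perDensity s hF).indicator hR))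
    change ∫⁻ q in perRegion (cylinder Ω M), _ = _
    rw [← lintegral_indicator hR]
    refine lintegral_congr fun q => ?_
    congr 1
    funext q
    rw [perDensity, ← ENNReal.ofReal_mul (abs_nonneg _), fibreKernel, mul_one_div]
    rfl
  rw [h1, ← lintegral_indicator (measurableSet_Q hΩ)]
  refine lintegral_congr fun p => ?_
  by_cases hp : p ∈ Q Ω
  · rw [Set.indicator_of_mem hp]
  · rw [Set.indicator_of_notMem hp, fibrePart_eq_zero F M hp]

/-- The fibres of `F` and `E` over `x` agree outside `O`. -/
def FibresAgree (E F O : Set (RnSucc n)) (x : Rn n) : Prop :=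
  ∀ᵐ t, (x, t) ∉ O → fibre F x t = fibre E x t

theorem ae_fibresAgree {E F O : Set (RnSucc n)}
    (h : (F \ O : Set (RnSucc n)) =ᵐ[volume] (E \ O : Set (RnSucc n))) :
    ∀ᵐ x, FibresAgree E F O x := by
  have h1 : ∀ᵐ q : Rn n × ℝ ∂(volume.prod volume), q ∉ O → fibre F q.1 q.2 = fibre E q.1 q.2 := by
    filter_upwards [Filter.eventuallyEq_set.1 h] with q hq hO
    have : q ∈ F ↔ q ∈ E := by simpa [hO] using hq
    change F.indicator (fun _ => (1 : ℝ)) q = E.indicator (fun _ => (1 : ℝ)) q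
    by_cases hE : q ∈ E
    · rw [Set.indicator_of_mem hE, Set.indicator_of_mem (this.2 hE)]
    · rw [Set.indicator_of_notMem hE, Set.indicator_of_notMem (fun h => hE (this.1 h))]
  exact Measure.ae_ae_of_ae_prod h1

theorem fibrePart_compl_congr {E F O : Set (RnSucc n)} {p : Rn n × Rn n}
    (h1 : FibresAgree E F O p.1) (h2 : FibresAgree E F O p.2) :
    fibrePart s F (perRegion O)ᶜ p = fibrePart s E (perRegion O)ᶜ p := by
  refine lintegral_congr_ae ?_
  filter_upwards [h1] with t ht
  refine lintegral_congr_ae ?_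
  filter_upwards [h2] with τ hτ
  by_cases hm : ((p.1, t), (p.2, τ)) ∈ (perRegion O)ᶜ
  · rw [Set.indicator_of_mem hm, Set.indicator_of_mem hm]
    have hm' : (p.1, t) ∉ O ∧ (p.2, τ) ∉ O := by simpa [perRegion] using hm
    simp only [perDensity, ht hm'.1, hτ hm'.2]
  · rw [Set.indicator_of_notMem hm, Set.indicator_of_notMem hm]

end NonlocalObstacle

/-! ### Rearrangement of a competitor into a subgraph -/

namespace NonlocalObstacle

variable {n : ℕ} {s M : ℝ} {Ω A : Set (Rn n)} {φ ψ u : Rn n → ℝ} {F : Set (RnSucc n)}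

/-- The function whose subgraph is the vertical rearrangement of `F`: the end point of the half-line
which has the same renormalized length, relative to the half-line below `u x`, as the fibre of `F`
over `x`. -/
noncomputable def rearr (F : Set (RnSucc n)) (u : Rn n → ℝ) (x : Rn n) : ℝ :=
  u x + ∫ t, (fibre F x t - halfLine (u x) t)

theorem FibresAgree.ae_abs_sub_le {x : Rn n}
    (h : FibresAgree (subgraph u Set.univ) F (cylinder Ω M) x) :
    ∀ᵐ t, ‖fibre F x t - halfLine (u x) t‖ ≤ (Set.Ioo (-M) M).indicator (fun _ => (1 : ℝ)) t := by
  filter_upwards [h] with t ht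
  rw [← fibre_subgraph]
  by_cases hm : t ∈ Set.Ioo (-M) M
  · rw [Set.indicator_of_mem hm]
    unfold fibre Set.indicator
    split_ifs <;> simp
  · rw [Set.indicator_of_notMem hm, ht fun hc => hm hc.2]
    simp

theorem FibresAgree.integrable {x : Rn n} (hF : MeasurableSet F)
    (h : FibresAgree (subgraph u Set.univ) F (cylinder Ω M) x) :
    Integrable fun t => fibre F x t - halfLine (u x) t := by
  refine Integrable.mono' ?_ ((measurable_fibre hF x).sub
    (measurable_halfLine _)).aestronglyMeasurable h.ae_abs_sub_le
  rw [integrable_indicator_iff measurableSet_Ioo]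
  exact integrableOn_const (by simp)

theorem FibresAgree.abs_rearr_sub_le {x : Rn n} (hM : 0 ≤ M)
    (h : FibresAgree (subgraph u Set.univ) F (cylinder Ω M) x) :
    |rearr F u x - u x| ≤ 2 * M := by
  have h1 : Integrable ((Set.Ioo (-M) M).indicator fun _ => (1 : ℝ)) := by
    rw [integrable_indicator_iff measurableSet_Ioo]
    exact integrableOn_const (by simp)
  have h2 := norm_integral_le_of_norm_le h1 h.ae_abs_sub_le
  rw [integral_indicator measurableSet_Ioo] at h2
  have h3 : ∫ _ in Set.Ioo (-M) M, (1 : ℝ) = 2 * M := by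
    simp [hM]
    ring
  rw [h3] at h2
  simpa [rearr] using h2

theorem FibresAgree.rearr_eq {x : Rn n} (hx : x ∉ Ω)
    (h : FibresAgree (subgraph u Set.univ) F (cylinder Ω M) x) : rearr F u x = u x := by
  have : ∫ t, (fibre F x t - halfLine (u x) t) = 0 := by
    refine integral_eq_zero_of_ae ?_
    filter_upwards [h] with t ht
    rw [← fibre_subgraph, ht fun hc => hx hc.1]
    simp
  rw [rearr, this, add_zero]

/-- The rearrangement respects the obstacle. -/
theorem FibresAgree.le_rearr {x : Rn n} (hF : MeasurableSet F)
    (h : FibresAgree (subgraph u Set.univ) F (cylinder Ω M) x) {c : ℝ}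
    (hc : ∀ᵐ t, t < c → (x, t) ∈ F) : c ≤ rearr F u x := by
  have h1 := h.integrable hF
  have h2 := integrable_halfLine_sub (u x) c
  have h3 : 0 ≤ ∫ t, ((fibre F x t - halfLine (u x) t) + (halfLine (u x) t - halfLine c t)) := by
    refine integral_nonneg_of_ae ?_
    filter_upwards [hc] with t ht
    simp only [Pi.zero_apply, sub_add_sub_cancel, sub_nonneg]
    unfold fibre halfLine Set.indicator
    by_cases htc : t < c
    · simp [htc, ht htc]
    · simp only [Set.mem_Iio, htc, if_false]
      split_ifs <;> simp
  rw [integral_add h1 h2, integral_halfLine_sub] at h3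
  unfold rearr
  linarith

theorem measurable_rearr (hF : MeasurableSet F) (hu : Measurable u) : Measurable (rearr F u) := by
  have h1 : Measurable fun q : Rn n × ℝ => halfLine (u q.1) q.2 := by
    have : (fun q : Rn n × ℝ => halfLine (u q.1) q.2) =
        {q : Rn n × ℝ | q.2 < u q.1}.indicator fun _ => 1 := by
      funext q
      simp [halfLine, Set.indicator]
    rw [this]
    exact measurable_const.indicator
      (measurableSet_lt measurable_snd (hu.comp measurable_fst))
  have h2 : StronglyMeasurable fun q : Rn n × ℝ => fibre F q.1 q.2 - halfLine (u q.1) q.2 :=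
    ((measurable_fibre_uncurry hF).sub h1).stronglyMeasurable
  exact hu.add h2.integral_prod_right.measurable

/-- The interaction of the fibres over the points of `p` of the subgraph of `u`. -/
noncomputable def fibreArea (s : ℝ) (u : Rn n → ℝ) (p : Rn n × Rn n) : ℝ :=
  gMoment n s / ‖p.1 - p.2‖ ^ ((n : ℝ) - 1 + s) +
    2 * (GG n s ((u p.1 - u p.2) / ‖p.1 - p.2‖) / ‖p.1 - p.2‖ ^ ((n : ℝ) - 1 + s))

theorem fibreArea_nonneg (s : ℝ) (u : Rn n → ℝ) (p : Rn n × Rn n) : 0 ≤ fibreArea s u p := by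
  have := gMoment_nonneg n s
  have := GG_nonneg n s ((u p.1 - u p.2) / ‖p.1 - p.2‖)
  unfold fibreArea
  positivity

theorem fibreArea_sub (s : ℝ) (u v : Rn n → ℝ) (p : Rn n × Rn n) :
    fibreArea s u p - fibreArea s v p = 2 * areaDiff s u v p := by
  unfold fibreArea areaDiff
  ring

theorem interaction_subgraph (hn : 1 ≤ n) (hs : 0 < s) (u : Rn n → ℝ) {p : Rn n × Rn n}
    (hp : p.1 ≠ p.2) :
    interaction (fun h => ENNReal.ofReal (fibreKernel n s ‖p.1 - p.2‖ h))
      (fibre (subgraph u Set.univ) p.1) (fibre (subgraph u Set.univ) p.2) =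
        ENNReal.ofReal (fibreArea s u p) := by
  have hk : Measurable fun h => ENNReal.ofReal (fibreKernel n s ‖p.1 - p.2‖ h) :=
    ((measurable_fibreKernel n s).comp
      (measurable_prodMk_left (x := ‖p.1 - p.2‖))).ennreal_ofReal
  rw [fibre_subgraph, fibre_subgraph, interaction_halfLine hk,
    lintegral_fibreKernel_mul_abs_sub hn hs (norm_pos_iff.2 (sub_ne_zero.2 hp))]
  rfl

theorem fibreArea_rearr_le_interaction (hn : 1 ≤ n) (hs : 0 < s) (hF : MeasurableSet F)
    {p : Rn n × Rn n} (hp : p.1 ≠ p.2)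
    (h1 : FibresAgree (subgraph u Set.univ) F (cylinder Ω M) p.1)
    (h2 : FibresAgree (subgraph u Set.univ) F (cylinder Ω M) p.2) :
    ENNReal.ofReal (fibreArea s (rearr F u) p) ≤
      interaction (fun h => ENNReal.ofReal (fibreKernel n s ‖p.1 - p.2‖ h))
        (fibre F p.1) (fibre F p.2) := by
  have hk : Measurable fun h => ENNReal.ofReal (fibreKernel n s ‖p.1 - p.2‖ h) :=
    ((measurable_fibreKernel n s).comp
      (measurable_prodMk_left (x := ‖p.1 - p.2‖))).ennreal_ofReal
  refine le_trans (le_of_eq ?_) (lintegral_le_interaction hk (measurable_fibre hF p.1)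
    (measurable_fibre hF p.2) (h1.integrable hF) (h2.integrable hF))
  rw [lintegral_fibreKernel_mul_abs_sub hn hs (norm_pos_iff.2 (sub_ne_zero.2 hp))]
  rfl

theorem measurableSet_subgraph_univ (hu : Measurable u) : MeasurableSet (subgraph u Set.univ) := by
  have : subgraph u Set.univ = {X : RnSucc n | X.2 < u X.1} := by
    ext X
    simp [subgraph]
  rw [this]
  exact measurableSet_lt measurable_snd (hu.comp measurable_fst)

/-- The rearrangement inequality for complete fibres, in terms of the contributions to the perimeter
in the cylinder: the contributions from outside the cylinder are the same for `F` and for the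
subgraph of `u`, and finite, so that they cancel. -/
theorem fibrePart_add_fibreArea_le (hn : 1 ≤ n) (hs : 0 < s) (hΩ : MeasurableSet Ω)
    (hu : Measurable u) (hF : MeasurableSet F) {p : Rn n × Rn n} (hp : p.1 ≠ p.2)
    (h1 : FibresAgree (subgraph u Set.univ) F (cylinder Ω M) p.1)
    (h2 : FibresAgree (subgraph u Set.univ) F (cylinder Ω M) p.2) :
    fibrePart s (subgraph u Set.univ) (perRegion (cylinder Ω M)) p +
      ENNReal.ofReal (fibreArea s (rearr F u) p) ≤
    fibrePart s F (perRegion (cylinder Ω M)) p + ENNReal.ofReal (fibreArea s u p) := by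
  have hR : MeasurableSet (perRegion (cylinder Ω M)) :=
    measurableSet_perRegion (hΩ.prod measurableSet_Ioo)
  have hE := fibrePart_add_compl (s := s) (measurableSet_subgraph_univ hu) hR p
  have hFi := fibrePart_add_compl (s := s) hF hR p
  rw [fibrePart_compl_congr h1 h2] at hFi
  rw [interaction_subgraph hn hs u hp] at hE
  have hw := fibreArea_rearr_le_interaction (s := s) hn hs hF hp h1 h2
  rw [← hFi] at hw
  rw [← hE, ← add_assoc, add_comm (fibrePart s F _ p), add_assoc]
  refine (add_le_add_right hw _).trans (le_of_eq ?_)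
  ring

/-- The previous inequality after cancellation of the part of the area common to both sides. -/
theorem fibrePart_add_areaDiff_le (hn : 1 ≤ n) (hs : 0 < s) (hΩ : MeasurableSet Ω)
    (hu : Measurable u) (hF : MeasurableSet F) {p : Rn n × Rn n} (hp : p.1 ≠ p.2)
    (h1 : FibresAgree (subgraph u Set.univ) F (cylinder Ω M) p.1)
    (h2 : FibresAgree (subgraph u Set.univ) F (cylinder Ω M) p.2) :
    fibrePart s (subgraph u Set.univ) (perRegion (cylinder Ω M)) p +
      ENNReal.ofReal (-(2 * areaDiff s u (rearr F u) p)) ≤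
    fibrePart s F (perRegion (cylinder Ω M)) p +
      ENNReal.ofReal (2 * areaDiff s u (rearr F u) p) := by
  have h := fibrePart_add_fibreArea_le (s := s) hn hs hΩ hu hF hp h1 h2
  rw [← fibreArea_sub, neg_sub]
  have a1 := fibreArea_nonneg s u p
  have a2 := fibreArea_nonneg s (rearr F u) p
  rcases le_total (fibreArea s u p) (fibreArea s (rearr F u) p) with hl | hl
  · rw [ENNReal.ofReal_of_nonpos (sub_nonpos.2 hl), add_zero]
    rw [← sub_add_cancel (fibreArea s (rearr F u) p) (fibreArea s u p),
      ENNReal.ofReal_add (sub_nonneg.2 hl) a1, ← add_assoc] at h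
    exact (ENNReal.add_le_add_iff_right ENNReal.ofReal_ne_top).1 h
  · rw [ENNReal.ofReal_of_nonpos (sub_nonpos.2 hl), add_zero]
    rw [← sub_add_cancel (fibreArea s u p) (fibreArea s (rearr F u) p),
      ENNReal.ofReal_add (sub_nonneg.2 hl) a2, ← add_assoc] at h
    exact (ENNReal.add_le_add_iff_right ENNReal.ofReal_ne_top).1 h

theorem ae_fibresAgree_pair {E O : Set (RnSucc n)} (h : ∀ᵐ x, FibresAgree E F O x) :
    ∀ᵐ p : Rn n × Rn n, FibresAgree E F O p.1 ∧ FibresAgree E F O p.2 := by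
  have f1 := Measure.quasiMeasurePreserving_fst (μ := (volume : Measure (Rn n)))
    (ν := (volume : Measure (Rn n)))
  have f2 := Measure.quasiMeasurePreserving_snd (μ := (volume : Measure (Rn n)))
    (ν := (volume : Measure (Rn n)))
  exact (f1.ae h).and (f2.ae h)

/-! ### Finiteness of the perimeter -/

theorem lintegral_fibreArea_lt_top (hn : 1 ≤ n) (hs : 0 < s) (hs1 : s < 1) (hΩ : MeasurableSet Ω)
    (hb : Bornology.IsBounded Ω) (hu : u ∈ W s Ω) :
    ∫⁻ p in Ω ×ˢ Ω, ENNReal.ofReal (fibreArea s u p) < ⊤ := by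
  have hle : ∀ p : Rn n × Rn n, ENNReal.ofReal (fibreArea s u p) ≤
      ENNReal.ofReal (gMoment n s) *
        ENNReal.ofReal (1 / ‖p.1 - p.2‖ ^ ((n : ℝ) - 1 + s)) +
      ENNReal.ofReal (2 * gMass n s) * gagDensity s u p := by
    intro p
    have hm := gMoment_nonneg n s
    have hg := gMass_nonneg n s
    rw [gagDensity, ← ENNReal.ofReal_mul hm, ← ENNReal.ofReal_mul (by positivity),
      ← ENNReal.ofReal_add (by positivity) (by positivity)]
    refine ENNReal.ofReal_le_ofReal ?_
    unfold fibreArea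
    have := abs_areaDiff_le hn hs u (fun _ => 0) p
    simp only [areaDiff, sub_self, zero_div, GG_zero, sub_zero] at this
    have := (le_abs_self _).trans this
    rw [mul_one_div]
    linarith
  refine lt_of_le_of_lt (lintegral_mono hle) ?_
  rw [lintegral_add_left (by fun_prop), lintegral_const_mul _ (by fun_prop),
    lintegral_const_mul' _ _ ENNReal.ofReal_ne_top,
    ← gagliardo_eq_lintegral_prod (W_aemeasurable hu)]
  refine ENNReal.add_lt_top.2 ⟨ENNReal.mul_lt_top ENNReal.ofReal_lt_top ?_,
    ENNReal.mul_lt_top ENNReal.ofReal_lt_top hu.2⟩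
  rw [Measure.volume_eq_prod, ← Measure.prod_restrict, lintegral_prod _ (by fun_prop)]
  exact lintegral_lintegral_bounded_lt_top hn hs1 hΩ hb

/-- One of the two points of a contributing pair has height in `(-M, M)`. -/
theorem fibrePart_le (hn : 1 ≤ n) (hs : 0 < s) (hM : 0 ≤ M) (F : Set (RnSucc n))
    {p : Rn n × Rn n} (hp : p.1 ≠ p.2) :
    fibrePart s F (perRegion (cylinder Ω M)) p ≤
      ENNReal.ofReal (4 * M * gMass n s) * ENNReal.ofReal (1 / ‖p.1 - p.2‖ ^ ((n : ℝ) + s)) := by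
  set k : ℝ → ENNReal := fun h => ENNReal.ofReal (fibreKernel n s ‖p.1 - p.2‖ h) with hk
  have hkm : Measurable k := ((measurable_fibreKernel n s).comp
      (measurable_prodMk_left (x := ‖p.1 - p.2‖))).ennreal_ofReal
  set I : ℝ → ENNReal := (Set.Ioo (-M) M).indicator fun _ => 1 with hI
  have hIm : Measurable I := measurable_const.indicator measurableSet_Ioo
  have hle : ∀ t τ : ℝ, (perRegion (cylinder Ω M)).indicator (perDensity s F)
      ((p.1, t), (p.2, τ)) ≤ I t * k (t - τ) + I τ * k (t - τ) := by
    intro t τ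
    by_cases hm : ((p.1, t), (p.2, τ)) ∈ perRegion (cylinder Ω M)
    · rw [Set.indicator_of_mem hm, ← add_mul, perDensity]
      refine mul_le_mul' ?_ le_rfl
      have h1 : ENNReal.ofReal |fibre F p.1 t - fibre F p.2 τ| ≤ 1 :=
        ENNReal.ofReal_le_one.2 (abs_fibre_sub_le F _ _ _ _)
      refine h1.trans ?_
      have hm' : (p.1, t) ∈ cylinder Ω M ∨ (p.2, τ) ∈ cylinder Ω M := by
        by_contra hc
        exact hm ⟨fun h => hc (Or.inl h), fun h => hc (Or.inr h)⟩
      rcases hm' with h | h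
      · rw [hI, Set.indicator_of_mem h.2]
        exact le_self_add
      · rw [hI, Set.indicator_of_mem h.2]
        exact le_add_self
    · rw [Set.indicator_of_notMem hm]
      exact zero_le
  have hkint := lintegral_fibreKernel hn hs (norm_pos_iff.2 (sub_ne_zero.2 hp))
  have hIint : ∫⁻ t, I t = ENNReal.ofReal (2 * M) := by
    rw [hI, lintegral_indicator_const measurableSet_Ioo, one_mul, Real.volume_Ioo]
    congr 1
    ring
  have j1 : ∫⁻ t, ∫⁻ τ, I t * k (t - τ) = (∫⁻ t, I t) * ∫⁻ h, k h := by
    rw [← lintegral_mul_const _ hIm]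
    refine lintegral_congr fun t => ?_
    rw [lintegral_const_mul _ (by fun_prop), lintegral_sub_left_eq_self k t]
  have j2 : ∫⁻ t, ∫⁻ τ, I τ * k (t - τ) = (∫⁻ t, I t) * ∫⁻ h, k h := by
    rw [lintegral_lintegral_swap (Measurable.aemeasurable (by
      unfold Function.uncurry
      fun_prop)), ← lintegral_mul_const _ hIm]
    refine lintegral_congr fun τ => ?_
    rw [lintegral_const_mul _ (by fun_prop), lintegral_sub_right_eq_self k τ]
  calc fibrePart s F (perRegion (cylinder Ω M)) p
      ≤ ∫⁻ t, ∫⁻ τ, (I t * k (t - τ) + I τ * k (t - τ)) :=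
        lintegral_mono fun t => lintegral_mono fun τ => hle t τ
    _ = (∫⁻ t, ∫⁻ τ, I t * k (t - τ)) + ∫⁻ t, ∫⁻ τ, I τ * k (t - τ) := by
        have m1 : Measurable fun z : ℝ × ℝ => I z.1 * k (z.1 - z.2) := by fun_prop
        rw [← lintegral_add_left m1.lintegral_prod_right']
        refine lintegral_congr fun t => ?_
        rw [← lintegral_add_left (by fun_prop)]
    _ = _ := by
        have := gMass_nonneg n s
        rw [j1, j2, hIint, hkint, ← ENNReal.ofReal_mul (by positivity),
          ← ENNReal.ofReal_mul (by positivity), ← ENNReal.ofReal_add (by positivity)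
            (by positivity)]
        congr 1
        ring

theorem fracPer_subgraph_lt_top (hn : 1 ≤ n) (hs : 0 < s) (hs1 : s < 1) (hΩ : IsOpen Ω)
    (hb : Bornology.IsBounded Ω) (hL : HasLipschitzBoundary Ω) (hu : u ∈ W s Ω)
    (hum : Measurable u) (hM : 0 ≤ M) :
    fracPer s (subgraph u Set.univ) (cylinder Ω M) < ⊤ := by
  have hΩm := hΩ.measurableSet
  have hEm := measurableSet_subgraph_univ hum
  have hR : MeasurableSet (perRegion (cylinder Ω M)) :=
    measurableSet_perRegion (hΩm.prod measurableSet_Ioo)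
  -- The function `1_Ω` turns the Hardy inequality into a bound for the kernel on `Q(Ω) ∖ (Ω × Ω)`.
  set e : Rn n → ℝ := Ω.indicator fun _ => 1 with he
  have hem : Measurable e := measurable_const.indicator hΩm
  have heW : e ∈ W s Ω := by
    refine W_congr (const_mem_W hb 1) ?_
    filter_upwards [ae_restrict_mem hΩm] with x hx
    rw [he, Set.indicator_of_mem hx]
  have hfin := lintegral_Q_gagDensity_lt_top hn hs hs1 hΩ hb hL heW hem.aemeasurable
    (Filter.Eventually.of_forall fun x hx => by rw [he, Set.indicator_of_notMem hx])
  rw [fracPer_eq hEm hΩm]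
  have hle : ∀ᵐ p ∂(volume.restrict (Q Ω)),
      fibrePart s (subgraph u Set.univ) (perRegion (cylinder Ω M)) p ≤
        (Ω ×ˢ Ω).indicator (fun p => ENNReal.ofReal (fibreArea s u p)) p +
          ENNReal.ofReal (4 * M * gMass n s) * gagDensity s e p := by
    filter_upwards [ae_restrict_of_ae (ae_ne_diagonal hn), ae_restrict_mem (measurableSet_Q hΩm)]
      with p hp hpQ
    by_cases hpΩ : p ∈ Ω ×ˢ Ω
    · rw [Set.indicator_of_mem hpΩ, ← interaction_subgraph hn hs u hp,
        ← fibrePart_add_compl hEm hR, add_assoc]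
      exact le_self_add
    · have hd : |e p.1 - e p.2| = 1 := by
        have h1 : p.1 ∈ Ω ∨ p.2 ∈ Ω := by
          by_contra hc
          exact hpQ ⟨fun h => hc (Or.inl h), fun h => hc (Or.inr h)⟩
        rcases h1 with h | h
        · have h2 : p.2 ∉ Ω := fun h2 => hpΩ ⟨h, h2⟩
          simp [he, h, h2]
        · have h2 : p.1 ∉ Ω := fun h2 => hpΩ ⟨h2, h⟩
          simp [he, h, h2]
      rw [Set.indicator_of_notMem hpΩ, zero_add, gagDensity, hd]
      exact fibrePart_le hn hs hM _ hp
  refine lt_of_le_of_lt (lintegral_mono_ae hle) ?_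
  have hgm : AEMeasurable (gagDensity s e) (volume.restrict (Q Ω)) :=
    (aemeasurable_gagDensity hem.aemeasurable hem.aemeasurable).restrict
  rw [lintegral_add_right' _ (hgm.const_mul _), lintegral_const_mul' _ _ ENNReal.ofReal_ne_top]
  refine ENNReal.add_lt_top.2 ⟨?_, ENNReal.mul_lt_top ENNReal.ofReal_lt_top hfin⟩
  refine lt_of_le_of_lt (setLIntegral_le_lintegral _ _) ?_
  rw [lintegral_indicator (hΩm.prod hΩm)]
  exact lintegral_fibreArea_lt_top hn hs hs1 hΩm hb hu

end NonlocalObstacle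

/-! ### Minimality of the subgraph -/

namespace NonlocalObstacle

variable {n : ℕ} {s M : ℝ} {Ω A : Set (Rn n)} {φ ψ u : Rn n → ℝ} {E F : Set (RnSucc n)}

/-- Finite perimeter of `F` makes the area of its rearrangement finite in `Ω × Ω`. -/
theorem gagliardo_rearr_lt_top (hn : 1 ≤ n) (hs : 0 < s) (hs1 : s < 1) (hΩ : MeasurableSet Ω)
    (hb : Bornology.IsBounded Ω) (hu : u ∈ W s Ω) (hum : Measurable u) (hF : MeasurableSet F)
    (hfib : ∀ᵐ x, FibresAgree (subgraph u Set.univ) F (cylinder Ω M) x)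
    (hfin : fracPer s F (cylinder Ω M) < ⊤) : gagliardo s Ω (rearr F u) < ⊤ := by
  have hR : MeasurableSet (perRegion (cylinder Ω M)) :=
    measurableSet_perRegion (hΩ.prod measurableSet_Ioo)
  refine gagliardo_lt_top_of_area hn hs1 hΩ hb (measurable_rearr hF hum).aemeasurable ?_
  have hle : ∀ᵐ p : Rn n × Rn n,
      ENNReal.ofReal (GG n s ((rearr F u p.1 - rearr F u p.2) / ‖p.1 - p.2‖) /
        ‖p.1 - p.2‖ ^ ((n : ℝ) - 1 + s)) ≤
      fibrePart s F (perRegion (cylinder Ω M)) p + ENNReal.ofReal (fibreArea s u p) := by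
    filter_upwards [ae_ne_diagonal hn, ae_fibresAgree_pair hfib] with p hp hp'
    refine le_trans (ENNReal.ofReal_le_ofReal ?_) (le_add_self.trans
      (fibrePart_add_fibreArea_le hn hs hΩ hum hF hp hp'.1 hp'.2))
    have := gMoment_nonneg n s
    have := GG_nonneg n s ((rearr F u p.1 - rearr F u p.2) / ‖p.1 - p.2‖)
    have h1 : 0 ≤ GG n s ((rearr F u p.1 - rearr F u p.2) / ‖p.1 - p.2‖) /
        ‖p.1 - p.2‖ ^ ((n : ℝ) - 1 + s) := by positivity
    have h2 : 0 ≤ gMoment n s / ‖p.1 - p.2‖ ^ ((n : ℝ) - 1 + s) := by positivity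
    unfold fibreArea
    linarith
  refine lt_of_le_of_lt (lintegral_mono_ae (ae_restrict_of_ae hle)) ?_
  rw [lintegral_add_left (measurable_fibrePart hF hR)]
  refine ENNReal.add_lt_top.2 ⟨?_, lintegral_fibreArea_lt_top hn hs hs1 hΩ hb hu⟩
  rw [fracPer_eq hF hΩ] at hfin
  refine lt_of_le_of_lt (lintegral_mono_set ?_) hfin
  intro p hp hc
  exact hc.1 hp.1

/-- The rearrangement of a competitor of finite perimeter is a competitor in the functional problem.
-/
theorem rearr_mem_WObs (hn : 1 ≤ n) (hs : 0 < s) (hs1 : s < 1) (hΩ : MeasurableSet Ω)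
    (hb : Bornology.IsBounded Ω) (hu : u ∈ WObs s Ω A φ ψ) (hum : Measurable u)
    (hF : MeasurableSet F) (hM : 0 ≤ M)
    (hfib : ∀ᵐ x, FibresAgree (subgraph u Set.univ) F (cylinder Ω M) x)
    (hψ : subgraph ψ A ≤ᵐ[volume] F) (hfin : fracPer s F (cylinder Ω M) < ⊤) :
    rearr F u ∈ WObs s Ω A φ ψ := by
  refine ⟨⟨?_, gagliardo_rearr_lt_top hn hs hs1 hΩ hb hu.1 hum hF hfib hfin⟩, ?_, ?_⟩
  · have h1 : IntegrableOn (fun x => rearr F u x - u x) Ω := by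
      refine Integrable.mono' (integrableOn_const (C := 2 * M) hb.measure_lt_top.ne)
        ((measurable_rearr hF hum).sub hum).aestronglyMeasurable ?_
      filter_upwards [ae_restrict_of_ae hfib] with x hx
      exact hx.abs_rearr_sub_le hM
    refine (h1.add hu.1.1).congr (Filter.Eventually.of_forall fun x => ?_)
    simp
  · filter_upwards [hu.2.1, hfib] with x hx hx' hxΩ
    rw [hx'.rearr_eq hxΩ, hx hxΩ]
  · have h1 : ∀ᵐ q : Rn n × ℝ ∂(volume.prod volume), q ∈ subgraph ψ A → q ∈ F := hψ
    filter_upwards [hfib, Measure.ae_ae_of_ae_prod h1] with x hx hx' hxA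
    refine hx.le_rearr hF ?_
    filter_upwards [hx'] with t ht htψ
    exact ht ⟨hxA, htψ⟩

/-- For measurable sets, the subgraph of a solution has less perimeter than any competitor: the
functional at the rearranged competitor mediates between the two. -/
theorem SolvesObstacle.fracPer_subgraph_le (hn : 1 ≤ n) (hs : 0 < s) (hs1 : s < 1)
    (hΩ : MeasurableSet Ω) (hb : Bornology.IsBounded Ω) (hu : SolvesObstacle s Ω A φ ψ u)
    (hum : Measurable u) (hF : MeasurableSet F) (hM : 0 ≤ M)
    (hFE : (F \ cylinder Ω M : Set (RnSucc n)) =ᵐ[volume]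
      (subgraph u Set.univ \ cylinder Ω M : Set (RnSucc n)))
    (hψ : subgraph ψ A ≤ᵐ[volume] F) :
    fracPer s (subgraph u Set.univ) (cylinder Ω M) ≤ fracPer s F (cylinder Ω M) := by
  rcases eq_or_ne (fracPer s F (cylinder Ω M)) ⊤ with htop | htop
  · rw [htop]
    exact le_top
  have hR : MeasurableSet (perRegion (cylinder Ω M)) :=
    measurableSet_perRegion (hΩ.prod measurableSet_Ioo)
  have hfib := ae_fibresAgree hFE
  obtain ⟨hint, hle⟩ := hu.2 _ (rearr_mem_WObs hn hs hs1 hΩ hb hu.1 hum hF hM hfib hψ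
    (lt_top_iff_ne_top.2 htop))
  rw [fracPer_eq (measurableSet_subgraph_univ hum) hΩ, fracPer_eq hF hΩ]
  have hpt : ∀ᵐ p ∂(volume.restrict (Q Ω)), _ := ae_restrict_of_ae
    ((ae_ne_diagonal hn).and (ae_fibresAgree_pair hfib) |>.mono fun p hp =>
      fibrePart_add_areaDiff_le hn hs hΩ hum hF hp.1 hp.2.1 hp.2.2)
  have h := lintegral_mono_ae hpt
  rw [lintegral_add_left (measurable_fibrePart (measurableSet_subgraph_univ hum) hR),
    lintegral_add_left (measurable_fibrePart hF hR)] at h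
  have hi : Integrable (fun p => 2 * areaDiff s u (rearr F u) p) (volume.restrict (Q Ω)) :=
    hint.const_mul 2
  have hi1 := hi.lintegral_lt_top
  have hi2 := hi.neg.lintegral_lt_top
  have hval := integral_eq_lintegral_pos_part_sub_lintegral_neg_part hi
  rw [integral_const_mul] at hval
  have hcmp : ∫⁻ p in Q Ω, ENNReal.ofReal (2 * areaDiff s u (rearr F u) p) ≤
      ∫⁻ p in Q Ω, ENNReal.ofReal (-(2 * areaDiff s u (rearr F u) p)) :=
    (ENNReal.toReal_le_toReal hi1.ne hi2.ne).1 (by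
      simp only [Pi.neg_apply]
      linarith)
  exact (ENNReal.add_le_add_iff_right hi1.ne).1 ((add_le_add_right hcmp _).trans h)

theorem fracPer_congr (h : E =ᵐ[volume] F) (O : Set (RnSucc n)) :
    fracPer s E O = fracPer s F O := by
  have f1 := Measure.quasiMeasurePreserving_fst (μ := (volume : Measure (RnSucc n)))
    (ν := (volume : Measure (RnSucc n)))
  have f2 := Measure.quasiMeasurePreserving_snd (μ := (volume : Measure (RnSucc n)))
    (ν := (volume : Measure (RnSucc n)))
  have hi := indicator_ae_eq_of_ae_eq_set (f := fun _ : RnSucc n => (1 : ℝ)) h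
  refine lintegral_congr_ae (ae_restrict_of_ae ?_)
  filter_upwards [f1.ae hi, f2.ae hi] with p h1 h2
  rw [h1, h2]

theorem subgraph_congr {v : Rn n → ℝ} (h : u =ᵐ[volume] v) :
    subgraph u Set.univ =ᵐ[volume] subgraph v Set.univ := by
  have f1 := Measure.quasiMeasurePreserving_fst (μ := (volume : Measure (Rn n)))
    (ν := (volume : Measure ℝ))
  refine Filter.eventuallyEq_set.2 ?_
  filter_upwards [f1.ae h] with q hq
  simp [subgraph, hq]

theorem SolvesObstacle.congr {v : Rn n → ℝ} (hu : SolvesObstacle s Ω A φ ψ u)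
    (h : u =ᵐ[volume] v) : SolvesObstacle s Ω A φ ψ v := by
  refine ⟨WObs_congr hu.1 h, fun w hw => ?_⟩
  have hc : areaDiff s u w =ᵐ[volume.restrict (Q Ω)] areaDiff s v w :=
    ae_restrict_of_ae (areaDiff_congr_ae h (Filter.EventuallyEq.refl _ w))
  obtain ⟨h1, h2⟩ := hu.2 w hw
  exact ⟨h1.congr hc, by rwa [← integral_congr_ae hc]⟩

theorem SolvesObstacle.solvesGeometricObstacle (hn : 1 ≤ n) (hs : 0 < s) (hs1 : s < 1)
    (hΩ : IsOpen Ω) (hb : Bornology.IsBounded Ω) (hL : HasLipschitzBoundary Ω)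
    (hφ : AEMeasurable φ (volume.restrict Ωᶜ)) (hu : SolvesObstacle s Ω A φ ψ u) :
    SolvesGeometricObstacle s Ω A φ ψ (subgraph u Set.univ) := by
  have f1 := Measure.quasiMeasurePreserving_fst (μ := (volume : Measure (Rn n)))
    (ν := (volume : Measure ℝ))
  have hua := WObs_aemeasurable hΩ.measurableSet hφ hu.1
  set u' := hua.mk u with hu'
  have huu : u =ᵐ[volume] u' := hua.ae_eq_mk
  have hum : Measurable u' := hua.measurable_mk
  have hE := subgraph_congr huu
  have hsol := hu.congr huu
  refine ⟨(measurableSet_subgraph_univ hum).nullMeasurableSet.congr hE.symm, ?_, ?_,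
    fun M hM _ => ⟨?_, fun F hF hFE hψF => ?_⟩⟩
  · refine Filter.eventuallyEq_set.2 ?_
    filter_upwards [f1.ae hu.1.2.1] with q hq
    by_cases hqΩ : q.1 ∈ Ω
    · simp [infCylinder, hqΩ]
    · simp [subgraph, infCylinder, hqΩ, hq hqΩ]
  · filter_upwards [f1.ae hu.1.2.2] with q hq hqA
    exact ⟨Set.mem_univ _, hqA.2.trans_le (hq hqA.1)⟩
  · rw [fracPer_congr hE]
    exact fracPer_subgraph_lt_top hn hs hs1 hΩ hb hL hsol.1.1 hum hM
  · obtain ⟨F', -, hF', hFF⟩ := hF.exists_measurable_superset_ae_eq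
    rw [fracPer_congr hE, ← fracPer_congr hFF]
    have hO : (cylinder Ω M) =ᵐ[volume] cylinder Ω M := Filter.EventuallyEq.rfl
    exact hsol.fracPer_subgraph_le hn hs hs1 hΩ.measurableSet hb hum hF' hM
      ((hFF.diff hO).trans (hFE.trans (hE.diff hO))) (hψF.trans hFF.symm.le)

theorem ae_abs_le_of_memLp_top {f : Rn n → ℝ} {S : Set (Rn n)} (hS : MeasurableSet S)
    (hf : MemLp f ⊤ (volume.restrict S)) : ∃ K : ℝ, 0 ≤ K ∧ ∀ᵐ x, x ∈ S → |f x| ≤ K := by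
  refine ⟨(eLpNorm f ⊤ (volume.restrict S)).toReal, ENNReal.toReal_nonneg, ?_⟩
  rw [← ae_restrict_iff' hS]
  have h := ae_le_eLpNormEssSup (f := f) (μ := volume.restrict S)
  filter_upwards [h] with x hx
  rw [← eLpNorm_exponent_top] at hx
  have := ENNReal.toReal_mono hf.2.ne hx
  rwa [toReal_enorm, Real.norm_eq_abs] at this

end NonlocalObstacle

theorem proposition3p2 (n : ℕ) (hn : 1 ≤ n) (s : ℝ) (hs0 : 0 < s) (hs1 : s < 1) :
    ∃ Θ : ℝ, 1 < Θ ∧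
      ∀ (Ω A : Set (Rn n)) (φ ψ : Rn n → ℝ),
        IsOpen Ω → Bornology.IsBounded Ω → HasLipschitzBoundary Ω →
        IsOpen A → A ⊆ Ω →
        MemLp ψ ⊤ (volume.restrict A) →
        AEMeasurable φ (volume.restrict Ωᶜ) →
        MemLp φ ⊤ (volume.restrict (nbhd Ω (Θ * Metric.diam Ω) \ Ω)) →
        (∃ u, SolvesObstacle s Ω A φ ψ u ∧ ∀ v, SolvesObstacle s Ω A φ ψ v → v =ᵐ[volume] u) ∧
        ∀ u, SolvesObstacle s Ω A φ ψ u →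
          SolvesGeometricObstacle s Ω A φ ψ (subgraph u Set.univ) := by
  obtain ⟨Θ, hΘ4, hΘ⟩ := exists_width n hs0
  refine ⟨Θ, by linarith, fun Ω A φ ψ hΩ hb hL hA hAΩ hψ hφm hφ => ⟨?_, fun u hu =>
    hu.solvesGeometricObstacle hn hs0 hs1 hΩ hb hL hφm⟩⟩
  have hex : ∃ u, SolvesObstacle s Ω A φ ψ u := by
    rcases Ω.eq_empty_or_nonempty with rfl | hne
    · exact ⟨φ, exists_solution_of_empty s A φ ψ hAΩ⟩
    · obtain ⟨M, hM, hφM⟩ := ae_abs_le_of_memLp_top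
        ((measurableSet_nbhd Ω _).diff hΩ.measurableSet) hφ
      obtain ⟨K, -, hψK⟩ := ae_abs_le_of_memLp_top hA.measurableSet hψ
      exact exists_solution_of_nonempty hn hs0 hs1 hΘ4 hΘ hΩ hb hne hL hAΩ hφm hM hφM hψK
  obtain ⟨u, hu⟩ := hex
  exact ⟨u, hu, fun v hv => hu.unique hn hΩ hb hv⟩
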